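/- **Setting.** Let $X$ be a classical affine type of rank $l$: $A_l^{(1)}$ ($l\ge1$), $A_{2l-1}^{(2)}$ ($l\ge3$), $A_{2l}^{(2)}$ ($l\ge1$), $B_l^{(1)}$ ($l\ge3$), $C_l^{(1)}$ ($l\ge2$), $D_l^{(1)}$ ($l\ge4$) or $D_{l+1}^{(2)}$ ($l\ge2$), and let $0\le j\le l$. *Abaci.* A whole abacus is a set of integers ("beads") that is bounded above and contains all sufficiently small integers; a half $k$ abacus is a set of integers $\ge k$ that is bounded above. The abacus of $\Lambda_j$, written $(\varnothing,j)$ in all cases, is the following. For $X=A_l^{(1)},C_l^{(1)}$, and whenever the dual labels satisfy $a_j^\vee/a_0^\vee=2$ (that is, $2\le j\le l$ for $A_{2l-1}^{(2)}$, $1\le j\le l$ for $A_{2l}^{(2)}$, $2\le j\le l-1$ for $B_l^{(1)}$, $2\le j\le l-2$ for $D_l^{(1)}$, $1\le j\le l-1$ for $D_{l+1}^{(2)}$), it is the whole abacus $\mathbb Z_{<j}$. In the remaining cases it is a half abacus: for $j=0$ the half $0$ abacus $\varnothing$; for $j=1$ (types $A_{2l-1}^{(2)},B_l^{(1)},D_l^{(1)}$)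 the half $0$ abacus $\{0\}$; for $X=D_l^{(1)}$ the half $l$ abacus $\{l\}$ if $j=l-1$ and the half $l$ abacus $\varnothing$ if $j=l$; for $X=B_l^{(1)},D_{l+1}^{(2)}$ and $j=l$ the half $l+1$ abacus $\varnothing$. *Moves.* For $X\ne A_l^{(1)}$ label the integers periodically, starting with label $1$ at position $0$, by $1,2,\dots,l,(l+1),-l,\dots,-1,(0)$, where the label $l+1$ is used only for $B_l^{(1)},D_{l+1}^{(2)}$ and the label $0$ only for $A_{2l}^{(2)},D_{l+1}^{(2)}$. Write $(i,2k)$ and $(-i,2k+1)$, $1\le i\le l$, for the positions labelled $i$ and $-i$ in the $k$-th period. The elementary $f_i$-moves, each taking a bead to an empty position (both on the abacus), are, for all $k\in\mathbb Z$: for $0<i<l$: $(i,2k)\to(i+1,2k)$ and $(-i-1,2k+1)\to(-i,2k+1)$; for $i=0$: $(-1,2k-1)\to(1,2k)$ if $X=C_l^{(1)},A_{2l}^{(2)},D_{l+1}^{(2)}$, and $(-1,2k-1)\to(2,2k)$, $(-2,2k-1)\to(1,2k)$ if $X=A_{2l-1}^{(2)},B_l^{(1)},D_l^{(1)}$; for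 $i=l$: $(l,2k)\to(1-l,2k+1)$, $(l-1,2k)\to(-l,2k+1)$ if $X=D_l^{(1)}$, and $(l,2k)\to(-l,2k+1)$ otherwise. On a half $0$ abacus there is one further $f_0$-move: set a bead at $(1,0)$ if it is empty ($X=A_{2l}^{(2)},D_{l+1}^{(2)}$), respectively set beads at $(1,0)$ and $(2,0)$ if both are empty ($X=A_{2l-1}^{(2)},B_l^{(1)},D_l^{(1)}$). On a half $l$ or $l+1$ abacus there is one further $f_l$-move: set a bead at $(-l,1)$ if it is empty ($X=B_l^{(1)},D_{l+1}^{(2)}$), respectively set beads at $(-l,1)$ and $(1-l,1)$ if both are empty ($X=D_l^{(1)}$). For $X=A_l^{(1)}$ the $f_i$-moves ($0\le i\le l$) take a bead from $x$ to the empty position $x+1$, for $x+1\equiv i \pmod{l+1}$. The abacus $\sigma_i(B)$ is obtained from $B$ by doing simultaneously all possible $f_i$-moves and the inverses of all $f_i$-moves that can be undone. A *$j$-core abacus* is an abacus of affine type $X$ (one obtained from the abacus of $\Lambda_j$ by finitely many $f_i$-moves, $0\le i\le l$) that lies in the orbit of the abacus of $\Lambda_j$ under $\sigma_0,\dots,\sigma_l$.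 *Weyl group.* Let $V$ be the Euclidean space spanned by the simple roots $\alpha_1,\dots,\alpha_l$ of the finite root system obtained by deleting node $0$ of $X$ (type $A_l$ for $A_l^{(1)}$; $B_l$ for $B_l^{(1)},D_{l+1}^{(2)}$; $C_l$ for $C_l^{(1)},A_{2l-1}^{(2)},A_{2l}^{(2)}$; $D_l$ for $D_l^{(1)}$; in standard coordinates), and let $\theta=\delta-a_0\alpha_0=\sum_{i=1}^l a_i\alpha_i$, with $a_i$ the labels of $X$. Let $\sigma_i$ ($1\le i\le l$) be the reflection of $V$ in $(v,\alpha_i)=0$ and $\sigma_0$ the reflection in $(v,\theta)=1$; they generate the affine Weyl group $W$, with length function $\ell$. Put $W^j=\{w\in W\mid \ell(w\sigma_i)>\ell(w)\text{ for all } i\ne j\}$, the minimal-length representatives of the cosets $wW_j$, $W_j=\langle\sigma_i\mid i\neq j\rangle$. Put $A_i^+=\{v\mid(v,\alpha_i)>0\}$ for $1\le i\le l$, $A_0^+=\{v\mid(v,\theta)<1\}$, $\mathcal A_e=\bigcap_{i}A_i^+$, $\mathcal A_w=w\mathcal A_e$ (the alcoves), and $\mathcal C_j=\bigcap_{i\ne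 j}A_i^+$ (the generalized Tits cone). **Lemma.** The operators $\sigma_i$ on abaci define an action of $W$ on the set of all whole abaci (respectively half $k$ abaci) when the abacus of $\Lambda_j$ is a whole (respectively half $k$) abacus. For every $j$-core abacus $(\lambda,j)$ there is a unique $w\in W^j$ with $w(\varnothing,j)=(\lambda,j)$. Moreover $w\mapsto w(\varnothing,j)$ is a bijection from $W^j$ onto the set of $j$-core abaci, and $w(\varnothing,j)\mapsto\mathcal A_{w^{-1}}$ ($w\in W^j$) is a well-defined bijection from the set of $j$-core abaci onto the set of alcoves $\mathcal A_u$, $u\in W$, contained in $\mathcal C_j$. -/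

import Mathlib

namespace CoreAbacus

/-- The classical affine types. For rank `l` the constructors stand for
`A_l^{(1)}`, `A_{2l-1}^{(2)}`, `A_{2l}^{(2)}`, `B_l^{(1)}`, `C_l^{(1)}`, `D_l^{(1)}`,
`D_{l+1}^{(2)}`, in this order. -/
inductive AffineType
  | A1
  | A2odd
  | A2even
  | B1
  | C1
  | D1
  | D2

/-- The ranks for which the type is one of the classical affine Cartan types. -/
def AffineType.Admissible : AffineType → ℕ → Prop
  | .A1, l => 1 ≤ l
  | .A2odd, l => 3 ≤ l
  | .A2even, l => 1 ≤ l
  | .B1, l => 3 ≤ l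
  | .C1, l => 2 ≤ l
  | .D1, l => 4 ≤ l
  | .D2, l => 2 ≤ l

/-! ### Positions -/

/-- `1` if `0` is an `l`-index (the arrow of the Dynkin diagram points from `1` to `0`),
and `0` otherwise. -/
def zeroIdx : AffineType → ℤ
  | .A2even => 1
  | .D2 => 1
  | _ => 0

/-- `1` if `l + 1` is an `l`-index (the arrow of the Dynkin diagram points from `l - 1` to `l`),
and `0` otherwise. -/
def topIdx : AffineType → ℤ
  | .B1 => 1
  | .D2 => 1
  | _ => 0

/-- The number of `l`-indices. The positions are labelled periodically by
`1, 2, …, l, (l+1), -l, …, -2, -1, (0)`, where `l+1` and `0` occur only if they are `l`-indices,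
and where position `0` has label `1`. -/
def period (X : AffineType) (l : ℕ) : ℤ := 2 * l + zeroIdx X + topIdx X

/-- For `1 ≤ i ≤ l`, the position `(i, 2k)`: the one with label `i` in the `k`-th period. -/
def posPlus (X : AffineType) (l : ℕ) (k i : ℤ) : ℤ := k * period X l + i - 1

/-- For `1 ≤ i ≤ l`, the position `(-i, 2k+1)`: the one with label `-i` in the `k`-th period. -/
def posMinus (X : AffineType) (l : ℕ) (k i : ℤ) : ℤ := (k + 1) * period X l - zeroIdx X - i

/-! ### Abaci -/

/-- An abacus (a `β`-set). For `lo = ⊥` it is a whole abacus, i.e. a two-sided `β`-set: a set of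
integers that is bounded above and contains all sufficiently small integers. For `lo = k` it is a
half `k` abacus, i.e. a one-sided `β`-set: a set of integers `≥ k` that is bounded above. -/
@[ext]
structure Abacus (lo : WithBot ℤ) where
  /-- The positions of the beads. -/
  beads : Set ℤ
  lo_le : ∀ x ∈ beads, lo ≤ (x : WithBot ℤ)
  bddAbove : BddAbove beads
  bddBelow : lo = ⊥ → BddBelow beadsᶜ

/-- Where the abacus of the fundamental weight `Λ_j` starts: it is a whole abacus for
`A_l^{(1)}`, `C_l^{(1)}` and whenever `a_j^∨ / a_0^∨ = 2`; otherwise it is a half abacus. -/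
def start : AffineType → ℕ → ℕ → WithBot ℤ
  | .A1, _, _ => ⊥
  | .C1, _, _ => ⊥
  | .A2odd, _, j => if j ≤ 1 then ((0 : ℤ) : WithBot ℤ) else ⊥
  | .A2even, _, j => if j = 0 then ((0 : ℤ) : WithBot ℤ) else ⊥
  | .B1, l, j => if j ≤ 1 then ((0 : ℤ) : WithBot ℤ) else
      if j = l then (((l : ℤ) + 1 : ℤ) : WithBot ℤ) else ⊥
  | .D1, l, j => if j ≤ 1 then ((0 : ℤ) : WithBot ℤ) else
      if l ≤ j + 1 then ((l : ℤ) : WithBot ℤ) else ⊥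
  | .D2, l, j => if j = 0 then ((0 : ℤ) : WithBot ℤ) else
      if j = l then (((l : ℤ) + 1 : ℤ) : WithBot ℤ) else ⊥

/-- The beads of the half abacus of `Λ_j` (in the cases where it is a half abacus): none, except
for the extra end node `1` of a fork at `0` and the extra end node `l - 1` of a fork at `l`. -/
def halfBeads : AffineType → ℕ → ℕ → Set ℤ
  | .A2odd, _, j => if j = 1 then {0} else ∅
  | .B1, _, j => if j = 1 then {0} else ∅
  | .D1, l, j => if j = 1 then {0} else if j + 1 = l then {(l : ℤ)} else ∅
  | _, _, _ => ∅

theorem halfBeads_bddAbove (X : AffineType) (l j : ℕ) : BddAbove (halfBeads X l j) := by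
  cases X <;> simp only [halfBeads] <;> (try split_ifs) <;> simp

theorem start_le_halfBeads (X : AffineType) (l j : ℕ) :
    ∀ x ∈ halfBeads X l j, start X l j ≤ (x : WithBot ℤ) := by
  intro x hx
  cases X <;> simp only [halfBeads, start] at * <;> (try split_ifs at *) <;>
    simp_all

/-- The abacus of `Λ_j`. When it is a whole abacus it is `(∅, j)`, with beads exactly at the
positions `< j`. -/
noncomputable def fundamentalAbacus (X : AffineType) (l j : ℕ) : Abacus (start X l j) := by
  classical
  exact
  { beads := if start X l j = ⊥ then Set.Iio (j : ℤ) else halfBeads X l j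
    lo_le := by
      intro x hx
      by_cases h : start X l j = ⊥
      · simp [h]
      · rw [if_neg h] at hx
        exact start_le_halfBeads X l j x hx
    bddAbove := by
      by_cases h : start X l j = ⊥
      · rw [if_pos h]; exact bddAbove_Iio
      · rw [if_neg h]; exact halfBeads_bddAbove X l j
    bddBelow := by
      intro h
      rw [if_pos h, Set.compl_Iio]
      exact bddBelow_Ici }

/-! ### The `f_i`-actions and the operators `σ_i` -/

/-- `Move X l lo i R A`: one of the elementary `f_i`-moves of type `X` and rank `l` for abaci
starting at `lo`; it removes the beads at the positions in `R` and sets beads at the positions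
in `A`. -/
inductive Move (X : AffineType) (l : ℕ) (lo : WithBot ℤ) : ℕ → Set ℤ → Set ℤ → Prop
  /-- Type `A_l^{(1)}`: position `x` to `x + 1`, where `x + 1 ≡ i` modulo `l + 1`. -/
  | typeA (i : ℕ) (x : ℤ) (hX : X = .A1) (hi : i ≤ l) (hx : x + 1 ≡ i [ZMOD ((l : ℤ) + 1)])
      (hlo : lo ≤ (x : WithBot ℤ)) : Move X l lo i {x} {x + 1}
  /-- `(i, 2k) → (i+1, 2k)`. -/
  | up (i : ℕ) (k : ℤ) (hX : X ≠ .A1) (h0 : 0 < i) (hl : i < l)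
      (hlo : lo ≤ (posPlus X l k i : WithBot ℤ)) :
      Move X l lo i {posPlus X l k i} {posPlus X l k (i + 1)}
  /-- `(-i-1, 2k+1) → (-i, 2k+1)`. -/
  | down (i : ℕ) (k : ℤ) (hX : X ≠ .A1) (h0 : 0 < i) (hl : i < l)
      (hlo : lo ≤ (posMinus X l k (i + 1) : WithBot ℤ)) :
      Move X l lo i {posMinus X l k (i + 1)} {posMinus X l k i}
  /-- `(-1, 2k-1) → (1, 2k)`. -/
  | zero (k : ℤ) (hX : X = .C1 ∨ X = .A2even ∨ X = .D2)
      (hlo : lo ≤ (posMinus X l (k - 1) 1 : WithBot ℤ)) :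
      Move X l lo 0 {posMinus X l (k - 1) 1} {posPlus X l k 1}
  /-- `(-1, 2k-1) → (2, 2k)`. -/
  | zeroFork₁ (k : ℤ) (hX : X = .A2odd ∨ X = .B1 ∨ X = .D1)
      (hlo : lo ≤ (posMinus X l (k - 1) 1 : WithBot ℤ)) :
      Move X l lo 0 {posMinus X l (k - 1) 1} {posPlus X l k 2}
  /-- `(-2, 2k-1) → (1, 2k)`. -/
  | zeroFork₂ (k : ℤ) (hX : X = .A2odd ∨ X = .B1 ∨ X = .D1)
      (hlo : lo ≤ (posMinus X l (k - 1) 2 : WithBot ℤ)) :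
      Move X l lo 0 {posMinus X l (k - 1) 2} {posPlus X l k 1}
  /-- `(l, 2k) → (-l, 2k+1)`. -/
  | last (k : ℤ) (hX : X = .A2odd ∨ X = .A2even ∨ X = .C1 ∨ X = .B1 ∨ X = .D2)
      (hlo : lo ≤ (posPlus X l k l : WithBot ℤ)) :
      Move X l lo l {posPlus X l k l} {posMinus X l k l}
  /-- `(l, 2k) → (1-l, 2k+1)`. -/
  | lastFork₁ (k : ℤ) (hX : X = .D1) (hlo : lo ≤ (posPlus X l k l : WithBot ℤ)) :
      Move X l lo l {posPlus X l k l} {posMinus X l k (l - 1)}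
  /-- `(l-1, 2k) → (-l, 2k+1)`. -/
  | lastFork₂ (k : ℤ) (hX : X = .D1) (hlo : lo ≤ (posPlus X l k (l - 1) : WithBot ℤ)) :
      Move X l lo l {posPlus X l k (l - 1)} {posMinus X l k l}
  /-- A half abacus starting at `(1, 0)`: a bead is set at the empty position `(1, 0)`. -/
  | newZero (hX : X = .A2even ∨ X = .D2) (hlo : lo = (posPlus X l 0 1 : WithBot ℤ)) :
      Move X l lo 0 ∅ {posPlus X l 0 1}
  /-- A half abacus starting at `(1, 0)`: beads are set at the empty positions
  `(1, 0)` and `(2, 0)`. -/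
  | newZeroFork (hX : X = .A2odd ∨ X = .B1 ∨ X = .D1)
      (hlo : lo = (posPlus X l 0 1 : WithBot ℤ)) :
      Move X l lo 0 ∅ {posPlus X l 0 1, posPlus X l 0 2}
  /-- A half abacus starting at `(-l, 1)`: a bead is set at the empty position `(-l, 1)`. -/
  | newLast (hX : X = .B1 ∨ X = .D2) (hlo : lo = (posMinus X l 0 l : WithBot ℤ)) :
      Move X l lo l ∅ {posMinus X l 0 l}
  /-- A half abacus starting at `(-l, 1)`: beads are set at the empty positions
  `(-l, 1)` and `(1-l, 1)`. -/
  | newLastFork (hX : X = .D1) (hlo : lo = (posMinus X l 0 l : WithBot ℤ)) :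
      Move X l lo l ∅ {posMinus X l 0 l, posMinus X l 0 (l - 1)}

variable {X : AffineType} {l : ℕ} {lo : WithBot ℤ}

theorem zeroIdx_nonneg (X : AffineType) : 0 ≤ zeroIdx X := by cases X <;> simp [zeroIdx]

theorem topIdx_nonneg (X : AffineType) : 0 ≤ topIdx X := by cases X <;> simp [topIdx]

theorem topIdx_le (X : AffineType) : topIdx X ≤ 1 := by cases X <;> simp [topIdx]

/-- A move either shifts one bead to the right by at most `3`, or sets beads near the start of a
half abacus. -/
theorem Move.shape {i : ℕ} {R A : Set ℤ} (h : Move X l lo i R A) :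
    (∃ x y : ℤ, R = {x} ∧ A = {y} ∧ lo ≤ (x : WithBot ℤ) ∧ x ≤ y ∧ y ≤ x + 3) ∨
    (R = ∅ ∧ lo ≠ ⊥ ∧ ∀ y ∈ A, lo ≤ (y : WithBot ℤ) ∧ y ≤ l + 3) := by
  have h0 := zeroIdx_nonneg X
  have h1 := topIdx_nonneg X
  have h2 := topIdx_le X
  have h3 : zeroIdx X ≤ 1 := by cases X <;> simp [zeroIdx]
  cases h with
  | typeA i x hX hi hx hlo => exact Or.inl ⟨_, _, rfl, rfl, hlo, by omega, by omega⟩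
  | up i k hX h0 hl hlo =>
    refine Or.inl ⟨_, _, rfl, rfl, hlo, ?_, ?_⟩ <;> simp only [posPlus] <;> omega
  | down i k hX h0 hl hlo =>
    refine Or.inl ⟨_, _, rfl, rfl, hlo, ?_, ?_⟩ <;> simp only [posMinus] <;> omega
  | zero k hX hlo =>
    refine Or.inl ⟨_, _, rfl, rfl, hlo, ?_, ?_⟩ <;>
      simp only [posMinus, posPlus, sub_add_cancel] <;> omega
  | zeroFork₁ k hX hlo =>
    have h4 : zeroIdx X = 0 := by rcases hX with rfl | rfl | rfl <;> rfl
    refine Or.inl ⟨_, _, rfl, rfl, hlo, ?_, ?_⟩ <;>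
      simp only [posMinus, posPlus, sub_add_cancel] <;> omega
  | zeroFork₂ k hX hlo =>
    have h4 : zeroIdx X = 0 := by rcases hX with rfl | rfl | rfl <;> rfl
    refine Or.inl ⟨_, _, rfl, rfl, hlo, ?_, ?_⟩ <;>
      simp only [posMinus, posPlus, sub_add_cancel] <;> omega
  | last k hX hlo =>
    refine Or.inl ⟨_, _, rfl, rfl, hlo, ?_, ?_⟩ <;>
      simp only [posMinus, posPlus, period, add_mul, one_mul] <;> omega
  | lastFork₁ k hX hlo =>
    refine Or.inl ⟨_, _, rfl, rfl, hlo, ?_, ?_⟩ <;>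
      simp only [posMinus, posPlus, period, add_mul, one_mul] <;> omega
  | lastFork₂ k hX hlo =>
    refine Or.inl ⟨_, _, rfl, rfl, hlo, ?_, ?_⟩ <;>
      simp only [posMinus, posPlus, period, add_mul, one_mul] <;> omega
  | newZero hX hlo =>
    refine Or.inr ⟨rfl, by simp [hlo], ?_⟩
    rintro y rfl
    exact ⟨hlo.le, by simp only [posPlus]; omega⟩
  | newZeroFork hX hlo =>
    refine Or.inr ⟨rfl, by simp [hlo], ?_⟩
    rintro y (rfl | rfl) <;> rw [hlo, WithBot.coe_le_coe] <;> simp only [posPlus] <;> omega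
  | newLast hX hlo =>
    refine Or.inr ⟨rfl, by simp [hlo], ?_⟩
    rintro y rfl
    exact ⟨hlo.le, by simp only [posMinus, period]; omega⟩
  | newLastFork hX hlo =>
    refine Or.inr ⟨rfl, by simp [hlo], ?_⟩
    rintro y (rfl | rfl) <;> rw [hlo, WithBot.coe_le_coe] <;>
      simp only [posMinus, period] <;> omega

/-- An `f_i`-action on the bead set `B`: the positions in `R` are occupied and those in `A` are
empty. -/
def Allowed (R A B : Set ℤ) : Prop := R ⊆ B ∧ Disjoint A B

/-- `C` is obtained from `B` by a single `f_i`-action. -/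
def FAction (X : AffineType) (l : ℕ) {lo : WithBot ℤ} (i : ℕ) (B C : Abacus lo) : Prop :=
  ∃ R A, Move X l lo i R A ∧ Allowed R A B.beads ∧ C.beads = (B.beads \ R) ∪ A

/-- The bead set obtained from `B` by doing all possible `f_i`-actions, and undoing all `f_i`-moves
that can be undone. (Different `f_i`-moves involve disjoint sets of positions.) -/
def sigmaBeads (X : AffineType) (l : ℕ) (lo : WithBot ℤ) (i : ℕ) (B : Set ℤ) : Set ℤ :=
  (B \ {x | ∃ R A, Move X l lo i R A ∧ (Allowed R A B ∧ x ∈ R ∨ Allowed A R B ∧ x ∈ A)}) ∪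
    {x | ∃ R A, Move X l lo i R A ∧ (Allowed R A B ∧ x ∈ A ∨ Allowed A R B ∧ x ∈ R)}

/-- The operator `σ_i` on abaci. -/
def sigma (X : AffineType) (l : ℕ) {lo : WithBot ℤ} (i : ℕ) (B : Abacus lo) : Abacus lo where
  beads := sigmaBeads X l lo i B.beads
  lo_le := by
    rintro x (hx | ⟨R, A, hm, hx⟩)
    · exact B.lo_le x hx.1
    · rcases hm.shape with ⟨a, b, rfl, rfl, h1, h2, h3⟩ | ⟨rfl, h1, h2⟩
      · have h4 : lo ≤ (b : WithBot ℤ) := h1.trans (WithBot.coe_le_coe.2 h2)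
        rcases hx with ⟨-, rfl⟩ | ⟨-, rfl⟩ <;> assumption
      · rcases hx with ⟨-, hx⟩ | ⟨-, hx⟩
        · exact (h2 x hx).1
        · exact hx.elim
  bddAbove := by
    obtain ⟨m, hm⟩ := B.bddAbove
    refine ⟨max (m + 3) (l + 3), ?_⟩
    rintro x (hx | ⟨R, A, hM, hx⟩)
    · have := hm hx.1
      exact le_max_of_le_left (by omega)
    · rcases hM.shape with ⟨a, b, rfl, rfl, h1, h2, h3⟩ | ⟨rfl, h1, h2⟩
      · rcases hx with ⟨h4, rfl⟩ | ⟨h4, rfl⟩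
        · have := hm (h4.1 rfl)
          exact le_max_of_le_left (by omega)
        · have := hm (h4.1 rfl)
          exact le_max_of_le_left (by omega)
      · rcases hx with ⟨-, hx⟩ | ⟨-, hx⟩
        · exact le_max_of_le_right (h2 x hx).2
        · exact hx.elim
  bddBelow := by
    intro hlo
    obtain ⟨m, hm⟩ := B.bddBelow hlo
    refine ⟨m - 3, fun x hx => ?_⟩
    have hx' : x ∉ sigmaBeads X l lo i B.beads := hx
    by_cases hB : x ∈ B.beads
    · have h5 : ∃ R A, Move X l lo i R A ∧
          (Allowed R A B.beads ∧ x ∈ R ∨ Allowed A R B.beads ∧ x ∈ A) := by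
        by_contra h
        exact hx' (Or.inl ⟨hB, h⟩)
      obtain ⟨R, A, hM, h6⟩ := h5
      rcases hM.shape with ⟨a, b, rfl, rfl, h1, h2, h3⟩ | ⟨rfl, h1, h2⟩
      · rcases h6 with ⟨h4, rfl⟩ | ⟨h4, rfl⟩
        · have := hm (Set.disjoint_singleton_left.1 h4.2)
          omega
        · have := hm (Set.disjoint_singleton_left.1 h4.2)
          omega
      · exact absurd hlo h1
    · have := hm hB
      omega

/-- An abacus of the affine type `X`: it is obtained from the abacus of `Λ_j` by `f_i`-actions. -/
def IsOfType (X : AffineType) (l j : ℕ) (B : Abacus (start X l j)) : Prop :=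
  Relation.ReflTransGen (fun C D => ∃ i ≤ l, FAction X l i C D) (fundamentalAbacus X l j) B

/-- A `j`-core abacus: an abacus of affine type `X` in the orbit of the abacus of `Λ_j` under
the operators `σ_0, …, σ_l`. -/
def IsCore (X : AffineType) (l j : ℕ) (B : Abacus (start X l j)) : Prop :=
  IsOfType X l j B ∧
    Relation.ReflTransGen (fun C D => ∃ i ≤ l, D = sigma X l i C) (fundamentalAbacus X l j) B

/-! ### The affine Weyl group -/

/-- The dimension of the Euclidean space in which the finite root system is written down. -/
def ambientDim : AffineType → ℕ → ℕ
  | .A1, l => l + 1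
  | _, l => l

/-- The standard basis vector `e_i`, `i = 1, 2, …`. -/
noncomputable def stdVec (n i : ℕ) : EuclideanSpace ℝ (Fin n) :=
  WithLp.toLp 2 (fun m => if (m : ℕ) + 1 = i then 1 else 0)

/-- The simple roots `α_1, …, α_l` of the finite root system obtained by deleting the node `0`. -/
noncomputable def simpleRootVec (X : AffineType) (l i : ℕ) :
    EuclideanSpace ℝ (Fin (ambientDim X l)) :=
  if i < l then stdVec _ i - stdVec _ (i + 1) else
    match X with
    | .A1 => stdVec _ l - stdVec _ (l + 1)
    | .B1 => stdVec _ l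
    | .D2 => stdVec _ l
    | .D1 => stdVec _ (l - 1) + stdVec _ l
    | .A2odd => (2 : ℝ) • stdVec _ l
    | .A2even => (2 : ℝ) • stdVec _ l
    | .C1 => (2 : ℝ) • stdVec _ l

/-- The Euclidean space `V`, spanned by the simple roots. -/
abbrev V (X : AffineType) (l : ℕ) : Submodule ℝ (EuclideanSpace ℝ (Fin (ambientDim X l))) :=
  Submodule.span ℝ (Set.range fun i : Fin l => simpleRootVec X l (i + 1))

/-- `simpleRoot X l i` is `α_{i+1}`, as an element of `V`. -/
noncomputable def simpleRoot (X : AffineType) (l : ℕ) (i : Fin l) : V X l :=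
  ⟨simpleRootVec X l (i + 1), Submodule.subset_span ⟨i, rfl⟩⟩

/-- The labels `a_1, …, a_l` of the affine Dynkin diagram. -/
def label : AffineType → ℕ → ℕ → ℕ
  | .A1, _, _ => 1
  | .A2odd, l, i => if i ≤ 1 ∨ i = l then 1 else 2
  | .A2even, l, i => if i = l then 1 else 2
  | .B1, _, i => if i ≤ 1 then 1 else 2
  | .C1, l, i => if i = 0 ∨ i = l then 1 else 2
  | .D1, l, i => if i ≤ 1 ∨ l ≤ i + 1 then 1 else 2
  | .D2, _, _ => 1

/-- `θ = δ - a_0 α_0 = a_1 α_1 + ⋯ + a_l α_l`. -/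
noncomputable def theta (X : AffineType) (l : ℕ) : V X l :=
  ∑ i : Fin l, (label X l (i + 1) : ℝ) • simpleRoot X l i

section Reflection

variable {E : Type*} [NormedAddCommGroup E] [InnerProductSpace ℝ E]

/-- The coroot `α^∨ = 2 α / (α, α)`. -/
noncomputable def coroot (α : E) : E := (2 / inner ℝ α α) • α

/-- The affine reflection `σ_{α, k}(v) = v - ((v, α) - k) α^∨` in the hyperplane `(v, α) = k`. -/
noncomputable def affReflection (α : E) (k : ℝ) : Equiv.Perm E :=
  Function.Involutive.toPerm (fun v => v - (inner ℝ v α - k) • coroot α) (by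
    intro v
    by_cases h : α = 0
    · simp [coroot, h]
    · have h2 : inner ℝ α α ≠ 0 := inner_self_ne_zero.2 h
      have h3 : inner ℝ (coroot α) α = 2 := by
        rw [coroot, real_inner_smul_left, div_mul_cancel₀ _ h2]
      simp only [inner_sub_left, real_inner_smul_left, h3]
      module)

end Reflection

/-- The generators `σ_0 = σ_{θ, 1}` and `σ_i = σ_{α_i, 0}` (`1 ≤ i ≤ l`), as affine
transformations of `V`. -/
noncomputable def genPerm (X : AffineType) (l : ℕ) : Fin (l + 1) → Equiv.Perm (V X l) :=
  Fin.cases (affReflection (theta X l) 1) (fun i => affReflection (simpleRoot X l i) 0)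

/-- The affine Weyl group `W`, generated by `σ_0, …, σ_l`. -/
noncomputable def W (X : AffineType) (l : ℕ) : Subgroup (Equiv.Perm (V X l)) :=
  Subgroup.closure (Set.range (genPerm X l))

/-- The generator `σ_i` of `W`. -/
noncomputable def gen (X : AffineType) (l : ℕ) (i : Fin (l + 1)) : W X l :=
  ⟨genPerm X l i, Subgroup.subset_closure ⟨i, rfl⟩⟩

/-- The length `ℓ(w)`: the least length of an expression of `w` in the generators. -/
noncomputable def length {X : AffineType} {l : ℕ} (w : W X l) : ℕ :=
  sInf {n | ∃ L : List (Fin (l + 1)), L.length = n ∧ (L.map (gen X l)).prod = w}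

/-- The (right) affine Grassmannian `W^j`. -/
def grassmannian (X : AffineType) (l : ℕ) (j : Fin (l + 1)) : Set (W X l) :=
  {w | ∀ i, i ≠ j → length w < length (w * gen X l i)}

/-! ### Alcoves -/

/-- The open half spaces `A_0^+ = {(v, θ) < 1}` and `A_i^+ = {(v, α_i) > 0}` (`1 ≤ i ≤ l`). -/
def halfSpace (X : AffineType) (l : ℕ) : Fin (l + 1) → Set (V X l) :=
  Fin.cases {v | inner ℝ v (theta X l) < 1} (fun i => {v | 0 < inner ℝ v (simpleRoot X l i)})

/-- The alcove `A_w = w A_e`, where the fundamental alcove `A_e` is the intersection of the `A_i^+`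
over all `i`. -/
def alcove {X : AffineType} {l : ℕ} (w : W X l) : Set (V X l) :=
  (w : Equiv.Perm (V X l)) '' ⋂ i, halfSpace X l i

/-- The generalized Tits cone `C_j`, the intersection of the `A_i^+` over all `i ≠ j`. -/
def titsCone (X : AffineType) (l : ℕ) (j : Fin (l + 1)) : Set (V X l) :=
  ⋂ i, ⋂ (_ : i ≠ j), halfSpace X l i

/-- The set of alcoves that lie in `C_j`. -/
def alcovesInCone (X : AffineType) (l : ℕ) (j : Fin (l + 1)) : Set (Set (V X l)) :=
  {C | (∃ w : W X l, C = alcove w) ∧ C ⊆ titsCone X l j}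

end CoreAbacus

namespace CoreAbacus

variable {X : AffineType} {l : ℕ}

/-! The proof reads the positions of an abacus as affine functionals on `V`. The position labelled
`i` or `-i` in period `k` is plus or minus the `i`-th coordinate, minus `k` times a fixed scale; the
labels `0` and `l+1` give constants; in type A the position `k(l+1)+r` is the coordinate `r+1` minus
`k`. The generators of `W` permute these functionals, and the elementary `f_i`-moves are the pairs
exchanged by the `i`-th generator, in increasing order. On a whole abacus `σ_i` is therefore the
permutation of positions induced by the generator. A half abacus is first completed below its start
by the complement of its mirror image under a reflection that commutes with `W`; the same
description then holds, and the moves that create beads are the pairs crossing the start. Hence `W`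
acts on abaci because it acts on functionals, and no relation between the `σ_i` has to be checked
(`mem_full_sigma`, `exists_action`).

The completed abacus of `Λ_j` consists of the functionals whose value at the `j`-th vertex of the
fundamental alcove exceeds a fixed level. Its image under `w` consists of those exceeding the level
at the image of the vertex (`mem_full_orbit`). The coordinates of the orbit of the vertex lie in a
discrete set, so the abacus determines the image of the vertex. The generators other than `σ_j` fix
the vertex, so every abacus in the orbit comes from an element of `W^j`. This element is unique: a
point of the cone `C_j` seen from the vertex starts inside the fundamental alcove, and `W` acts
freely on alcoves (`grassmannian_ext`).

Length is tied to geometry by `length_lt_mul_gen_iff`: multiplying `w` by `σ_i` on the right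
lengthens `w` exactly when the alcove of `w⁻¹` lies in `A_i^+`. This gives the bijection with
alcoves. It follows from the exchange condition, which rests on one fact about the types: a root,
that is, a difference of two functionals in the orbit of an exchanged pair, has constant sign on the
fundamental alcove (the field `sign`).

Finally, orbit elements are abaci of affine type. Along a reduced word each generator only performs
`f_k`-moves and undoes none (`not_allowed_of_length_lt`); these moves are finite in number and
disjoint, so they can be done one at a time. -/

theorem affReflection_involutive {E : Type*} [NormedAddCommGroup E] [InnerProductSpace ℝ E]
    (α : E) (k : ℝ) : Function.Involutive (affReflection α k) := by
  unfold affReflection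
  exact Function.Involutive.toPerm_involutive _

/-! ### The walls of the fundamental alcove -/

/-- The affine functional defining the `i`-th wall; it is positive on the half space `A_i^+`. -/
noncomputable def wallFun (X : AffineType) (l : ℕ) : Fin (l + 1) → V X l → ℝ :=
  Fin.cases (fun v => 1 - inner ℝ v (theta X l)) (fun i v => inner ℝ v (simpleRoot X l i))

/-- The gradient of the `i`-th wall functional. -/
noncomputable def wallVec (X : AffineType) (l : ℕ) : Fin (l + 1) → V X l :=
  Fin.cases (-theta X l) (simpleRoot X l)

theorem inner_smul_left_V (r : ℝ) (v w : V X l) : inner ℝ (r • v) w = r * inner ℝ v w :=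
  real_inner_smul_left v w r

theorem inner_smul_right_V (r : ℝ) (v w : V X l) : inner ℝ v (r • w) = r * inner ℝ v w :=
  real_inner_smul_right v w r

theorem wallFun_add (i : Fin (l + 1)) (v d : V X l) :
    wallFun X l i (v + d) = wallFun X l i v + inner ℝ d (wallVec X l i) := by
  refine Fin.cases ?_ (fun i => ?_) i
  · simp only [wallFun, wallVec, Fin.cases_zero, inner_add_left, inner_neg_right]; ring
  · simp only [wallFun, wallVec, Fin.cases_succ, inner_add_left]

theorem genPerm_apply (i : Fin (l + 1)) (v : V X l) :
    genPerm X l i v = v + (-wallFun X l i v) • coroot (wallVec X l i) := by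
  refine Fin.cases ?_ (fun i => ?_) i
  · simp only [wallFun, wallVec, genPerm, Fin.cases_zero, affReflection, coroot,
      Function.Involutive.coe_toPerm, inner_neg_neg]
    module
  · simp only [wallFun, wallVec, genPerm, Fin.cases_succ, affReflection,
      Function.Involutive.coe_toPerm, sub_zero]
    module

theorem wallFun_genPerm (i j : Fin (l + 1)) (v : V X l) :
    wallFun X l j (genPerm X l i v) =
      wallFun X l j v - inner ℝ (coroot (wallVec X l i)) (wallVec X l j) * wallFun X l i v := by
  rw [genPerm_apply, wallFun_add, inner_smul_left_V]; ring

theorem genPerm_genPerm (i : Fin (l + 1)) (v : V X l) :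
    genPerm X l i (genPerm X l i v) = v := by
  refine Fin.cases ?_ (fun i => ?_) i
  · exact affReflection_involutive _ _ v
  · exact affReflection_involutive _ _ v

theorem genPerm_of_wallFun_eq_zero {i : Fin (l + 1)} {v : V X l} (h : wallFun X l i v = 0) :
    genPerm X l i v = v := by
  simp [genPerm_apply, h]

/-! ### Words in the generators, and linear parts of the elements of `W` -/

theorem gen_mul_gen (i : Fin (l + 1)) : gen X l i * gen X l i = 1 := by
  ext1; ext1 v; exact genPerm_genPerm i v

theorem gen_inv (i : Fin (l + 1)) : (gen X l i)⁻¹ = gen X l i :=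
  inv_eq_of_mul_eq_one_left (gen_mul_gen i)

/-- The element of `W` with the given word in the generators. -/
noncomputable def word (X : AffineType) (l : ℕ) (L : List (Fin (l + 1))) : W X l :=
  (L.map (gen X l)).prod

theorem word_cons (i : Fin (l + 1)) (L : List (Fin (l + 1))) :
    word X l (i :: L) = gen X l i * word X l L := by simp [word]

theorem word_append (L L' : List (Fin (l + 1))) :
    word X l (L ++ L') = word X l L * word X l L' := by simp [word]

theorem word_reverse (L : List (Fin (l + 1))) : word X l L.reverse = (word X l L)⁻¹ := by
  induction L with
  | nil => simp [word]
  | cons i L ih =>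
    rw [List.reverse_cons, word_append, ih, word_cons i L, mul_inv_rev, gen_inv]
    simp [word]

theorem exists_word (w : W X l) : ∃ L, word X l L = w := by
  obtain ⟨w, hw⟩ := w
  induction hw using Subgroup.closure_induction with
  | mem x hx => obtain ⟨i, rfl⟩ := hx; exact ⟨[i], by simp [word]; rfl⟩
  | one => exact ⟨[], rfl⟩
  | mul x y hx hy h1 h2 =>
    obtain ⟨L, hL⟩ := h1
    obtain ⟨L', hL'⟩ := h2
    exact ⟨L ++ L', by rw [word_append, hL, hL']; rfl⟩
  | inv x hx h =>
    obtain ⟨L, hL⟩ := h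
    exact ⟨L.reverse, by rw [word_reverse, hL]; rfl⟩

theorem length_word_le (L : List (Fin (l + 1))) : length (word X l L) ≤ L.length :=
  Nat.sInf_le ⟨L, rfl, rfl⟩

theorem exists_word_length (w : W X l) : ∃ L, word X l L = w ∧ L.length = length w := by
  obtain ⟨L, hL⟩ := exists_word w
  obtain ⟨L', h1, h2⟩ := Nat.sInf_mem
    (s := {n | ∃ L : List (Fin (l + 1)), L.length = n ∧ (L.map (gen X l)).prod = w}) ⟨_, L, rfl, hL⟩
  exact ⟨L', h2, h1⟩

theorem W_induction {p : W X l → Prop} (one : p 1) (mul : ∀ i w, p w → p (gen X l i * w))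
    (w : W X l) : p w := by
  obtain ⟨L, rfl⟩ := exists_word w
  induction L with
  | nil => exact one
  | cons i L ih => rw [word_cons]; exact mul _ _ ih

/-- The linear part of an element of `W` is orthogonal. -/
theorem exists_linear_part (w : W X l) : ∃ U : V X l →ₗ[ℝ] V X l,
    (∀ v d, (w : Equiv.Perm (V X l)) (v + d) = (w : Equiv.Perm (V X l)) v + U d) ∧
    ∀ d e, inner ℝ (U d) (U e) = inner ℝ d e := by
  induction w using W_induction with
  | one => exact ⟨LinearMap.id, fun _ _ => rfl, fun _ _ => rfl⟩
  | mul i w h =>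
    obtain ⟨U, h1, h2⟩ := h
    set b := coroot (wallVec X l i)
    set β := wallVec X l i with hβ
    have hb : ∀ d : V X l, inner ℝ d β * inner ℝ b b = 2 * inner ℝ d b := by
      intro d
      simp only [b, coroot, inner_smul_left_V, inner_smul_right_V, ← hβ]
      -- For `β = 0` the division by zero makes the coroot zero as well, and both sides vanish.
      by_cases hβ0 : inner ℝ β β = 0
      · rw [hβ0]; simp
      · field_simp
    let R : V X l →ₗ[ℝ] V X l :=
      { toFun := fun d => d - inner ℝ d β • b
        map_add' := fun d e => by simp only [inner_add_left]; module
        map_smul' := fun r d => by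
          simp only [inner_smul_left_V, RingHom.id_apply]; module }
    refine ⟨R ∘ₗ U, fun v d => ?_, fun d e => ?_⟩
    · change genPerm X l i ((w : Equiv.Perm (V X l)) (v + d)) =
        genPerm X l i ((w : Equiv.Perm (V X l)) v) + R (U d)
      rw [h1, genPerm_apply, genPerm_apply, wallFun_add]
      simp only [R, LinearMap.coe_mk, AddHom.coe_mk]
      module
    · rw [← h2 d e]
      simp only [R, LinearMap.comp_apply, LinearMap.coe_mk, AddHom.coe_mk, inner_sub_left,
        inner_sub_right, inner_smul_left_V, inner_smul_right_V]
      have e1 := hb (U e)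
      have e2 := real_inner_comm (U e) b
      have e3 := hb (U d)
      linear_combination (inner ℝ (U d) β / 2) * e1 + (inner ℝ (U e) β / 2) * e3 -
        (inner ℝ (U d) β) * e2

/-- If `w` maps a wall functional to a multiple of another one, it conjugates the reflections. -/
theorem conj_gen {w : W X l} {i k : Fin (l + 1)} {r : ℝ} (hr : r ≠ 0)
    (h : ∀ v, wallFun X l i (((w⁻¹ : W X l) : Equiv.Perm (V X l)) v) = r * wallFun X l k v) :
    w * gen X l i * w⁻¹ = gen X l k := by
  obtain ⟨U, h1, h2⟩ := exists_linear_part w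
  have h3 : ∀ v, wallFun X l i v = r * wallFun X l k ((w : Equiv.Perm (V X l)) v) := by
    intro v
    rw [← h]
    congr 1
    exact ((w : Equiv.Perm (V X l)).symm_apply_apply v).symm
  have h4 : ∀ d, inner ℝ d (wallVec X l i) = r * inner ℝ (U d) (wallVec X l k) := by
    intro d
    have e := h3 (0 + d)
    rw [wallFun_add, h1, wallFun_add, h3 0] at e
    linear_combination e
  have hinj : Function.Injective U := by
    refine (injective_iff_map_eq_zero U).2 fun d hd => ?_
    have := h2 d d
    rw [hd, inner_zero_left] at this
    exact inner_self_eq_zero.1 this.symm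
  -- In finite dimension the isometry `U` is onto, so the `k`-th gradient can be written as `U e`
  -- and compared before applying `U`.
  have hsurj := LinearMap.surjective_of_injective hinj
  have h5 : U (wallVec X l i) = r • wallVec X l k := by
    obtain ⟨e, he⟩ := hsurj (wallVec X l k)
    rw [← he, ← map_smul]
    congr 1
    refine ext_inner_left ℝ fun d => ?_
    rw [h4, ← he, h2, inner_smul_right_V]
  have h6 : U (coroot (wallVec X l i)) = r⁻¹ • coroot (wallVec X l k) := by
    rw [coroot, coroot, map_smul, h5, ← h2 (wallVec X l i), h5, inner_smul_left_V,
      inner_smul_right_V, smul_smul, smul_smul]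
    congr 1
    by_cases h0 : inner ℝ (wallVec X l k) (wallVec X l k) = 0
    · rw [h0]; simp
    · field_simp
  rw [mul_inv_eq_iff_eq_mul]
  ext1; ext1 v
  change (w : Equiv.Perm (V X l)) (genPerm X l i v) = genPerm X l k ((w : Equiv.Perm (V X l)) v)
  -- The factor `r` of the functional cancels the factor `r⁻¹` of the coroot.
  rw [genPerm_apply, h1, genPerm_apply, map_smul, h6, h3 v, smul_smul]
  congr 2
  field_simp

/-- The open fundamental alcove. -/
def IsInterior (v : V X l) : Prop := ∀ i, 0 < wallFun X l i v

/-! ### The fundamental alcove, its images, and functions positive on it -/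

theorem mem_halfSpace {i : Fin (l + 1)} {v : V X l} :
    v ∈ halfSpace X l i ↔ 0 < wallFun X l i v := by
  refine Fin.cases ?_ (fun i => ?_) i
  · simp [halfSpace, wallFun]
  · simp [halfSpace, wallFun]

theorem mem_iInter_halfSpace {v : V X l} : v ∈ ⋂ i, halfSpace X l i ↔ IsInterior v := by
  simp [mem_halfSpace, IsInterior]

theorem mem_titsCone {j : Fin (l + 1)} {v : V X l} :
    v ∈ titsCone X l j ↔ ∀ i, i ≠ j → 0 < wallFun X l i v := by
  simp [titsCone, mem_halfSpace]

theorem mem_alcove {w : W X l} {v : V X l} :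
    v ∈ alcove w ↔ IsInterior (((w⁻¹ : W X l) : Equiv.Perm (V X l)) v) := by
  rw [alcove, Set.mem_image_equiv, mem_iInter_halfSpace]
  rfl

theorem wallFun_segment (i : Fin (l + 1)) (u v : V X l) (t : ℝ) :
    wallFun X l i (u + t • (v - u)) =
      wallFun X l i u + t * (wallFun X l i v - wallFun X l i u) := by
  have h : wallFun X l i v = wallFun X l i (u + (v - u)) := by congr 1; abel
  rw [wallFun_add, inner_smul_left_V, h, wallFun_add]; ring

/-- `f` is affine along segments. -/
def IsAffineFun (f : V X l → ℝ) : Prop :=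
  ∀ u v t, f (u + t • (v - u)) = f u + t * (f v - f u)

/-- Every point of the segment from `z` to `b` other than `z` is interior. If `f z` were negative,
`f` would vanish at one of them, namely at the parameter `t`. -/
theorem nonneg_of_pos_on_interior {f : V X l → ℝ} (hf : IsAffineFun f)
    (hpos : ∀ v, IsInterior v → 0 < f v) {b z : V X l} (hb : IsInterior b)
    (hz : ∀ i, 0 ≤ wallFun X l i z) : 0 ≤ f z := by
  by_contra! hneg
  have hfb := hpos b hb
  have ht : 0 < -f z / (f b - f z) := div_pos (by linarith) (by linarith)
  have ht1 : -f z / (f b - f z) ≤ 1 := by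
    rw [div_le_one (by linarith)]; linarith
  set t := -f z / (f b - f z) with hteq
  have h := hpos (z + t • (b - z)) (fun i => by
    rw [wallFun_segment]
    have := hz i
    have h2 := hb i
    nlinarith [mul_pos ht h2, mul_nonneg (sub_nonneg.2 ht1) this])
  rw [hf, hteq, div_mul_cancel₀ _ (by linarith)] at h
  linarith

/-! ### Models of the affine Weyl group on positions -/

/-- The pairs of positions in the orbits of the pairs exchanged by a generator. -/
inductive RootPair {I : Type*} (perm : I → ℤ → ℤ) : ℤ → ℤ → Prop
  | base (i : I) (x : ℤ) (h : perm i x ≠ x) : RootPair perm x (perm i x)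
  | step (i : I) (p q : ℤ) (h : RootPair perm p q) : RootPair perm (perm i p) (perm i q)

/-- A realization of positions as affine functionals on `V`, ordered by their values at a point of
the fundamental alcove, and permuted by the generators of `W`. -/
structure PositionModel (X : AffineType) (l : ℕ) where
  /-- The functional of a position. -/
  fn : ℤ → V X l → ℝ
  isAffine : ∀ x, IsAffineFun (fn x)
  /-- The permutation of the positions by a generator. -/
  perm : Fin (l + 1) → ℤ → ℤ
  fn_perm : ∀ i x v, fn (perm i x) v = fn x (genPerm X l i v)
  /-- A generic point of the fundamental alcove. -/
  base : V X l
  base_mem : IsInterior base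
  anti : StrictAnti (fn · base)
  /-- The vertices of the fundamental alcove. -/
  vertex : Fin (l + 1) → V X l
  wallFun_vertex : ∀ {i j}, i ≠ j → wallFun X l i (vertex j) = 0
  vertex_pos : ∀ j, 0 < wallFun X l j (vertex j)
  exists_perm_ne : ∀ i, ∃ x, perm i x ≠ x
  -- The hyperplanes of the roots do not cut the fundamental alcove. The order at the point `base`
  -- thus decides the sign of a root on the whole alcove; for pairs that are not roots it may fail.
  sign : ∀ {p q}, RootPair perm p q → p < q → ∀ v, IsInterior v → fn q v < fn p v

namespace PositionModel

variable (M : PositionModel X l)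

/-- One generic point separates all positions. Identities between positions are therefore proved
below as identities between functionals. -/
theorem fn_injective {x y : ℤ} (h : ∀ v, M.fn x v = M.fn y v) : x = y :=
  M.anti.injective (h M.base)

theorem perm_perm (i : Fin (l + 1)) (x : ℤ) : M.perm i (M.perm i x) = x :=
  M.fn_injective fun v => by rw [M.fn_perm, M.fn_perm, genPerm_genPerm]

theorem perm_eq {i : Fin (l + 1)} {x y : ℤ} (h : ∀ v, M.fn y v = M.fn x (genPerm X l i v)) :
    M.perm i x = y :=
  M.fn_injective fun v => by rw [M.fn_perm, h]

theorem perm_injective (i : Fin (l + 1)) : Function.Injective (M.perm i) :=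
  Function.LeftInverse.injective (M.perm_perm i)

theorem rootPair_symm {p q : ℤ} (h : RootPair M.perm p q) : RootPair M.perm q p := by
  induction h with
  | base i x h =>
    have := RootPair.base (perm := M.perm) i (M.perm i x) (by rw [M.perm_perm]; exact h.symm)
    rwa [M.perm_perm] at this
  | step i p q h ih => exact .step i q p ih

theorem rootPair_ne {p q : ℤ} (h : RootPair M.perm p q) : p ≠ q := by
  induction h with
  | base i x h => exact h.symm
  | step i p q h ih => exact (M.perm_injective i).ne ih

/-- The reflection moves `v` along the coroot of its wall by an amount proportional to the wall
functional, so an affine functional changes by a multiple of that functional. -/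
theorem sub_perm (i : Fin (l + 1)) (x : ℤ) :
    ∃ r : ℝ, ∀ v, M.fn x v - M.fn (M.perm i x) v = r * wallFun X l i v := by
  set b := coroot (wallVec X l i) with hb
  refine ⟨M.fn x b - M.fn x 0, fun v => ?_⟩
  -- In the parallelogram `0, u, u + d, d` the two diagonals have the same midpoint; this turns
  -- affineness along segments into additivity of increments.
  have h1 : ∀ (u d : V X l) (t : ℝ), M.fn x (u + t • d) = M.fn x u + t * (M.fn x d - M.fn x 0) := by
    intro u d t
    have e1 := M.isAffine x ((2⁻¹ : ℝ) • u) (u + d) 2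
    have e2 := M.isAffine x (0 : V X l) u 2⁻¹
    have e3 := M.isAffine x d u 2⁻¹
    have e4 := M.isAffine x u (u + d) t
    have e5 := M.isAffine x (0 : V X l) (u + d) 2⁻¹
    rw [show d + (2⁻¹ : ℝ) • (u - d) = 0 + (2⁻¹ : ℝ) • (u + d - 0) by module, e5] at e3
    rw [show u + t • (u + d - u) = u + t • d by module] at e4
    rw [e4]
    linear_combination 2 * t * e3
  rw [M.fn_perm, genPerm_apply, h1]; ring

theorem sub_perm_pos {i : Fin (l + 1)} {x : ℤ} (hx : x < M.perm i x) :
    ∃ r : ℝ, 0 < r ∧ ∀ v, M.fn x v - M.fn (M.perm i x) v = r * wallFun X l i v := by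
  obtain ⟨r, hr⟩ := M.sub_perm i x
  refine ⟨r, ?_, hr⟩
  have h1 := hr M.base
  have h2 : M.fn (M.perm i x) M.base < M.fn x M.base := M.anti hx
  have h3 := M.base_mem i
  by_contra! h4
  nlinarith

theorem exists_lt_perm (i : Fin (l + 1)) : ∃ x, x < M.perm i x := by
  obtain ⟨x, hx⟩ := M.exists_perm_ne i
  rcases lt_or_gt_of_ne hx with h | h
  · exact ⟨M.perm i x, by rwa [M.perm_perm]⟩
  · exact ⟨x, h⟩

/-- The generator swaps the two positions of an exchanged pair, so it reverses their difference,
which is a positive multiple of the wall functional. No separate check that the wall vector is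
nonzero is needed. -/
theorem wallFun_genPerm_self (M : PositionModel X l) (i : Fin (l + 1)) (v : V X l) :
    wallFun X l i (genPerm X l i v) = -wallFun X l i v := by
  obtain ⟨x, hx⟩ := M.exists_lt_perm i
  obtain ⟨r, hr, h⟩ := M.sub_perm_pos hx
  have h1 := h v
  have h2 := h (genPerm X l i v)
  rw [M.fn_perm, genPerm_genPerm, ← M.fn_perm] at h2
  have h3 : r * (wallFun X l i (genPerm X l i v) + wallFun X l i v) = 0 := by
    linear_combination -h1 - h2
  rcases mul_eq_zero.1 h3 with h4 | h4
  · exact absurd h4 hr.ne'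
  · linarith

theorem vertex_nonneg (i j : Fin (l + 1)) : 0 ≤ wallFun X l i (M.vertex j) := by
  by_cases h : i = j
  · subst h; exact (M.vertex_pos i).le
  · exact (M.wallFun_vertex h).ge

/-- A generator changes each wall functional by a multiple of its own, so the span of the wall
functionals is stable under `W`. -/
theorem rootPair_mem_span {p q : ℤ} (h : RootPair M.perm p q) :
    ∃ c : Fin (l + 1) → ℝ, ∀ v, M.fn p v - M.fn q v = ∑ j, c j * wallFun X l j v := by
  induction h with
  | base i x h =>
    obtain ⟨r, hr⟩ := M.sub_perm i x
    refine ⟨fun j => if j = i then r else 0, fun v => ?_⟩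
    rw [hr]; simp
  | step i p q h ih =>
    obtain ⟨c, hc⟩ := ih
    refine ⟨fun j => c j - if j = i then
      ∑ k, c k * inner ℝ (coroot (wallVec X l i)) (wallVec X l k) else 0, fun v => ?_⟩
    rw [M.fn_perm, M.fn_perm, hc]
    simp only [wallFun_genPerm, sub_mul, ite_mul, zero_mul, Finset.sum_sub_distrib,
      Finset.sum_ite_eq', Finset.mem_univ, if_true, mul_sub, Finset.sum_mul, mul_assoc]

theorem isAffine_sub (p q : ℤ) : IsAffineFun fun v => M.fn p v - M.fn q v := fun u v t => by
  simp only [M.isAffine p u v t, M.isAffine q u v t]; ring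

/-- The only roots whose sign is changed by a generator are those of the wall. -/
theorem exists_eq_wallFun {i : Fin (l + 1)} {p q : ℤ} (h : RootPair M.perm p q) (hpq : p < q)
    (hqp : M.perm i q < M.perm i p) :
    ∃ r : ℝ, 0 < r ∧ ∀ v, M.fn p v - M.fn q v = r * wallFun X l i v := by
  obtain ⟨c, hc⟩ := M.rootPair_mem_span h
  -- For `j ≠ i` the `j`-th vertex is fixed by the `i`-th generator. The root is nonnegative there
  -- before the generator acts and nonpositive afterwards, so it vanishes; its value is `c j` times
  -- a positive number.
  have h1 : ∀ j, j ≠ i → c j = 0 := by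
    intro j hj
    have e1 : 0 ≤ M.fn p (M.vertex j) - M.fn q (M.vertex j) :=
      nonneg_of_pos_on_interior (M.isAffine_sub p q)
        (fun v hv => sub_pos.2 (M.sign h hpq v hv)) M.base_mem (fun k => M.vertex_nonneg k j)
    have e2 : 0 ≤ M.fn (M.perm i q) (M.vertex j) - M.fn (M.perm i p) (M.vertex j) :=
      nonneg_of_pos_on_interior (M.isAffine_sub _ _)
        (fun v hv => sub_pos.2 (M.sign (M.rootPair_symm (.step i p q h)) hqp v hv)) M.base_mem
        (fun k => M.vertex_nonneg k j)
    rw [M.fn_perm, M.fn_perm, genPerm_of_wallFun_eq_zero (M.wallFun_vertex hj.symm)] at e2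
    have e3 := hc (M.vertex j)
    rw [Finset.sum_eq_single j (fun k _ hk => by rw [M.wallFun_vertex hk, mul_zero]) (by simp)]
      at e3
    have e4 : c j * wallFun X l j (M.vertex j) = 0 := by linarith
    exact (mul_eq_zero.1 e4).resolve_right (M.vertex_pos j).ne'
  have h2 : ∀ v, M.fn p v - M.fn q v = c i * wallFun X l i v := by
    intro v
    rw [hc, Finset.sum_eq_single i (fun k _ hk => by rw [h1 k hk, zero_mul]) (by simp)]
  refine ⟨c i, ?_, h2⟩
  have e1 := h2 M.base
  have e2 := M.sign h hpq _ M.base_mem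
  have e3 := M.base_mem i
  by_contra! h4
  nlinarith

/-! ### The action of `W` on positions, the exchange condition and lengths -/

theorem exists_act (w : W X l) (x : ℤ) : ∃ y, ∀ v,
    M.fn y v = M.fn x (((w⁻¹ : W X l) : Equiv.Perm (V X l)) v) := by
  induction w using W_induction with
  | one => exact ⟨x, fun v => by simp⟩
  | mul i w h =>
    obtain ⟨y, hy⟩ := h
    refine ⟨M.perm i y, fun v => ?_⟩
    rw [M.fn_perm, hy, mul_inv_rev, gen_inv]
    rfl

/-- The action of `W` on positions. -/
noncomputable def act (w : W X l) (x : ℤ) : ℤ := (M.exists_act w x).choose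

theorem fn_act (w : W X l) (x : ℤ) (v : V X l) :
    M.fn (M.act w x) v = M.fn x (((w⁻¹ : W X l) : Equiv.Perm (V X l)) v) :=
  (M.exists_act w x).choose_spec v

theorem act_one (x : ℤ) : M.act 1 x = x := M.fn_injective fun v => by simp [M.fn_act]

theorem act_mul (w w' : W X l) (x : ℤ) : M.act (w * w') x = M.act w (M.act w' x) :=
  M.fn_injective fun v => by simp only [M.fn_act, mul_inv_rev]; rfl

theorem act_gen (i : Fin (l + 1)) (x : ℤ) : M.act (gen X l i) x = M.perm i x :=
  M.fn_injective fun v => by rw [M.fn_act, M.fn_perm, gen_inv]; rfl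

theorem rootPair_act (w : W X l) {p q : ℤ} (h : RootPair M.perm p q) :
    RootPair M.perm (M.act w p) (M.act w q) := by
  induction w using W_induction with
  | one => simpa only [act_one] using h
  | mul i w ih => simp only [act_mul, act_gen]; exact .step i _ _ ih

/-- Images of walls are roots up to a positive factor; this makes `sign` and `exists_eq_wallFun`
applicable to them. -/
theorem wallFun_act (w : W X l) (i : Fin (l + 1)) : ∃ p q, ∃ r : ℝ, 0 < r ∧
    RootPair M.perm p q ∧ ∀ v, M.fn p v - M.fn q v =
      r * wallFun X l i (((w⁻¹ : W X l) : Equiv.Perm (V X l)) v) := by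
  obtain ⟨x, hx⟩ := M.exists_lt_perm i
  obtain ⟨r, hr, h⟩ := M.sub_perm_pos hx
  refine ⟨_, _, r, hr, M.rootPair_act w (.base i x hx.ne'), fun v => ?_⟩
  rw [M.fn_act, M.fn_act, h]

/-- The pullback of a wall under `w` is the zero set of a root, so it misses the open fundamental
alcove. Hence the alcove of `w` lies entirely on one side of the wall, and the point `base` decides
which. -/
theorem wallFun_pos_iff (M : PositionModel X l) (w : W X l) (i : Fin (l + 1)) {v : V X l}
    (hv : IsInterior v) :
    0 < wallFun X l i ((w : Equiv.Perm (V X l)) v) ↔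
      0 < wallFun X l i ((w : Equiv.Perm (V X l)) M.base) := by
  obtain ⟨p, q, r, hr, h1, h2⟩ := M.wallFun_act w⁻¹ i
  rw [inv_inv] at h2
  have key : ∀ u, 0 < wallFun X l i ((w : Equiv.Perm (V X l)) u) ↔ M.fn q u < M.fn p u := by
    intro u
    rw [← sub_pos (b := M.fn q u), h2, mul_pos_iff_of_pos_left hr]
  rw [key, key]
  rcases lt_or_gt_of_ne (M.rootPair_ne h1) with h | h
  · exact iff_of_true (M.sign h1 h v hv) (M.sign h1 h _ M.base_mem)
  · exact iff_of_false (M.sign (M.rootPair_symm h1) h v hv).not_gt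
      (M.sign (M.rootPair_symm h1) h _ M.base_mem).not_gt

/-- The exchange condition. -/
theorem exists_exchange (i : Fin (l + 1)) (L : List (Fin (l + 1)))
    (h : ¬ 0 < wallFun X l i ((((word X l L)⁻¹ : W X l) : Equiv.Perm (V X l)) M.base)) :
    ∃ L', L'.length + 1 = L.length ∧ word X l L' = word X l L * gen X l i := by
  induction L with
  | nil => exact absurd (M.base_mem i) (by simpa [word] using h)
  | cons k L ih =>
    set u := word X l L with hu
    by_cases h1 : 0 < wallFun X l i (((u⁻¹ : W X l) : Equiv.Perm (V X l)) M.base)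
    -- The root obtained from wall `i` by `u` is positive on the alcove, and `h` says that generator
    -- `k` makes it negative. It must be a multiple of the functional of wall `k`, so `u` conjugates
    -- generator `i` into generator `k`, and the letter `k` cancels.
    · obtain ⟨p, q, r, hr, h2, h3⟩ := M.wallFun_act u i
      have hpq : p < q := by
        by_contra hn
        have h4 := M.sign (M.rootPair_symm h2)
          (lt_of_le_of_ne (not_lt.1 hn) (M.rootPair_ne h2).symm) _ M.base_mem
        have h5 := h3 M.base
        have := mul_pos hr h1
        linarith
      have hqp : M.perm k q < M.perm k p := by
        by_contra hn
        have h2' := RootPair.step k p q h2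
        have h4 := M.sign h2' (lt_of_le_of_ne (not_lt.1 hn) (M.rootPair_ne h2')) _ M.base_mem
        rw [M.fn_perm, M.fn_perm] at h4
        have h5 := h3 (genPerm X l k M.base)
        have h6 : 0 < r * wallFun X l i (((u⁻¹ : W X l) : Equiv.Perm (V X l))
          (genPerm X l k M.base)) := by linarith
        rw [mul_pos_iff_of_pos_left hr] at h6
        apply h
        rw [word_cons, mul_inv_rev, gen_inv]
        exact h6
      obtain ⟨r', hr', h4⟩ := M.exists_eq_wallFun h2 hpq hqp
      have h5 := conj_gen (w := u) (i := i) (k := k) (r := r' / r) (by positivity) (fun v => by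
        rw [div_mul_eq_mul_div, eq_div_iff hr.ne', mul_comm, ← h3, h4])
      refine ⟨L, rfl, ?_⟩
      rw [mul_inv_eq_iff_eq_mul] at h5
      rw [word_cons, mul_assoc, ← hu, h5, ← mul_assoc, gen_mul_gen, one_mul]
    · obtain ⟨L', h2, h3⟩ := ih h1
      exact ⟨k :: L', by simp [h2], by rw [word_cons, word_cons, h3, mul_assoc]⟩

theorem length_mul_gen_lt (M : PositionModel X l) {w : W X l} {i : Fin (l + 1)}
    (h : ¬ 0 < wallFun X l i (((w⁻¹ : W X l) : Equiv.Perm (V X l)) M.base)) :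
    length (w * gen X l i) < length w := by
  obtain ⟨L, rfl, hL⟩ := exists_word_length w
  obtain ⟨L', h1, h2⟩ := M.exists_exchange i L h
  rw [← h2]
  have := length_word_le (X := X) L'
  omega

/-- Apply `length_mul_gen_lt` to `w * gen X l i`: the reflection puts the point on the negative side
of the wall. -/
theorem length_lt_mul_gen (M : PositionModel X l) {w : W X l} {i : Fin (l + 1)}
    (h : 0 < wallFun X l i (((w⁻¹ : W X l) : Equiv.Perm (V X l)) M.base)) :
    length w < length (w * gen X l i) := by
  have := M.length_mul_gen_lt (w := w * gen X l i) (i := i) (by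
    rw [mul_inv_rev, gen_inv]
    have : wallFun X l i (((gen X l i * w⁻¹ : W X l) : Equiv.Perm (V X l)) M.base) = _ :=
      M.wallFun_genPerm_self i (((w⁻¹ : W X l) : Equiv.Perm (V X l)) M.base)
    rw [this]; linarith)
  rwa [mul_assoc, gen_mul_gen, mul_one] at this

theorem length_lt_mul_gen_iff (M : PositionModel X l) {w : W X l} {i : Fin (l + 1)} :
    length w < length (w * gen X l i) ↔
      0 < wallFun X l i (((w⁻¹ : W X l) : Equiv.Perm (V X l)) M.base) := by
  refine ⟨fun h => ?_, M.length_lt_mul_gen⟩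
  by_contra h1
  exact (M.length_mul_gen_lt h1).not_gt h

theorem mem_grassmannian {w : W X l} {j : Fin (l + 1)} : w ∈ grassmannian X l j ↔
    ∀ i, i ≠ j → 0 < wallFun X l i (((w⁻¹ : W X l) : Equiv.Perm (V X l)) M.base) := by
  simp only [grassmannian, Set.mem_ofPred_eq, M.length_lt_mul_gen_iff]

theorem alcove_inv_subset_iff (M : PositionModel X l) {w : W X l} {j : Fin (l + 1)} :
    alcove w⁻¹ ⊆ titsCone X l j ↔ w ∈ grassmannian X l j := by
  rw [M.mem_grassmannian]
  constructor
  · intro h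
    refine mem_titsCone.1 (h (mem_alcove.2 ?_))
    have : (((w⁻¹)⁻¹ : W X l) : Equiv.Perm (V X l)) (((w⁻¹ : W X l) : Equiv.Perm (V X l)) M.base)
      = M.base := by simp
    rw [this]
    exact M.base_mem
  · intro h v hv
    rw [mem_alcove] at hv
    refine mem_titsCone.2 fun i hi => ?_
    have h1 := (M.wallFun_pos_iff w⁻¹ i hv).2 (h i hi)
    rwa [show ((w⁻¹ : W X l) : Equiv.Perm (V X l))
      ((((w⁻¹)⁻¹ : W X l) : Equiv.Perm (V X l)) v) = v by simp] at h1

/-- A nonempty reduced word has a last letter, and multiplying by that generator shortens the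
element, contrary to `length_lt_mul_gen`. -/
theorem eq_one_of_forall_pos (M : PositionModel X l) {w : W X l}
    (h : ∀ i, 0 < wallFun X l i (((w⁻¹ : W X l) : Equiv.Perm (V X l)) M.base)) : w = 1 := by
  obtain ⟨L, rfl, hL⟩ := exists_word_length w
  rcases L.eq_nil_or_concat with rfl | ⟨L, i, rfl⟩
  · rfl
  · exfalso
    have h1 := M.length_lt_mul_gen (h i)
    rw [← hL, List.concat_eq_append, word_append, mul_assoc] at h1
    have h2 : word X l [i] * gen X l i = 1 := by simp [word, gen_mul_gen]
    rw [h2, mul_one] at h1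
    have := length_word_le (X := X) L
    simp at h1
    omega

/-- `W` acts freely on the alcoves. -/
theorem eq_one_of_isInterior (M : PositionModel X l) {w : W X l} {v : V X l} (hv : IsInterior v)
    (hw : IsInterior ((w : Equiv.Perm (V X l)) v)) : w = 1 := by
  refine M.eq_one_of_forall_pos fun i => ?_
  rw [← M.wallFun_pos_iff w⁻¹ i hw]
  rw [show ((w⁻¹ : W X l) : Equiv.Perm (V X l)) ((w : Equiv.Perm (V X l)) v) = v by simp]
  exact hv i

theorem alcove_injective (M : PositionModel X l) :
    Function.Injective (alcove : W X l → Set (V X l)) := by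
  intro w w' h
  have h1 : (w : Equiv.Perm (V X l)) M.base ∈ alcove w := by
    rw [mem_alcove]; simpa using M.base_mem
  rw [h, mem_alcove] at h1
  exact (inv_mul_eq_one.1 (M.eq_one_of_isInterior (w := w'⁻¹ * w) M.base_mem h1)).symm

/-- Elements of `W^j` are determined by the image of the `j`-th vertex. -/
theorem grassmannian_ext (M : PositionModel X l) {j : Fin (l + 1)} {w w' : W X l}
    (hw : w ∈ grassmannian X l j)
    (hw' : w' ∈ grassmannian X l j)
    (h : (w : Equiv.Perm (V X l)) (M.vertex j) = (w' : Equiv.Perm (V X l)) (M.vertex j)) :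
    w = w' := by
  rw [M.mem_grassmannian] at hw hw'
  set z := M.vertex j
  set y := ((w⁻¹ : W X l) : Equiv.Perm (V X l)) M.base with hy
  set y' := ((w'⁻¹ : W X l) : Equiv.Perm (V X l)) M.base with hy'
  have hwy : ((w'⁻¹ * w : W X l) : Equiv.Perm (V X l)) y = y' := by
    simp [hy, hy']
  have hz : ((w'⁻¹ * w : W X l) : Equiv.Perm (V X l)) z = z := by
    have : ((w'⁻¹ * w : W X l) : Equiv.Perm (V X l)) z =
      ((w'⁻¹ : W X l) : Equiv.Perm (V X l)) ((w : Equiv.Perm (V X l)) z) := rfl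
    rw [this, h]; simp
  have hpos := M.vertex_pos j
  -- Going from the vertex `z` towards a point of the cone, the walls other than `j`, which vanish
  -- at `z`, become positive at once, and wall `j` stays positive for a short time. Here `D` bounds
  -- its slope, the added `1` keeping it nonzero, and the half leaves a margin.
  have near : ∀ u, (∀ i, i ≠ j → 0 < wallFun X l i u) → ∃ t > (0 : ℝ), ∀ s, 0 < s → s ≤ t →
      IsInterior (z + s • (u - z)) := by
    intro u hu
    set D := |wallFun X l j u - wallFun X l j z| + 1
    have hD : 0 < D := by positivity
    refine ⟨wallFun X l j z / 2 / D, by positivity, fun s hs hst i => ?_⟩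
    rw [wallFun_segment]
    by_cases hi : i = j
    · subst hi
      have h1 : s * D ≤ wallFun X l i z / 2 := by rwa [le_div_iff₀ hD] at hst
      have h2 := neg_abs_le (wallFun X l i u - wallFun X l i z)
      have h3 : -D ≤ wallFun X l i u - wallFun X l i z := by simp only [D]; linarith
      nlinarith
    · rw [M.wallFun_vertex hi, zero_add, sub_zero]
      exact mul_pos hs (hu i hi)
  obtain ⟨t, ht, h1⟩ := near y hw
  obtain ⟨t', ht', h2⟩ := near y' hw'
  have hs : 0 < min t t' := lt_min ht ht'
  have h3 := h1 _ hs (min_le_left _ _)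
  have h4 := h2 _ hs (min_le_right _ _)
  obtain ⟨U, hU, -⟩ := exists_linear_part (w'⁻¹ * w)
  -- The element `w'⁻¹ * w` fixes `z` and maps `y` to `y'`, so it carries the first segment to the
  -- second. At a common small parameter an interior point goes to an interior point.
  have h5 : U (y - z) = y' - z := by
    have := hU z (y - z)
    rw [hz, add_sub_cancel, hwy] at this
    rw [this]; abel
  have h6 : ((w'⁻¹ * w : W X l) : Equiv.Perm (V X l)) (z + min t t' • (y - z)) =
      z + min t t' • (y' - z) := by
    rw [hU, hz, map_smul, h5]
  rw [← h6] at h4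
  exact (inv_mul_eq_one.1 (M.eq_one_of_isInterior h3 h4)).symm

/-- Every coset of `W_j` meets `W^j`. -/
theorem exists_mem_grassmannian (M : PositionModel X l) {S : Type*}
    (j : Fin (l + 1)) (f : W X l → S)
    (hf : ∀ w i, i ≠ j → f (w * gen X l i) = f w) (w : W X l) :
    ∃ u ∈ grassmannian X l j, f u = f w := by
  induction hn : length w using Nat.strong_induction_on generalizing w with
  | _ n ih =>
    by_cases hw : w ∈ grassmannian X l j
    · exact ⟨w, hw, rfl⟩
    · rw [M.mem_grassmannian] at hw
      push Not at hw
      obtain ⟨i, hi, h⟩ := hw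
      have h1 := M.length_mul_gen_lt (w := w) (i := i) (not_lt.2 h)
      obtain ⟨u, hu, h2⟩ := ih _ (hn ▸ h1) _ rfl
      exact ⟨u, hu, h2.trans (hf w i hi)⟩

end PositionModel

end CoreAbacus

/-! ### Completed abaci and the action of `W` on them -/

namespace CoreAbacus

variable {X : AffineType} {l : ℕ}

/-- The length criterion concerns multiplication on the right; inversion transfers it to the left,
where generators are applied to abaci. -/
theorem length_inv (w : W X l) : length w⁻¹ = length w := by
  have h : ∀ w : W X l, length w⁻¹ ≤ length w := by
    intro w
    obtain ⟨L, rfl, hL⟩ := exists_word_length w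
    rw [← word_reverse, ← hL, ← List.length_reverse]
    exact length_word_le _
  exact le_antisymm (h w) (by simpa using h w⁻¹)

/-- The completion of a half abacus by a reflection; a whole abacus is its own completion. -/
def completion (refl : ℤ → ℤ) {lo : WithBot ℤ} (B : Abacus lo) : Set ℤ :=
  {x | x ∈ B.beads ∨ ¬ lo ≤ (x : WithBot ℤ) ∧ refl x ∉ B.beads}

/-- A position model together with the data that relate it to the abacus of `Λ_j`. -/
structure AbacusModel (X : AffineType) (l : ℕ) (j : Fin (l + 1)) extends PositionModel X l where
  /-- The reflection that completes half abaci. -/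
  refl : ℤ → ℤ
  /-- Twice the value of the functionals at the centre of the reflection. -/
  centre : ℝ
  fn_refl : start X l j ≠ ⊥ → ∀ x v, fn (refl x) v = centre - fn x v
  not_start_le_refl : start X l j ≠ ⊥ → ∀ x : ℤ, start X l j ≤ (x : WithBot ℤ) →
    ¬ start X l j ≤ (refl x : WithBot ℤ)
  -- The exception is a position fixed by the reflection. It lies below the start and is always
  -- occupied in a completed abacus.
  start_le_refl : ∀ x : ℤ, ¬ start X l j ≤ (x : WithBot ℤ) → refl x ≠ x →
    start X l j ≤ (refl x : WithBot ℤ)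
  -- A pair crossing the start comes with its mirror image, from `refl (perm i x)` to `refl x`.
  -- Above the start, both together appear as new beads at `perm i x` and `refl x`, which may
  -- coincide.
  move_iff : ∀ (i : Fin (l + 1)) (R A : Set ℤ), Move X l (start X l j) i R A ↔
    (∃ x : ℤ, x < perm i x ∧ start X l j ≤ (x : WithBot ℤ) ∧ R = {x} ∧ A = {perm i x}) ∨
    (∃ x : ℤ, ¬ start X l j ≤ (x : WithBot ℤ) ∧ start X l j ≤ (perm i x : WithBot ℤ) ∧
      R = ∅ ∧ A = {perm i x, refl x})
  /-- The beads of the abacus of `Λ_j` are the positions with value above this at the vertex. -/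
  level : ℝ
  mem_fundamental : ∀ x, x ∈ completion refl (fundamentalAbacus X l j) ↔
    level < fn x (vertex j)
  vertex_determined : ∀ w w' : W X l,
    (∀ x, level < fn x ((w : Equiv.Perm (V X l)) (vertex j)) ↔
      level < fn x ((w' : Equiv.Perm (V X l)) (vertex j))) →
    (w : Equiv.Perm (V X l)) (vertex j) = (w' : Equiv.Perm (V X l)) (vertex j)

namespace AbacusModel

variable {j : Fin (l + 1)} (M : AbacusModel X l j)

/-- The completion of an abacus. -/
def full (B : Abacus (start X l j)) : Set ℤ := completion M.refl B

theorem mem_full_of_le {B : Abacus (start X l j)} {x : ℤ} (hx : start X l j ≤ (x : WithBot ℤ)) :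
    x ∈ M.full B ↔ x ∈ B.beads := by
  simp [full, completion, hx]

theorem mem_full_of_not_le {B : Abacus (start X l j)} {x : ℤ}
    (hx : ¬ start X l j ≤ (x : WithBot ℤ)) : x ∈ M.full B ↔ M.refl x ∉ B.beads := by
  have : x ∉ B.beads := fun h => hx (B.lo_le x h)
  simp only [full, completion, Set.mem_ofPred_eq, this, false_or, and_iff_right hx]

theorem full_injective {B C : Abacus (start X l j)} (h : ∀ x, x ∈ M.full B ↔ x ∈ M.full C) :
    B = C := by
  ext x
  by_cases hx : start X l j ≤ (x : WithBot ℤ)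
  · rw [← M.mem_full_of_le hx, h, M.mem_full_of_le hx]
  · exact iff_of_false (fun h => hx (B.lo_le x h)) (fun h => hx (C.lo_le x h))

theorem start_ne_bot {x : ℤ} (hx : ¬ start X l j ≤ (x : WithBot ℤ)) : start X l j ≠ ⊥ := by
  rintro h
  exact hx (h ▸ bot_le)

theorem refl_refl (h : start X l j ≠ ⊥) (x : ℤ) : M.refl (M.refl x) = x :=
  M.fn_injective fun v => by rw [M.fn_refl h, M.fn_refl h]; ring

theorem perm_refl (h : start X l j ≠ ⊥) (i : Fin (l + 1)) (x : ℤ) :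
    M.perm i (M.refl x) = M.refl (M.perm i x) :=
  M.perm_eq fun v => by rw [M.fn_refl h, M.fn_refl h, M.fn_perm]

/-- A position equal to its mirror image has a constant functional, half of `centre`, so every
generator fixes it. -/
theorem perm_of_refl_eq (h : start X l j ≠ ⊥) {x : ℤ} (hx : M.refl x = x) (i : Fin (l + 1)) :
    M.perm i x = x :=
  M.perm_eq fun v => by
    have h1 := M.fn_refl h x v
    have h2 := M.fn_refl h x (genPerm X l i v)
    rw [hx] at h1 h2
    linarith

theorem refl_mem_full (h : start X l j ≠ ⊥) {B : Abacus (start X l j)} {x : ℤ}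
    (hx : M.refl x ≠ x) : M.refl x ∈ M.full B ↔ x ∉ M.full B := by
  by_cases h1 : start X l j ≤ (x : WithBot ℤ)
  · rw [M.mem_full_of_le h1, M.mem_full_of_not_le (M.not_start_le_refl h x h1), M.refl_refl h]
  · rw [M.mem_full_of_not_le h1, M.mem_full_of_le (M.start_le_refl x h1 hx), not_not]

theorem move_of_mem {i : Fin (l + 1)} {R A : Set ℤ} (h : Move X l (start X l j) i R A) {x : ℤ}
    (hx : start X l j ≤ (x : WithBot ℤ)) (hm : x ∈ R ∨ x ∈ A) :
    (x < M.perm i x ∧ R = {x} ∧ A = {M.perm i x}) ∨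
    (M.perm i x < x ∧ start X l j ≤ (M.perm i x : WithBot ℤ) ∧ R = {M.perm i x} ∧ A = {x}) ∨
    (¬ start X l j ≤ (M.perm i x : WithBot ℤ) ∧ R = ∅ ∧ A = {x, M.refl (M.perm i x)}) := by
  rcases (M.move_iff i R A).1 h with ⟨y, h1, h2, rfl, rfl⟩ | ⟨y, h1, h2, rfl, rfl⟩
  · rcases hm with hm | hm
    · obtain rfl : x = y := hm
      exact .inl ⟨h1, rfl, rfl⟩
    · obtain rfl : x = M.perm i y := hm
      rw [M.perm_perm]
      exact .inr (.inl ⟨h1, h2, rfl, rfl⟩)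
  · have hb := start_ne_bot h1
    rcases hm with hm | hm | hm
    · exact hm.elim
    · rw [hm, M.perm_perm]
      exact .inr (.inr ⟨h1, rfl, rfl⟩)
    · have hm : x = M.refl y := hm
      rw [hm, M.perm_refl hb, M.refl_refl hb]
      exact .inr (.inr ⟨M.not_start_le_refl hb _ h2, rfl, Set.pair_comm _ _⟩)

/-- The move through a position is determined by the position and its image under the generator.
This is the disjointness of moves that makes performing them simultaneously meaningful. -/
theorem move_eq (M : AbacusModel X l j) {i : Fin (l + 1)} {R A R' A' : Set ℤ}
    (h : Move X l (start X l j) i R A)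
    (h' : Move X l (start X l j) i R' A') {x : ℤ} (hx : start X l j ≤ (x : WithBot ℤ))
    (hm : x ∈ R ∨ x ∈ A) (hm' : x ∈ R' ∨ x ∈ A') : R = R' ∧ A = A' := by
  rcases M.move_of_mem h hx hm with ⟨h1, rfl, rfl⟩ | ⟨h1, h2, rfl, rfl⟩ | ⟨h1, rfl, rfl⟩ <;>
  rcases M.move_of_mem h' hx hm' with ⟨h3, rfl, rfl⟩ | ⟨h3, h4, rfl, rfl⟩ | ⟨h3, rfl, rfl⟩
  · exact ⟨rfl, rfl⟩
  · exact absurd h1 h3.not_gt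
  · exact absurd (hx.trans (WithBot.coe_le_coe.2 h1.le)) h3
  · exact absurd h1 h3.not_gt
  · exact ⟨rfl, rfl⟩
  · exact absurd h2 h3
  · exact absurd (hx.trans (WithBot.coe_le_coe.2 h3.le)) h1
  · exact absurd h4 h1
  · exact ⟨rfl, rfl⟩

/-- Only one move meets `x`, and doing or undoing it exchanges the contents of `x` and `perm i x`.
If `perm i x` is below the start, its content is opposite to that of its mirror image, so the two
beads are set or removed exactly when `x` and this mirror image are both empty or both full. -/
theorem mem_sigmaBeads (i : Fin (l + 1)) (B : Abacus (start X l j)) {x : ℤ}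
    (hx : start X l j ≤ (x : WithBot ℤ)) :
    x ∈ sigmaBeads X l (start X l j) i B.beads ↔ M.perm i x ∈ M.full B := by
  have key : ∀ R A, Move X l (start X l j) i R A → (x ∈ R ∨ x ∈ A) →
      (x ∈ sigmaBeads X l (start X l j) i B.beads ↔
        (x ∈ B.beads ∧ ¬ (Allowed R A B.beads ∧ x ∈ R ∨ Allowed A R B.beads ∧ x ∈ A)) ∨
          (Allowed R A B.beads ∧ x ∈ A ∨ Allowed A R B.beads ∧ x ∈ R)) := by
    intro R A hM hm
    refine or_congr (and_congr Iff.rfl (not_congr ?_)) ?_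
    · refine ⟨fun ⟨R', A', hM', h⟩ => ?_, fun h => ⟨R, A, hM, h⟩⟩
      obtain ⟨rfl, rfl⟩ := M.move_eq hM hM' hx hm (h.imp And.right And.right)
      exact h
    · refine ⟨fun ⟨R', A', hM', h⟩ => ?_, fun h => ⟨R, A, hM, h⟩⟩
      obtain ⟨rfl, rfl⟩ := M.move_eq hM hM' hx hm (h.symm.imp And.right And.right)
      exact h
  by_cases hy : start X l j ≤ (M.perm i x : WithBot ℤ)
  · rw [M.mem_full_of_le hy]
    rcases lt_trichotomy x (M.perm i x) with h | h | h
    · rw [key {x} {M.perm i x} ((M.move_iff _ _ _).2 (.inl ⟨x, h, hx, rfl, rfl⟩)) (.inl rfl)]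
      have h1 : x ∉ ({M.perm i x} : Set ℤ) := h.ne
      simp only [Allowed, Set.singleton_subset_iff, Set.disjoint_singleton_left, h1,
        Set.mem_singleton_iff]
      tauto
    · have hn : ∀ R A, Move X l (start X l j) i R A → x ∉ R ∧ x ∉ A := by
        intro R A hM
        rw [← not_or]
        intro hm
        rcases M.move_of_mem hM hx hm with ⟨h1, -⟩ | ⟨h1, -⟩ | ⟨h1, -⟩
        · exact h1.ne h
        · exact h1.ne h.symm
        · exact h1 hy
      rw [← h]
      refine ⟨?_, fun h1 => .inl ⟨h1, ?_⟩⟩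
      · rintro (h1 | ⟨R, A, hM, h1 | h1⟩)
        · exact h1.1
        · exact ((hn _ _ hM).2 h1.2).elim
        · exact ((hn _ _ hM).1 h1.2).elim
      · rintro ⟨R, A, hM, h1 | h1⟩
        · exact (hn _ _ hM).1 h1.2
        · exact (hn _ _ hM).2 h1.2
    · rw [key {M.perm i x} {x} ((M.move_iff _ _ _).2
        (.inl ⟨M.perm i x, by rwa [M.perm_perm], hy, rfl, by rw [M.perm_perm]⟩)) (.inr rfl)]
      have h1 : x ∉ ({M.perm i x} : Set ℤ) := h.ne'
      simp only [Allowed, Set.singleton_subset_iff, Set.disjoint_singleton_left, h1,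
        Set.mem_singleton_iff]
      tauto
  · rw [M.mem_full_of_not_le hy, key ∅ {x, M.refl (M.perm i x)} ((M.move_iff _ _ _).2
      (.inr ⟨M.perm i x, hy, by rwa [M.perm_perm], rfl, by rw [M.perm_perm]⟩))
      (.inr (.inl rfl))]
    have h1 : x ∈ ({x, M.refl (M.perm i x)} : Set ℤ) := .inl rfl
    simp only [Allowed, Set.empty_subset, Set.insert_subset_iff, Set.singleton_subset_iff,
      Set.disjoint_insert_left, Set.disjoint_singleton_left, h1,
      Set.mem_empty_iff_false]
    tauto

/-- Below the start this follows from `mem_sigmaBeads` by reflection, which commutes with the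
generators and complements completed abaci, except at its fixed positions; there the generators act
trivially. -/
theorem mem_full_sigma (i : Fin (l + 1)) (B : Abacus (start X l j)) (x : ℤ) :
    x ∈ M.full (sigma X l i B) ↔ M.perm i x ∈ M.full B := by
  have key : ∀ {x : ℤ}, start X l j ≤ (x : WithBot ℤ) →
      (x ∈ M.full (sigma X l i B) ↔ M.perm i x ∈ M.full B) := fun hx => by
    rw [M.mem_full_of_le hx]
    exact M.mem_sigmaBeads i B hx
  by_cases hx : start X l j ≤ (x : WithBot ℤ)
  · exact key hx
  · have hb := start_ne_bot hx
    by_cases hr : M.refl x = x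
    · rw [M.perm_of_refl_eq hb hr, M.mem_full_of_not_le hx, M.mem_full_of_not_le hx, hr]
      exact iff_of_true (fun h => hx (Abacus.lo_le _ _ h)) (fun h => hx (Abacus.lo_le _ _ h))
    · have hr' : M.refl (M.perm i x) ≠ M.perm i x := by
        rw [← M.perm_refl hb]
        exact fun h => hr (M.perm_injective i h)
      have h1 := key (M.start_le_refl x hx hr)
      rw [M.perm_refl hb, M.refl_mem_full hb hr, M.refl_mem_full hb hr'] at h1
      exact not_iff_not.1 h1

/-- The operator built from a word is described by the action of its product on positions, so it
depends only on that product. -/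
theorem exists_action (w : W X l) : ∃ F : Abacus (start X l j) → Abacus (start X l j),
    ∀ B x, x ∈ M.full (F B) ↔ M.act w⁻¹ x ∈ M.full B := by
  induction w using W_induction with
  | one => exact ⟨id, fun B x => by simp [M.act_one]⟩
  | mul i w ih =>
    obtain ⟨F, hF⟩ := ih
    refine ⟨fun B => sigma X l i (F B), fun B x => ?_⟩
    rw [M.mem_full_sigma, hF, mul_inv_rev, M.act_mul, gen_inv, M.act_gen]

/-- The action of `W` on abaci. -/
noncomputable def action : W X l →* Function.End (Abacus (start X l j)) where
  toFun w := (M.exists_action w).choose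
  map_one' := by
    funext B
    exact M.full_injective fun x => by
      rw [(M.exists_action 1).choose_spec, inv_one, M.act_one]; rfl
  map_mul' w w' := by
    funext B
    refine M.full_injective fun x => ?_
    have h1 := (M.exists_action w).choose_spec ((M.exists_action w').choose B) x
    rw [(M.exists_action w').choose_spec, ← M.act_mul, ← mul_inv_rev] at h1
    rw [(M.exists_action (w * w')).choose_spec]
    exact h1.symm

theorem mem_full_action (w : W X l) (B : Abacus (start X l j)) (x : ℤ) :
    x ∈ M.full (M.action w B) ↔ M.act w⁻¹ x ∈ M.full B :=
  (M.exists_action w).choose_spec B x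

theorem action_gen (i : Fin (l + 1)) : M.action (gen X l i) = sigma X l i := by
  funext B
  exact M.full_injective fun x => by
    rw [M.mem_full_action, gen_inv, M.act_gen, M.mem_full_sigma]

theorem action_mul_apply (w w' : W X l) (B : Abacus (start X l j)) :
    M.action (w * w') B = M.action w (M.action w' B) := by rw [map_mul]; rfl

theorem action_one_apply (B : Abacus (start X l j)) : M.action 1 B = B := by rw [map_one]; rfl

/-- This replaces the orbit of abaci by the orbit of the vertex: a moved functional at the vertex
has the value of the original one at the moved vertex. -/
theorem mem_full_orbit (w : W X l) (x : ℤ) :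
    x ∈ M.full (M.action w (fundamentalAbacus X l j)) ↔
      M.level < M.fn x ((w : Equiv.Perm (V X l)) (M.vertex j)) := by
  rw [M.mem_full_action, full, M.mem_fundamental, M.fn_act, inv_inv]

theorem action_mul_gen_fundamental (w : W X l) {i : Fin (l + 1)} (hi : i ≠ j) :
    M.action (w * gen X l i) (fundamentalAbacus X l j) =
      M.action w (fundamentalAbacus X l j) := by
  refine M.full_injective fun x => ?_
  rw [M.mem_full_orbit, M.mem_full_orbit]
  have : ((w * gen X l i : W X l) : Equiv.Perm (V X l)) (M.vertex j) =
    (w : Equiv.Perm (V X l)) (genPerm X l i (M.vertex j)) := rfl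
  rw [this, genPerm_of_wallFun_eq_zero (M.wallFun_vertex hi)]

theorem injOn_grassmannian (M : AbacusModel X l j) :
    Set.InjOn (fun w => M.action w (fundamentalAbacus X l j)) (grassmannian X l j) := by
  intro w hw w' hw' h
  refine M.grassmannian_ext hw hw' (M.vertex_determined _ _ fun x => ?_)
  have h' : M.action w (fundamentalAbacus X l j) = M.action w' (fundamentalAbacus X l j) := h
  rw [← M.mem_full_orbit, ← M.mem_full_orbit, h']

/-! ### Orbits and `f_i`-actions -/

/-- The result of an `f_i`-action. -/
def doMove {lo : WithBot ℤ} {i : ℕ} {R A : Set ℤ} (B : Abacus lo) (h : Move X l lo i R A) :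
    Abacus lo where
  beads := (B.beads \ R) ∪ A
  lo_le := by
    rintro x (hx | hx)
    · exact B.lo_le x hx.1
    · rcases h.shape with ⟨a, b, rfl, rfl, h1, h2, h3⟩ | ⟨rfl, h1, h2⟩
      · rw [Set.mem_singleton_iff.1 hx]
        exact h1.trans (WithBot.coe_le_coe.2 h2)
      · exact (h2 x hx).1
  bddAbove := by
    refine (B.bddAbove.mono Set.sdiff_subset).union ?_
    rcases h.shape with ⟨a, b, rfl, rfl, h1, h2, h3⟩ | ⟨rfl, h1, h2⟩
    · exact bddAbove_singleton
    · exact ⟨_, fun x hx => (h2 x hx).2⟩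
  bddBelow := by
    intro hlo
    have h1 : ((B.beads \ R) ∪ A)ᶜ ⊆ B.beadsᶜ ∪ R := by
      intro x hx
      simp only [Set.mem_compl_iff, Set.mem_union, Set.mem_sdiff, not_or, not_and, not_not] at hx ⊢
      tauto
    refine ((B.bddBelow hlo).union ?_).mono h1
    rcases h.shape with ⟨a, b, rfl, rfl, -⟩ | ⟨rfl, -⟩
    · exact bddBelow_singleton
    · exact bddBelow_empty

theorem start_le_of_mem_move {lo : WithBot ℤ} {i : ℕ} {R A : Set ℤ} (h : Move X l lo i R A)
    {x : ℤ} (hx : x ∈ R ∨ x ∈ A) : lo ≤ (x : WithBot ℤ) := by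
  rcases h.shape with ⟨a, b, rfl, rfl, h1, h2, h3⟩ | ⟨rfl, h1, h2⟩
  · rcases hx with hx | hx
    · rwa [Set.mem_singleton_iff.1 hx]
    · rw [Set.mem_singleton_iff.1 hx]
      exact h1.trans (WithBot.coe_le_coe.2 h2)
  · rcases hx with hx | hx
    · exact hx.elim
    · exact (h2 x hx).1

/-- By `move_eq` the moves use disjoint positions, so performing one of them leaves the others
allowed. -/
theorem exists_chain (M : AbacusModel X l j) (i : Fin (l + 1)) (B : Abacus (start X l j))
    (F : Finset (Set ℤ × Set ℤ))
    (hF : ∀ m ∈ F, Move X l (start X l j) i m.1 m.2 ∧ Allowed m.1 m.2 B.beads) :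
    ∃ C, Relation.ReflTransGen (FAction X l i) B C ∧
      C.beads = (B.beads \ ⋃ m ∈ F, m.1) ∪ ⋃ m ∈ F, m.2 := by
  classical
  induction F using Finset.induction_on with
  | empty => exact ⟨B, .refl, by simp⟩
  | insert m F hm ih =>
    obtain ⟨C, h1, h2⟩ := ih fun m' hm' => hF m' (Finset.mem_insert_of_mem hm')
    obtain ⟨h3, h4, h5⟩ := hF m (Finset.mem_insert_self _ _)
    have hdisj : ∀ x, (x ∈ m.1 ∨ x ∈ m.2) → ∀ m' ∈ F, x ∉ m'.1 ∧ x ∉ m'.2 := by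
      intro x hx m' hm'
      rw [← not_or]
      intro hx'
      obtain ⟨e1, e2⟩ := M.move_eq h3 (hF m' (Finset.mem_insert_of_mem hm')).1
        (start_le_of_mem_move h3 hx) hx hx'
      exact hm (by rwa [show m = m' from Prod.ext e1 e2])
    refine ⟨doMove C h3, h1.tail ⟨m.1, m.2, h3, ⟨?_, ?_⟩, rfl⟩, ?_⟩
    · intro x hx
      rw [h2]
      refine .inl ⟨h4 hx, ?_⟩
      simp only [Set.mem_iUnion, not_exists]
      exact fun m' hm' => (hdisj x (.inl hx) m' hm').1
    · rw [Set.disjoint_left, h2]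
      rintro x hx (h | h)
      · exact Set.disjoint_left.1 h5 hx h.1
      · simp only [Set.mem_iUnion] at h
        obtain ⟨m', hm', h⟩ := h
        exact (hdisj x (.inr hx) m' hm').2 h
    · ext x
      simp only [doMove, h2, Finset.set_biUnion_insert, Set.mem_union, Set.mem_sdiff, not_or]
      have h6 : x ∈ m.1 → x ∉ ⋃ m' ∈ F, m'.2 := by
        intro hx
        simp only [Set.mem_iUnion, not_exists]
        exact fun m' hm' => (hdisj x (.inl hx) m' hm').2
      tauto

/-- An allowed shift starts at a bead and ends at a hole at most three places further. Beads are
bounded above; the holes of a whole abacus and the positions of a half abacus are bounded below.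
Creating moves stay between the start and `l + 3`. -/
theorem finite_allowed (M : AbacusModel X l j) (i : Fin (l + 1)) (B : Abacus (start X l j)) :
    {m : Set ℤ × Set ℤ | Move X l (start X l j) i m.1 m.2 ∧ Allowed m.1 m.2 B.beads}.Finite := by
  obtain ⟨b, hb⟩ := B.bddAbove
  obtain ⟨a, ha⟩ : ∃ a : ℤ,
      ∀ x : ℤ, start X l j ≤ (x : WithBot ℤ) → (∃ y, x ≤ y ∧ y ≤ x + 3 ∧ y ∉ B.beads) →
        a ≤ x := by
    by_cases h : start X l j = ⊥
    · obtain ⟨c, hc⟩ := B.bddBelow h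
      refine ⟨c - 3, ?_⟩
      rintro x - ⟨y, -, h2, h3⟩
      have := hc h3
      omega
    · obtain ⟨c, hc⟩ := WithBot.ne_bot_iff_exists.1 h
      refine ⟨c, fun x hx _ => ?_⟩
      rw [← hc] at hx
      exact WithBot.coe_le_coe.1 hx
  obtain ⟨d, hd⟩ : ∃ d : ℤ, start X l j ≠ ⊥ → start X l j = d := by
    by_cases h : start X l j = ⊥
    · exact ⟨0, fun h' => absurd h h'⟩
    · obtain ⟨c, hc⟩ := WithBot.ne_bot_iff_exists.1 h
      exact ⟨c, fun _ => hc.symm⟩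
  refine (((Set.finite_Icc a b).image fun x => (({x}, {M.perm i x}) : Set ℤ × Set ℤ)).union
    ((Set.finite_Icc d (l + 3)).image fun y =>
      ((∅, {y, M.refl (M.perm i y)}) : Set ℤ × Set ℤ))).subset ?_
  rintro ⟨R, A⟩ ⟨hM, h1, h2⟩
  simp only at hM h1 h2
  have hs := hM.shape
  rcases (M.move_iff i R A).1 hM with ⟨x, h3, h4, rfl, rfl⟩ | ⟨x, h3, h4, rfl, rfl⟩
  · refine .inl ⟨x, ⟨ha x h4 ⟨M.perm i x, h3.le, ?_, Set.disjoint_singleton_left.1 h2⟩,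
      hb (h1 rfl)⟩, rfl⟩
    rcases hs with ⟨x', y, e1, e2, -, -, h5⟩ | ⟨e1, -⟩
    · obtain rfl := Set.singleton_eq_singleton_iff.1 e1
      exact (Set.singleton_eq_singleton_iff.1 e2).trans_le h5
    · exact absurd e1 (Set.singleton_ne_empty _)
  · refine .inr ⟨M.perm i x, ⟨?_, ?_⟩, by simp only [M.perm_perm]⟩
    · rw [hd (start_ne_bot h3)] at h4
      exact WithBot.coe_le_coe.1 h4
    · rcases hs with ⟨x', y, e1, -⟩ | ⟨-, -, h5⟩
      · exact absurd e1.symm (Set.singleton_ne_empty _)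
      · exact (h5 _ (.inl rfl)).2

theorem reflTransGen_sigma (M : AbacusModel X l j) (i : Fin (l + 1)) (B : Abacus (start X l j))
    (h : ∀ R A, Move X l (start X l j) i R A → ¬ Allowed A R B.beads) :
    Relation.ReflTransGen (FAction X l i) B (sigma X l i B) := by
  obtain ⟨C, h1, h2⟩ := M.exists_chain i B (M.finite_allowed i B).toFinset (fun m hm => by
    simpa using hm)
  have h3 : C = sigma X l i B := by
    ext x
    rw [h2]
    simp only [Set.Finite.mem_toFinset, Set.mem_ofPred_eq, sigma, sigmaBeads, Set.mem_union,
      Set.mem_sdiff, Set.mem_iUnion, Prod.exists, exists_prop]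
    refine or_congr (and_congr Iff.rfl (not_congr ?_)) ?_
    · refine exists_congr fun R => exists_congr fun A => ?_
      have := h R A
      tauto
    · refine exists_congr fun R => exists_congr fun A => ?_
      have := h R A
      tauto
  rwa [← h3]

/-- If the generator lengthens `u`, then `u` maps the open alcove to the positive side of wall `k`,
and so the vertex to its closure. There the smaller position of an exchanged pair has the larger or
equal value: a bead at the larger one forces a bead at the smaller one, and nothing can be undone.
-/
theorem not_allowed_of_length_lt (M : AbacusModel X l j) {k : Fin (l + 1)} {u : W X l}
    (hu : length u < length (gen X l k * u)) {R A : Set ℤ}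
    (hM : Move X l (start X l j) k R A) :
    ¬ Allowed A R (M.action u (fundamentalAbacus X l j)).beads := by
  have h1 : 0 < wallFun X l k ((u : Equiv.Perm (V X l)) M.base) := by
    rw [← length_inv, ← length_inv (gen X l k * u), mul_inv_rev, gen_inv,
      M.length_lt_mul_gen_iff, inv_inv] at hu
    exact hu
  have h2 : 0 ≤ wallFun X l k ((u : Equiv.Perm (V X l)) (M.vertex j)) := by
    refine nonneg_of_pos_on_interior (f := fun v => wallFun X l k ((u : Equiv.Perm (V X l)) v))
      ?_ (fun v hv => (M.wallFun_pos_iff u k hv).2 h1) M.base_mem (fun i => M.vertex_nonneg i j)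
    intro v v' t
    obtain ⟨U, hU, -⟩ := exists_linear_part u
    have e : U (v' - v) = (u : Equiv.Perm (V X l)) v' - (u : Equiv.Perm (V X l)) v := by
      rw [eq_sub_iff_add_eq', ← hU, add_sub_cancel]
    simp only [hU, map_smul, e]
    exact wallFun_segment _ _ _ _
  set B := M.action u (fundamentalAbacus X l j)
  have key : ∀ x, x < M.perm k x → M.perm k x ∈ M.full B → x ∈ M.full B := by
    intro x hx h
    rw [M.mem_full_orbit] at h ⊢
    obtain ⟨r, hr, h3⟩ := M.sub_perm_pos hx
    have := h3 ((u : Equiv.Perm (V X l)) (M.vertex j))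
    have := mul_nonneg hr.le h2
    linarith
  rintro ⟨h3, h4⟩
  rcases (M.move_iff k R A).1 hM with ⟨x, h5, h6, rfl, rfl⟩ | ⟨x, h5, h6, rfl, rfl⟩
  · have h7 := h3 (Set.mem_singleton _)
    rw [← M.mem_full_of_le (h6.trans (WithBot.coe_le_coe.2 h5.le))] at h7
    exact Set.disjoint_singleton_left.1 h4 ((M.mem_full_of_le h6).1 (key x h5 h7))
  · have h7 := h3 (.inl rfl)
    have h8 : M.refl x ∈ B.beads := h3 (.inr rfl)
    rw [← M.mem_full_of_le h6] at h7
    have h9 : x < M.perm k x := by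
      by_contra hn
      exact h5 (h6.trans (WithBot.coe_le_coe.2 (not_lt.1 hn)))
    exact (M.mem_full_of_not_le h5).1 (key x h9 h7) h8

theorem isOfType_action (M : AbacusModel X l j) (w : W X l) :
    IsOfType X l j (M.action w (fundamentalAbacus X l j)) := by
  induction hn : length w using Nat.strong_induction_on generalizing w with
  | _ n ih =>
    obtain ⟨L, rfl, hL⟩ := exists_word_length w
    cases L with
    | nil =>
      have : word X l [] = 1 := rfl
      rw [this, M.action_one_apply]
      exact .refl
    | cons k L =>
      have h1 := length_word_le (X := X) L
      rw [List.length_cons] at hL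
      -- The word is reduced, so deleting its first letter shortens the element.
      have h2 : length (word X l L) < length (gen X l k * word X l L) := by
        rw [← word_cons]; omega
      have h3 := ih _ (by rw [word_cons] at hn; omega) (word X l L) rfl
      rw [word_cons, M.action_mul_apply, M.action_gen]
      refine h3.trans ((M.reflTransGen_sigma k _
        fun R A hM => M.not_allowed_of_length_lt h2 hM).lift id fun C D h => ⟨k, ?_, h⟩)
      have := k.2
      omega

/-- The requirement of being of affine type is automatic on the orbit, by `isOfType_action`. -/
theorem isCore_iff (M : AbacusModel X l j) (B : Abacus (start X l j)) :
    IsCore X l j B ↔ ∃ w, M.action w (fundamentalAbacus X l j) = B := by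
  constructor
  · rintro ⟨-, h⟩
    induction h with
    | refl => exact ⟨1, M.action_one_apply _⟩
    | tail h1 h2 ih =>
      obtain ⟨w, rfl⟩ := ih
      obtain ⟨i, hi, rfl⟩ := h2
      refine ⟨gen X l ⟨i, by omega⟩ * w, ?_⟩
      rw [M.action_mul_apply, M.action_gen]
  · rintro ⟨w, rfl⟩
    refine ⟨M.isOfType_action w, ?_⟩
    induction w using W_induction with
    | one => rw [M.action_one_apply]
    | mul i w ih =>
      refine ih.tail ⟨i, by have := i.2; omega, ?_⟩
      rw [M.action_mul_apply, M.action_gen]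

theorem bijOn_grassmannian (M : AbacusModel X l j) :
    Set.BijOn (fun w => M.action w (fundamentalAbacus X l j))
    (grassmannian X l j) {B | IsCore X l j B} := by
  refine ⟨fun w _ => (M.isCore_iff _).2 ⟨w, rfl⟩, M.injOn_grassmannian, fun B hB => ?_⟩
  obtain ⟨w, rfl⟩ := (M.isCore_iff _).1 hB
  exact M.exists_mem_grassmannian j (fun w => M.action w (fundamentalAbacus X l j))
    (fun w i hi => M.action_mul_gen_fundamental w hi) w

theorem main (M : AbacusModel X l j) : ∃ ρ : W X l →* Function.End (Abacus (start X l j)),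
    (∀ i : Fin (l + 1), ρ (gen X l i) = sigma X l i) ∧
    (∀ B, IsCore X l j B →
      ∃! w, w ∈ grassmannian X l j ∧ ρ w (fundamentalAbacus X l j) = B) ∧
    Set.BijOn (fun w => ρ w (fundamentalAbacus X l j))
      (grassmannian X l j) {B | IsCore X l j B} ∧
    ∃ Φ : Abacus (start X l j) → Set (V X l),
      Set.BijOn Φ {B | IsCore X l j B} (alcovesInCone X l j) ∧
      ∀ w ∈ grassmannian X l j,
        Φ (ρ w (fundamentalAbacus X l j)) = alcove w⁻¹ := by
  have hbij := M.bijOn_grassmannian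
  refine ⟨M.action, M.action_gen, fun B hB => ?_, hbij, ?_⟩
  · obtain ⟨w, hw, rfl⟩ := hbij.surjOn hB
    exact ⟨w, ⟨hw, rfl⟩, fun w' h => hbij.injOn h.1 hw h.2⟩
  · let f := Function.invFunOn (fun w => M.action w (fundamentalAbacus X l j)) (grassmannian X l j)
    have hf : ∀ w ∈ grassmannian X l j, f (M.action w (fundamentalAbacus X l j)) = w :=
      fun w hw => hbij.injOn.leftInvOn_invFunOn hw
    refine ⟨fun B => alcove (f B)⁻¹, ⟨?_, ?_, ?_⟩, fun w hw => by simp only [hf w hw]⟩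
    · intro B hB
      obtain ⟨w, hw, rfl⟩ := hbij.surjOn hB
      simp only [hf w hw]
      exact ⟨⟨_, rfl⟩, M.alcove_inv_subset_iff.2 hw⟩
    · intro B hB B' hB' h
      obtain ⟨w, hw, rfl⟩ := hbij.surjOn hB
      obtain ⟨w', hw', rfl⟩ := hbij.surjOn hB'
      simp only [hf w hw, hf w' hw'] at h
      rw [inv_injective (M.alcove_injective h)]
    · rintro _ ⟨⟨u, rfl⟩, hu⟩
      have hu' : u⁻¹ ∈ grassmannian X l j := M.alcove_inv_subset_iff.1 (by rwa [inv_inv])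
      refine ⟨M.action u⁻¹ (fundamentalAbacus X l j), hbij.mapsTo hu', ?_⟩
      simp only [hf _ hu', inv_inv]

end AbacusModel

end CoreAbacus

namespace CoreAbacus

variable {X : AffineType} {l : ℕ}

/-! ### Coordinates on `V` -/

/-- The `i`-th standard coordinate, `i = 1, 2, …`. -/
noncomputable def coord (v : V X l) (i : ℕ) : ℝ :=
  inner ℝ (v : EuclideanSpace ℝ (Fin (ambientDim X l))) (stdVec _ i)

theorem inner_stdVec {n : ℕ} (v : EuclideanSpace ℝ (Fin n)) (i : Fin n) :
    inner ℝ v (stdVec n (i + 1)) = v i := by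
  simp only [stdVec, PiLp.inner_apply]
  rw [Finset.sum_eq_single i]
  · simp
  · intro b _ hb
    have : (b : ℕ) ≠ i := fun h => hb (Fin.ext h)
    simp [this]
  · simp

/-- Only `i` has to be in range: for other `j` the vector `stdVec n j` is zero, in agreement with
the formula. -/
theorem inner_stdVec_stdVec {n i j : ℕ} (hi : 1 ≤ i) (hin : i ≤ n) :
    inner ℝ (stdVec n j) (stdVec n i) = if i = j then (1 : ℝ) else 0 := by
  have h := inner_stdVec (stdVec n j) ⟨i - 1, by omega⟩
  rw [show i - 1 + 1 = i by omega] at h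
  rw [h]
  simp [stdVec, show i - 1 + 1 = i by omega]

theorem coord_ext {v v' : V X l} (h : ∀ i, 1 ≤ i → i ≤ ambientDim X l → coord v i = coord v' i) :
    v = v' := by
  ext m
  have := h (m + 1) (by omega) (by omega)
  rwa [coord, coord, inner_stdVec, inner_stdVec] at this

theorem coord_add (v w : V X l) (i : ℕ) : coord (v + w) i = coord v i + coord w i := by
  simp [coord, inner_add_left]

theorem coord_sub (v w : V X l) (i : ℕ) : coord (v - w) i = coord v i - coord w i := by
  simp [coord, inner_sub_left]

theorem coord_smul (r : ℝ) (v : V X l) (i : ℕ) : coord (r • v) i = r * coord v i := by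
  simp [coord, real_inner_smul_left]

theorem isAffineFun_coord (i : ℕ) : IsAffineFun fun v : V X l => coord v i := fun u v t => by
  simp only [coord_add, coord_smul, coord_sub]

/-- A vector representing the gradient of the `i`-th wall functional in the ambient space. -/
theorem wallVec_of_ne_zero {i : Fin (l + 1)} (hi : i ≠ 0) :
    (wallVec X l i : EuclideanSpace ℝ (Fin (ambientDim X l))) = simpleRootVec X l i := by
  obtain ⟨i, rfl⟩ := Fin.exists_succ_eq.2 hi
  simp [wallVec, simpleRoot]

theorem wallVec_zero :
    (wallVec X l 0 : EuclideanSpace ℝ (Fin (ambientDim X l))) = -(theta X l : _) := by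
  simp [wallVec]

theorem wallFun_of_ne_zero {i : Fin (l + 1)} (hi : i ≠ 0) (v : V X l) :
    wallFun X l i v = inner ℝ (v : EuclideanSpace ℝ (Fin (ambientDim X l)))
      (simpleRootVec X l i) := by
  obtain ⟨i, rfl⟩ := Fin.exists_succ_eq.2 hi
  simp [wallFun, simpleRoot]

theorem wallFun_zero (v : V X l) :
    wallFun X l 0 v = 1 - inner ℝ (v : EuclideanSpace ℝ (Fin (ambientDim X l))) (theta X l) := by
  simp [wallFun]

theorem coord_genPerm (i : Fin (l + 1)) (v : V X l) (m : ℕ) :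
    coord (genPerm X l i v) m = coord v m - wallFun X l i v *
      (2 / inner ℝ (wallVec X l i : EuclideanSpace ℝ (Fin (ambientDim X l))) (wallVec X l i) *
        inner ℝ (wallVec X l i : EuclideanSpace ℝ (Fin (ambientDim X l))) (stdVec _ m)) := by
  rw [genPerm_apply, coord_add, coord_smul, coroot, coord_smul]
  simp only [coord, Submodule.coe_inner]
  ring

theorem coe_theta : (theta X l : EuclideanSpace ℝ (Fin (ambientDim X l))) =
    ∑ i ∈ Finset.range l, (label X l (i + 1) : ℝ) • simpleRootVec X l (i + 1) := by
  rw [theta, Submodule.coe_sum, ← Fin.sum_univ_eq_sum_range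
    (fun i => (label X l (i + 1) : ℝ) • simpleRootVec X l (i + 1))]
  rfl

theorem simpleRootVec_of_lt {i : ℕ} (hi : i < l) :
    simpleRootVec X l i = stdVec _ i - stdVec _ (i + 1) := by
  simp [simpleRootVec, hi]

/-! ### Type `A_l^{(1)}` -/

namespace TypeA

theorem simpleRootVec_eq {i : ℕ} (hi : i ≤ l) :
    simpleRootVec .A1 l i = stdVec _ i - stdVec _ (i + 1) := by
  rcases hi.lt_or_eq with h | rfl
  · exact simpleRootVec_of_lt h
  · simp [simpleRootVec]

theorem theta_eq : (theta .A1 l : EuclideanSpace ℝ (Fin (ambientDim .A1 l))) =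
    stdVec _ 1 - stdVec _ (l + 1) := by
  rw [coe_theta]
  have h : ∀ n ≤ l, ∑ i ∈ Finset.range n, (label .A1 l (i + 1) : ℝ) • simpleRootVec .A1 l (i + 1) =
      stdVec _ 1 - stdVec _ (n + 1) := by
    intro n hn
    induction n with
    | zero => simp
    | succ n ih =>
      rw [Finset.sum_range_succ, ih (by omega), simpleRootVec_eq (by omega)]
      simp [label]
  exact h l le_rfl

theorem wallFun_zero_eq (v : V .A1 l) : wallFun .A1 l 0 v = 1 - (coord v 1 - coord v (l + 1)) := by
  rw [wallFun_zero, theta_eq, inner_sub_right]; rfl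

theorem wallFun_eq {i : Fin (l + 1)} (hi : i ≠ 0) (v : V .A1 l) :
    wallFun .A1 l i v = coord v i - coord v (i + 1) := by
  rw [wallFun_of_ne_zero hi, simpleRootVec_eq (by omega), inner_sub_right]; rfl

theorem coord_genPerm_zero (hl : 1 ≤ l) (v : V .A1 l) {m : ℕ} (h1 : 1 ≤ m) (h2 : m ≤ l + 1) :
    coord (genPerm .A1 l 0 v) m = if m = 1 then coord v (l + 1) + 1 else
      if m = l + 1 then coord v 1 - 1 else coord v m := by
  have h3 : m ≤ ambientDim .A1 l := h2
  have h4 : l + 1 ≤ ambientDim .A1 l := le_rfl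
  have h5 : 1 ≤ ambientDim .A1 l := by omega
  rw [coord_genPerm, wallFun_zero_eq, wallVec_zero, theta_eq]
  simp only [inner_neg_left, inner_neg_right, inner_sub_left, inner_sub_right,
    inner_stdVec_stdVec h1 h3, inner_stdVec_stdVec le_rfl h5,
    inner_stdVec_stdVec (Nat.le_add_left 1 l) h4, if_true]
  have e1 : (1 : ℕ) ≠ l + 1 := by omega
  split_ifs <;> subst_vars <;> first | omega | (norm_num; done) | (norm_num; ring)

theorem coord_genPerm_of_ne {i : Fin (l + 1)} (hi : i ≠ 0) (v : V .A1 l) {m : ℕ} (h1 : 1 ≤ m)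
    (h2 : m ≤ l + 1) : coord (genPerm .A1 l i v) m = if m = i then coord v (i + 1) else
      if m = i + 1 then coord v i else coord v m := by
  have hi0 : 1 ≤ (i : ℕ) := Nat.one_le_iff_ne_zero.2 fun h => hi (Fin.ext h)
  have h3 : m ≤ ambientDim .A1 l := h2
  have h4 : (i : ℕ) + 1 ≤ ambientDim .A1 l := by change (i : ℕ) + 1 ≤ l + 1; omega
  rw [coord_genPerm, wallFun_eq hi, wallVec_of_ne_zero hi, simpleRootVec_eq (by omega)]
  simp only [inner_sub_left, inner_sub_right,
    inner_stdVec_stdVec h1 h3, inner_stdVec_stdVec hi0 (by omega : (i : ℕ) ≤ ambientDim .A1 l),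
    inner_stdVec_stdVec (Nat.le_add_left 1 i) h4, if_true]
  split_ifs <;> subst_vars <;> first | omega | norm_num

/-- The coordinates of a combination of the roots `e_i - e_{i+1}` are the increments of its
coefficients, extended by zero at both ends; `g` is this coefficient function. -/
theorem exists_coord (g : ℕ → ℝ) (h0 : g 0 = 0) (hg : g (l + 1) = 0) :
    ∃ v : V .A1 l, ∀ m, m ≤ l → coord v (m + 1) = g (m + 1) - g m := by
  refine ⟨∑ i : Fin l, g (i + 1) • simpleRoot .A1 l i, fun m hm => ?_⟩
  have hm' : m + 1 ≤ ambientDim .A1 l := by change m + 1 ≤ l + 1; omega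
  have h1 : coord (∑ i : Fin l, g (i + 1) • simpleRoot .A1 l i) (m + 1) =
      ∑ i ∈ Finset.range l,
        g (i + 1) * ((if m = i then 1 else 0) - if m = i + 1 then 1 else 0) := by
    rw [← Fin.sum_univ_eq_sum_range
      (fun i => g (i + 1) * (((if m = i then 1 else 0) - if m = i + 1 then 1 else 0 : ℝ))), coord,
      Submodule.coe_sum, sum_inner]
    refine Finset.sum_congr rfl fun i _ => ?_
    have e : (simpleRoot .A1 l i : EuclideanSpace ℝ (Fin (ambientDim .A1 l))) =
      stdVec _ (i + 1) - stdVec _ (i + 1 + 1) := simpleRootVec_eq (by omega)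
    rw [Submodule.coe_smul, real_inner_smul_left, e, inner_sub_left,
      inner_stdVec_stdVec (by omega) hm', inner_stdVec_stdVec (by omega) hm']
    simp
  rw [h1]
  simp only [mul_sub, Finset.sum_sub_distrib, mul_ite, mul_one, mul_zero, Finset.sum_ite_eq,
    Finset.mem_range]
  congr 1
  · split_ifs with h
    · rfl
    · rw [show m = l by omega, hg]
  · rcases m with _ | m
    · simp [h0]
    · simp only [add_left_inj, Finset.sum_ite_eq, Finset.mem_range]
      rw [if_pos (by omega)]

/-- The functional of a position. -/
noncomputable def posFun (l : ℕ) (x : ℤ) (v : V .A1 l) : ℝ :=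
  coord v ((x % (l + 1)).toNat + 1) - (x / (l + 1) : ℤ)

theorem posFun_eq (k : ℤ) {r : ℕ} (hr : r ≤ l) (v : V .A1 l) :
    posFun l (k * (l + 1) + r) v = coord v (r + 1) - k := by
  have h1 : (k * (l + 1) + r) % ((l : ℤ) + 1) = r := by
    rw [add_comm, Int.add_mul_emod_self_right]
    exact Int.emod_eq_of_lt (by omega) (by omega)
  have h2 : (k * (l + 1) + r) / ((l : ℤ) + 1) = k := by
    rw [add_comm, Int.add_mul_ediv_right _ _ (by omega),
      Int.ediv_eq_zero_of_lt (by omega) (by omega), zero_add]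
  rw [posFun, h1, h2, Int.toNat_natCast]

theorem exists_pos (l : ℕ) (x : ℤ) : ∃ (k : ℤ) (r : ℕ), r ≤ l ∧ x = k * (l + 1) + r := by
  have h1 := Int.emod_nonneg x (b := (l : ℤ) + 1) (by omega)
  have h2 := Int.emod_lt_of_pos x (b := (l : ℤ) + 1) (by omega)
  refine ⟨x / (l + 1), (x % (l + 1)).toNat, by omega, ?_⟩
  have h3 := Int.ediv_mul_add_emod x ((l : ℤ) + 1)
  rw [Int.toNat_of_nonneg h1]
  exact h3.symm

theorem posFun_genPerm (hl : 1 ≤ l) (i : Fin (l + 1)) (k : ℤ) {r : ℕ} (hr : r ≤ l) (v : V .A1 l) :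
    posFun l (k * (l + 1) + r) (genPerm .A1 l i v) =
      posFun l (if r + 1 = i ∨ r = l ∧ i = 0 then k * (l + 1) + r + 1 else
        if r = i then k * (l + 1) + r - 1 else k * (l + 1) + r) v := by
  have key := posFun_eq (l := l) k hr
  rw [key]
  by_cases hi : i = 0
  · subst hi
    rw [coord_genPerm_zero hl v (by omega) (by omega)]
    have hz : ((0 : Fin (l + 1)) : ℕ) = 0 := rfl
    by_cases h1 : r = l
    · subst h1
      rw [if_neg (by omega), if_pos rfl, if_pos (by simp),
        show k * (r + 1) + r + 1 = (k + 1) * (r + 1) + (0 : ℕ) by push_cast; ring,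
        posFun_eq _ (by omega)]
      push_cast; ring
    · rw [if_neg (show ¬ (r + 1 = ((0 : Fin (l + 1)) : ℕ) ∨ r = l ∧ (0 : Fin (l + 1)) = 0) by
        rw [hz]; omega)]
      by_cases h2 : r = 0
      · subst h2
        rw [if_pos (by omega), if_pos hz.symm,
          show k * (l + 1) + (0 : ℕ) - 1 = (k - 1) * (l + 1) + (l : ℕ) by push_cast; ring,
          posFun_eq _ (by omega)]
        push_cast; ring
      · rw [if_neg (by omega), if_neg (by omega), if_neg (by rwa [hz]), key]
  · rw [coord_genPerm_of_ne hi v (by omega) (by omega)]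
    have hi0 : (i : ℕ) ≠ 0 := fun h => hi (Fin.ext h)
    by_cases h1 : r + 1 = i
    · rw [if_pos h1, if_pos (.inl h1),
        show k * (l + 1) + (r : ℤ) + 1 = k * (l + 1) + ((r + 1 : ℕ) : ℤ) by push_cast; ring,
        posFun_eq _ (by omega), h1]
    · rw [if_neg h1, if_neg (show ¬ (r + 1 = i ∨ r = l ∧ i = 0) by simp [h1, hi])]
      by_cases h2 : r = i
      · rw [if_pos (by omega), if_pos h2,
          show k * (l + 1) + (r : ℤ) - 1 = k * (l + 1) + ((r - 1 : ℕ) : ℤ) by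
            push_cast [show 1 ≤ r by omega]; ring, posFun_eq _ (by omega), ← h2,
          show r - 1 + 1 = r by omega]
      · rw [if_neg (by omega), if_neg h2, key]

/-- Consecutive positions differ by a wall functional. In type A all pairs of positions, and not
only the roots, therefore have constant sign on the alcove. -/
theorem strictAnti_posFun (hl : 1 ≤ l) {v : V .A1 l} (hv : IsInterior v) :
    StrictAnti (posFun l · v) := by
  refine strictAnti_int_of_succ_lt fun x => ?_
  obtain ⟨k, r, hr, rfl⟩ := exists_pos l x
  rcases hr.lt_or_eq with h | rfl
  · rw [show k * (l + 1) + (r : ℤ) + 1 = k * (l + 1) + ((r + 1 : ℕ) : ℤ) by push_cast; ring,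
      posFun_eq _ (by omega), posFun_eq _ (by omega)]
    have h1 := hv ⟨r + 1, by omega⟩
    rw [wallFun_eq (by simp [Fin.ext_iff])] at h1
    linarith
  · rw [show k * (r + 1) + (r : ℤ) + 1 = (k + 1) * (r + 1) + (0 : ℕ) by push_cast; ring,
      posFun_eq _ (by omega), posFun_eq _ (by omega)]
    have h1 := hv 0
    rw [wallFun_zero_eq] at h1
    push_cast
    linarith

theorem exists_base (l : ℕ) : ∃ v : V .A1 l, IsInterior v := by
  -- The coordinates are equally spaced with gap `1/(l+1)`, which makes all wall functionals, the
  -- zeroth included, equal to `1/(l+1)`.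
  obtain ⟨v, hv⟩ := exists_coord (l := l) (fun m => (m * (l + 1 - m) : ℝ) / (2 * l + 2))
    (by simp) (by simp)
  have h2 : (0 : ℝ) < 2 * l + 2 := by positivity
  have hv' : ∀ m, m ≤ l → coord v (m + 1) = (l - 2 * m : ℝ) / (2 * l + 2) := by
    intro m hm
    rw [hv m hm]
    push_cast
    field_simp
    ring
  refine ⟨v, fun i => ?_⟩
  by_cases hi : i = 0
  · subst hi
    have h1 := hv' 0 (by omega)
    rw [zero_add] at h1
    rw [wallFun_zero_eq, hv' l le_rfl, h1, ← sub_div, sub_pos, div_lt_one h2]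
    push_cast; linarith
  · obtain ⟨i, rfl⟩ := Fin.exists_succ_eq.2 hi
    rw [wallFun_eq hi, Fin.val_succ, hv' i (by omega), hv' (i + 1) (by omega), ← sub_div]
    push_cast
    apply div_pos _ h2
    linarith

theorem exists_vertex (hl : 1 ≤ l) (j : Fin (l + 1)) : ∃ v : V .A1 l,
    (∀ m, m ≤ l → coord v (m + 1) = (if m < j then 1 else 0) - (j : ℝ) / (l + 1)) ∧
    (∀ i, i ≠ j → wallFun .A1 l i v = 0) ∧ 0 < wallFun .A1 l j v := by
  have h2 : (0 : ℝ) < l + 1 := by positivity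
  -- The vertex is `e_1 + ⋯ + e_j` projected to the vectors with coordinate sum zero, and `min m j`
  -- gives its partial sums before projection.
  obtain ⟨v, hv⟩ := exists_coord (l := l) (fun m => (min m (j : ℕ) : ℕ) - m * (j : ℝ) / (l + 1))
    (by simp) (by
      rw [min_eq_right (by omega)]
      push_cast
      field_simp
      simp)
  have hv' : ∀ m, m ≤ l → coord v (m + 1) = (if m < j then 1 else 0) - (j : ℝ) / (l + 1) := by
    intro m hm
    rw [hv m hm]
    split_ifs with h
    · rw [min_eq_left (by omega), min_eq_left (by omega)]
      push_cast; ring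
    · rw [min_eq_right (by omega), min_eq_right (by omega)]
      push_cast; ring
  have h0 := hv' 0 (by omega)
  rw [zero_add] at h0
  have hw0 : wallFun .A1 l 0 v = if j = 0 then 1 else 0 := by
    rw [wallFun_zero_eq, h0, hv' l le_rfl, if_neg (show ¬ l < (j : ℕ) by omega)]
    by_cases hj : j = 0
    · subst hj; simp
    · have : 0 < (j : ℕ) := Nat.pos_of_ne_zero fun h => hj (Fin.ext h)
      rw [if_pos this, if_neg hj]; ring
  have hw : ∀ i : Fin (l + 1), i ≠ 0 → wallFun .A1 l i v = if i = j then 1 else 0 := by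
    intro i hi
    obtain ⟨i, rfl⟩ := Fin.exists_succ_eq.2 hi
    rw [wallFun_eq hi, Fin.val_succ, hv' i (by omega), hv' (i + 1) (by omega)]
    have e : i.succ = j ↔ (i : ℕ) + 1 = j := by rw [Fin.ext_iff, Fin.val_succ]
    simp only [e]
    split_ifs <;> first | omega | norm_num
  refine ⟨v, hv', fun i hij => ?_, ?_⟩
  · by_cases hi : i = 0
    · subst hi; rw [hw0, if_neg hij.symm]
    · rw [hw i hi, if_neg hij]
  · by_cases hj : j = 0
    · subst hj; rw [hw0, if_pos rfl]; exact one_pos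
    · rw [hw j hj, if_pos rfl]; exact one_pos

/-- The permutation of the positions by a generator. -/
noncomputable def posPerm (hl : 1 ≤ l) (i : Fin (l + 1)) (x : ℤ) : ℤ :=
  (show ∃ y, ∀ v, posFun l y v = posFun l x (genPerm .A1 l i v) by
    obtain ⟨k, r, hr, rfl⟩ := exists_pos l x
    exact ⟨_, fun v => (posFun_genPerm hl i k hr v).symm⟩).choose

theorem posFun_posPerm (hl : 1 ≤ l) (i : Fin (l + 1)) (x : ℤ) (v : V .A1 l) :
    posFun l (posPerm hl i x) v = posFun l x (genPerm .A1 l i v) :=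
  Exists.choose_spec (p := fun y => ∀ v, posFun l y v = posFun l x (genPerm .A1 l i v)) _ v

theorem posPerm_eq (hl : 1 ≤ l) (i : Fin (l + 1)) (k : ℤ) {r : ℕ} (hr : r ≤ l) :
    posPerm hl i (k * (l + 1) + r) = if r + 1 = i ∨ r = l ∧ i = 0 then k * (l + 1) + r + 1 else
        if r = i then k * (l + 1) + r - 1 else k * (l + 1) + r := by
  obtain ⟨b, hb⟩ := exists_base l
  refine (strictAnti_posFun hl hb).injective ?_
  rw [posFun_posPerm, posFun_genPerm hl i k hr]

/-- The position model of type `A_l^{(1)}`. -/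
noncomputable def positionModel (hl : 1 ≤ l) : PositionModel .A1 l where
  fn := posFun l
  isAffine x u v t := by
    simp only [posFun, isAffineFun_coord _ u v t]; ring
  perm := posPerm hl
  fn_perm := posFun_posPerm hl
  base := (exists_base l).choose
  base_mem := (exists_base l).choose_spec
  anti := strictAnti_posFun hl (exists_base l).choose_spec
  vertex j := (exists_vertex hl j).choose
  wallFun_vertex {i j} h := (exists_vertex hl j).choose_spec.2.1 i h
  vertex_pos j := (exists_vertex hl j).choose_spec.2.2
  exists_perm_ne i := by
    refine ⟨0 * (l + 1) + (i : ℕ), ?_⟩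
    rw [posPerm_eq hl i 0 (by omega)]
    split_ifs <;> omega
  sign _ hpq v hv := strictAnti_posFun hl hv hpq

theorem positionModel_vertex (hl : 1 ≤ l) (j : Fin (l + 1)) {m : ℕ} (hm : m ≤ l) :
    coord ((positionModel hl).vertex j) (m + 1) = (if m < j then 1 else 0) - (j : ℝ) / (l + 1) :=
  (exists_vertex hl j).choose_spec.1 m hm

/-- The generators permute the coordinates up to integers. This discreteness lets a bead set recover
a point of the orbit. -/
theorem exists_int_coord (hl : 1 ≤ l) (j : Fin (l + 1)) (w : W .A1 l) {m : ℕ} (h1 : 1 ≤ m)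
    (h2 : m ≤ l + 1) : ∃ n : ℤ, coord ((w : Equiv.Perm (V .A1 l)) ((positionModel hl).vertex j)) m =
      n - (j : ℝ) / (l + 1) := by
  induction w using W_induction generalizing m with
  | one =>
    obtain ⟨m, rfl⟩ := Nat.exists_eq_add_of_le' h1
    refine ⟨if m < j then 1 else 0, ?_⟩
    simp [positionModel_vertex hl j (show m ≤ l by omega)]
  | mul i w ih =>
    change ∃ n : ℤ, coord (genPerm .A1 l i
      ((w : Equiv.Perm (V .A1 l)) ((positionModel hl).vertex j))) m = n - (j : ℝ) / (l + 1)
    by_cases hi : i = 0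
    · subst hi
      rw [coord_genPerm_zero hl _ h1 h2]
      split_ifs
      · obtain ⟨n, hn⟩ := ih (m := l + 1) (by omega) (by omega)
        exact ⟨n + 1, by rw [hn]; push_cast; ring⟩
      · obtain ⟨n, hn⟩ := ih (m := 1) (by omega) (by omega)
        exact ⟨n - 1, by rw [hn]; push_cast; ring⟩
      · exact ih h1 h2
    · have hi0 : (i : ℕ) ≠ 0 := fun h => hi (Fin.ext h)
      rw [coord_genPerm_of_ne hi _ h1 h2]
      split_ifs
      · exact ih (by omega) (by omega)
      · exact ih (by omega) (by omega)
      · exact ih h1 h2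

theorem modEq_iff (k : ℤ) {r i : ℕ} (hr : r ≤ l) (hi : i ≤ l) :
    k * (l + 1) + r + 1 ≡ i [ZMOD ((l : ℤ) + 1)] ↔ r + 1 = i ∨ r = l ∧ i = 0 := by
  have h : k * (l + 1) + r + 1 ≡ r + 1 [ZMOD ((l : ℤ) + 1)] := by
    rw [Int.modEq_iff_dvd]
    exact ⟨-k, by ring⟩
  have h2 : (k * (l + 1) + r + 1 ≡ i [ZMOD ((l : ℤ) + 1)]) ↔
      ((r : ℤ) + 1 ≡ i [ZMOD ((l : ℤ) + 1)]) := ⟨h.symm.trans, h.trans⟩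
  rw [h2]
  have h3 : (i : ℤ) % ((l : ℤ) + 1) = i := Int.emod_eq_of_lt (by omega) (by omega)
  rcases hr.lt_or_eq with h4 | rfl
  · have h5 : ((r : ℤ) + 1) % ((l : ℤ) + 1) = r + 1 := Int.emod_eq_of_lt (by omega) (by omega)
    rw [Int.ModEq, h3, h5]; omega
  · rw [Int.ModEq, h3, Int.emod_self]; omega

/-- The abacus model of type `A_l^{(1)}`. -/
noncomputable def abacusModel (hl : 1 ≤ l) (j : Fin (l + 1)) : AbacusModel .A1 l j where
  toPositionModel := positionModel hl
  refl := id
  centre := 0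
  fn_refl h := absurd rfl h
  not_start_le_refl h := absurd rfl h
  start_le_refl x h := absurd bot_le h
  move_iff i R A := by
    have hperm : (positionModel hl).perm = posPerm hl := rfl
    rw [hperm]
    constructor
    · intro h
      generalize hn : (i : ℕ) = n at h
      cases h with
      | typeA _ x hX hi hx hlo =>
        subst hn
        left
        obtain ⟨k, r, hr, rfl⟩ := exists_pos l x
        rw [modEq_iff k hr hi] at hx
        have h1 : posPerm hl i (k * (l + 1) + r) = k * (l + 1) + r + 1 := by
          rw [posPerm_eq hl i k hr, if_pos (by rwa [← Fin.val_eq_zero_iff])]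
        exact ⟨_, by rw [h1]; omega, hlo, rfl, by rw [h1]⟩
      | _ => simp at *
    · rintro (⟨x, h1, h2, rfl, rfl⟩ | ⟨x, h1, -⟩)
      · obtain ⟨k, r, hr, rfl⟩ := exists_pos l x
        rw [posPerm_eq hl i k hr] at h1 ⊢
        split_ifs at h1 ⊢ with h3 h4
        · refine .typeA i _ rfl (by omega) ?_ h2
          rw [modEq_iff k hr (by omega), ← Fin.val_eq_zero_iff (a := i)] at *
          exact h3
        · omega
        · omega
      · exact absurd bot_le h1
  -- The values on the orbit lie in the integers shifted by `-j/(l+1)`, and the level lies halfway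
  -- between two of them.
  level := 1 / 2 - (j : ℝ) / (l + 1)
  mem_fundamental x := by
    obtain ⟨k, r, hr, rfl⟩ := exists_pos l x
    have h1 : (positionModel hl).fn = posFun l := rfl
    rw [h1, posFun_eq k hr, positionModel_vertex hl j hr]
    have h2 : (k * (l + 1) + r ∈ completion id (fundamentalAbacus .A1 l j)) ↔
        k * (l + 1) + (r : ℤ) < j := by
      simp [completion, fundamentalAbacus, start]
    rw [h2]
    have hj : (j : ℤ) ≤ l := by omega
    have h3 : (0 : ℤ) ≤ l := by omega
    rcases lt_trichotomy k 0 with hk | rfl | hk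
    · have hk' : (k : ℝ) ≤ -1 := by exact_mod_cast Int.le_sub_one_of_lt hk
      refine iff_of_true ?_ ?_
      · nlinarith
      · split_ifs <;> linarith
    · have : (0 * ((l : ℤ) + 1) + (r : ℤ) < j) ↔ r < (j : ℕ) := by omega
      rw [this]
      split_ifs with h
      · refine iff_of_true h ?_
        push_cast; linarith
      · refine iff_of_false h ?_
        push_cast; linarith
    · have hk' : (1 : ℝ) ≤ k := by exact_mod_cast hk
      refine iff_of_false ?_ ?_
      · nlinarith
      · split_ifs <;> linarith
  vertex_determined w w' h := by
    refine coord_ext fun m h1 h2 => ?_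
    have h2 : m ≤ l + 1 := h2
    obtain ⟨n, hn⟩ := exists_int_coord hl j w h1 h2
    obtain ⟨n', hn'⟩ := exists_int_coord hl j w' h1 h2
    -- Among the positions of residue `m - 1`, the beads are those in the periods `k < n`, so they
    -- determine `n`.
    have key : ∀ k : ℤ, k < n ↔ k < n' := by
      intro k
      have h3 := h (k * (l + 1) + (m - 1 : ℕ))
      have h4 : (positionModel hl).fn = posFun l := rfl
      rw [h4, posFun_eq k (by omega), posFun_eq k (by omega), show m - 1 + 1 = m by omega, hn,
        hn'] at h3
      have h5 : ∀ n : ℤ, (1 / 2 - (j : ℝ) / (l + 1) < n - (j : ℝ) / (l + 1) - k) ↔ k < n := by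
        intro n
        constructor
        · intro h6
          have : (k : ℝ) < n := by linarith
          exact_mod_cast this
        · intro h6
          have : (k : ℝ) + 1 ≤ n := by exact_mod_cast h6
          linarith
      rwa [h5, h5] at h3
    rw [hn, hn']
    have h6 := key n
    have h7 := key n'
    have : n = n' := by omega
    rw [this]

end TypeA

end CoreAbacus

namespace CoreAbacus

variable {X : AffineType} {l : ℕ}

/-! ### The other types -/

namespace TypeBCD

/-- The Dynkin diagram has a fork at the node `0`. -/
abbrev ZeroFork (X : AffineType) : Prop := X = .A2odd ∨ X = .B1 ∨ X = .D1

/-- The decrease of the functionals of the positions along a period. -/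
noncomputable def scale : AffineType → ℝ
  | .D2 => 2
  | _ => 1

theorem scale_pos (X : AffineType) : 0 < scale X := by cases X <;> simp [scale]

theorem scale_of_zeroFork (h : ZeroFork X) : scale X = 1 := by
  rcases h with rfl | rfl | rfl <;> rfl

theorem ambientDim_eq (hX : X ≠ .A1) : ambientDim X l = l := by
  cases X <;> simp_all [ambientDim]

theorem one_le_rank (hl : X.Admissible l) : 1 ≤ l := by
  cases X <;> simp only [AffineType.Admissible] at hl <;> omega

theorem three_le_rank (hl : X.Admissible l) (h : ZeroFork X) : 3 ≤ l := by
  rcases h with rfl | rfl | rfl <;> simp only [AffineType.Admissible] at hl <;> omega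

theorem four_le_rank (hl : X.Admissible l) (h : X = .D1) : 4 ≤ l := by
  subst h; exact hl

theorem sum_simpleRootVec_range (a m : ℕ) (h : a + m ≤ l) :
    ∑ i ∈ Finset.range m, simpleRootVec X l (i + a) = stdVec _ a - stdVec _ (a + m) := by
  induction m with
  | zero => simp
  | succ m ih =>
    rw [Finset.sum_range_succ, ih (by omega), simpleRootVec_of_lt (by omega), add_comm m a,
      add_assoc]
    abel

theorem simpleRootVec_last (hX : X ≠ .A1) (hD : X ≠ .D1) :
    ∃ r : ℝ, 0 < r ∧ simpleRootVec X l l = r • stdVec _ l := by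
  cases X <;> simp only [ne_eq, not_true_eq_false, reduceCtorEq, not_false_eq_true] at hX hD
  · exact ⟨2, by norm_num, by simp [simpleRootVec]⟩
  · exact ⟨2, by norm_num, by simp [simpleRootVec]⟩
  · exact ⟨1, by norm_num, by simp [simpleRootVec]⟩
  · exact ⟨2, by norm_num, by simp [simpleRootVec]⟩
  · exact ⟨1, by norm_num, by simp [simpleRootVec]⟩

theorem simpleRootVec_last_fork (hD : X = .D1) :
    simpleRootVec X l l = stdVec _ (l - 1) + stdVec _ l := by
  subst hD; simp [simpleRootVec]

theorem sum_label_fork (m : ℕ) (hm : m + 2 ≤ l)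
    (h1 : label X l 1 = 1) (h2 : ∀ i < m, label X l (i + 2) = 2) :
    ∑ i ∈ Finset.range (m + 1), (label X l (i + 1) : ℝ) • simpleRootVec X l (i + 1) =
      stdVec _ 1 + stdVec _ 2 - (2 : ℝ) • stdVec _ (m + 2) := by
  rw [Finset.sum_range_succ',
    Finset.sum_congr rfl (g := fun i => (2 : ℝ) • simpleRootVec X l (i + 2))
    (fun i hi => by rw [h2 i (Finset.mem_range.1 hi)]; norm_num), ← Finset.smul_sum,
    sum_simpleRootVec_range 2 m (by omega), zero_add, h1, simpleRootVec_of_lt (by omega),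
    add_comm 2 m]
  module

/-- With labels `1, 2, 2, …` the sum telescopes to `e_1 + e_2` minus twice a later basis vector,
which the roots at the other end cancel. -/
theorem theta_fork (hl : X.Admissible l) (h : ZeroFork X) :
    (theta X l : EuclideanSpace ℝ (Fin (ambientDim X l))) = stdVec _ 1 + stdVec _ 2 := by
  have h3 := three_le_rank hl h
  rw [coe_theta]
  rcases h with rfl | rfl | rfl
  · obtain ⟨m, rfl⟩ := Nat.exists_eq_add_of_le' (show 2 ≤ l by omega)
    rw [Finset.sum_range_succ, sum_label_fork m le_rfl (by simp [label])
      (fun i hi => by simp [label]; omega)]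
    simp [label, simpleRootVec]
  · obtain ⟨m, rfl⟩ := Nat.exists_eq_add_of_le' (show 2 ≤ l by omega)
    rw [Finset.sum_range_succ, sum_label_fork m le_rfl (by simp [label])
      (fun i hi => by simp [label])]
    simp [label, simpleRootVec]
  · have h4 : 4 ≤ l := hl
    obtain ⟨m, rfl⟩ := Nat.exists_eq_add_of_le' h3
    rw [Finset.sum_range_succ, Finset.sum_range_succ, sum_label_fork m (by omega) (by simp [label])
      (fun i hi => by simp [label]; omega)]
    simp only [label, simpleRootVec]
    simp
    module

/-- The sum telescopes to `e_1` for `D2` and to `2 e_1` for `C1` and `A2even`; the factor `2 / scale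
X` covers both. -/
theorem theta_plain (hl : X.Admissible l) (hX : X ≠ .A1) (h : ¬ ZeroFork X) :
    (theta X l : EuclideanSpace ℝ (Fin (ambientDim X l))) = (2 / scale X) • stdVec _ 1 := by
  obtain ⟨m, rfl⟩ := Nat.exists_eq_add_of_le' (one_le_rank hl)
  rw [coe_theta, Finset.sum_range_succ]
  cases X <;> simp only [ne_eq, not_true_eq_false, reduceCtorEq, not_false_eq_true, or_false,
    or_true, ZeroFork, or_self] at hX h
  · rw [Finset.sum_congr rfl (g := fun i => (2 : ℝ) • simpleRootVec _ (m + 1) (i + 1))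
      (fun i hi => by
        have := Finset.mem_range.1 hi
        simp [label, this.ne]), ← Finset.smul_sum, sum_simpleRootVec_range 1 m (by omega)]
    simp [label, simpleRootVec, scale, add_comm 1 m]
    module
  · rw [Finset.sum_congr rfl (g := fun i => (2 : ℝ) • simpleRootVec _ (m + 1) (i + 1))
      (fun i hi => by
        have := Finset.mem_range.1 hi
        simp [label, this.ne]), ← Finset.smul_sum, sum_simpleRootVec_range 1 m (by omega)]
    simp [label, simpleRootVec, scale, add_comm 1 m]
    module
  · rw [Finset.sum_congr rfl (g := fun i => simpleRootVec _ (m + 1) (i + 1))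
      (fun i hi => by simp [label]), sum_simpleRootVec_range 1 m (by omega)]
    simp [label, simpleRootVec, scale, add_comm 1 m]

/-! #### The walls and the generators in coordinates -/

theorem wallFun_mid {i : Fin (l + 1)} (h0 : 0 < (i : ℕ)) (hi : (i : ℕ) < l) (v : V X l) :
    wallFun X l i v = coord v i - coord v (i + 1) := by
  rw [wallFun_of_ne_zero (fun h => by simp [h] at h0), simpleRootVec_of_lt hi, inner_sub_right]
  rfl

theorem wallFun_last (hl : X.Admissible l) (hX : X ≠ .A1) (hD : X ≠ .D1) : ∃ r : ℝ, 0 < r ∧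
    ∀ v : V X l, wallFun X l (Fin.last l) v = r * coord v l := by
  obtain ⟨r, hr, h⟩ := simpleRootVec_last (l := l) hX hD
  have h1 := one_le_rank hl
  refine ⟨r, hr, fun v => ?_⟩
  rw [wallFun_of_ne_zero (fun h => by simp [Fin.ext_iff] at h; omega), Fin.val_last, h,
    real_inner_smul_right]
  rfl

theorem wallFun_last_fork (hl : X.Admissible l) (hD : X = .D1) (v : V X l) :
    wallFun X l (Fin.last l) v = coord v (l - 1) + coord v l := by
  have h1 := one_le_rank hl
  rw [wallFun_of_ne_zero (fun h => by simp [Fin.ext_iff] at h; omega), Fin.val_last,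
    simpleRootVec_last_fork hD, inner_add_right]
  rfl

theorem wallFun_zero_plain (hl : X.Admissible l) (hX : X ≠ .A1) (h : ¬ ZeroFork X) (v : V X l) :
    wallFun X l 0 v = 1 - 2 / scale X * coord v 1 := by
  rw [wallFun_zero, theta_plain hl hX h, real_inner_smul_right]; rfl

theorem wallFun_zero_fork (hl : X.Admissible l) (h : ZeroFork X) (v : V X l) :
    wallFun X l 0 v = scale X - (coord v 1 + coord v 2) := by
  rw [wallFun_zero, theta_fork hl h, inner_add_right, scale_of_zeroFork h]; rfl

theorem inner_stdVec_stdVec' (hX : X ≠ .A1) {i j : ℕ} (hi : 1 ≤ i) (hin : i ≤ l) :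
    inner ℝ (stdVec (ambientDim X l) j) (stdVec (ambientDim X l) i) =
      if i = j then (1 : ℝ) else 0 :=
  inner_stdVec_stdVec hi (hin.trans (ambientDim_eq hX).ge)

theorem coord_mid (hX : X ≠ .A1) {i : Fin (l + 1)} (h0 : 0 < (i : ℕ)) (hi : (i : ℕ) < l)
    (v : V X l) {m : ℕ} (h1 : 1 ≤ m) (h2 : m ≤ l) : coord (genPerm X l i v) m =
      coord v (if m = i then i + 1 else if m = i + 1 then i else m) := by
  rw [coord_genPerm, wallFun_mid h0 hi, wallVec_of_ne_zero (fun h => by simp [h] at h0),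
    simpleRootVec_of_lt hi]
  simp only [inner_sub_left, inner_sub_right, inner_stdVec_stdVec' hX h1 h2,
    inner_stdVec_stdVec' hX h0 hi.le, inner_stdVec_stdVec' hX (Nat.le_add_left 1 i) hi, if_true]
  split_ifs <;> subst_vars <;> first | omega | norm_num

theorem coord_last (hl : X.Admissible l) (hX : X ≠ .A1) (hD : X ≠ .D1) (v : V X l) {m : ℕ}
    (h1 : 1 ≤ m) (h2 : m ≤ l) : coord (genPerm X l (Fin.last l) v) m =
      if m = l then -coord v l else coord v m := by
  have hl1 := one_le_rank hl
  obtain ⟨r, hr, h⟩ := simpleRootVec_last (l := l) hX hD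
  have hne : Fin.last l ≠ 0 := fun h => by simp [Fin.ext_iff] at h; omega
  rw [coord_genPerm, wallFun_of_ne_zero hne, wallVec_of_ne_zero hne, Fin.val_last, h]
  simp only [real_inner_smul_left, real_inner_smul_right, inner_stdVec_stdVec' hX h1 h2,
    inner_stdVec_stdVec' hX hl1 le_rfl, if_true]
  rw [← coord]
  split_ifs
  · subst_vars; field_simp; ring
  · ring

theorem coord_last_fork (hl : X.Admissible l) (hD : X = .D1) (v : V X l) {m : ℕ}
    (h1 : 1 ≤ m) (h2 : m ≤ l) : coord (genPerm X l (Fin.last l) v) m =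
      if m = l then -coord v (l - 1) else if m = l - 1 then -coord v l else coord v m := by
  have hl1 := four_le_rank hl hD
  have hX : X ≠ .A1 := by rintro rfl; cases hD
  have hne : Fin.last l ≠ 0 := fun h => by simp [Fin.ext_iff] at h; omega
  rw [coord_genPerm, wallFun_last_fork hl hD, wallVec_of_ne_zero hne, Fin.val_last,
    simpleRootVec_last_fork hD]
  simp only [inner_add_left, inner_add_right, inner_stdVec_stdVec' hX h1 h2,
    inner_stdVec_stdVec' hX (show 1 ≤ l by omega) le_rfl,
    inner_stdVec_stdVec' hX (show 1 ≤ l - 1 by omega) (show l - 1 ≤ l by omega), if_true]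
  split_ifs <;> subst_vars <;> first | omega | norm_num

theorem coord_zero (hl : X.Admissible l) (hX : X ≠ .A1) (h : ¬ ZeroFork X) (v : V X l) {m : ℕ}
    (h1 : 1 ≤ m) (h2 : m ≤ l) : coord (genPerm X l 0 v) m =
      if m = 1 then scale X - coord v 1 else coord v m := by
  have hl1 := one_le_rank hl
  have hs := scale_pos X
  rw [coord_genPerm, wallFun_zero_plain hl hX h, wallVec_zero, theta_plain hl hX h]
  simp only [inner_neg_left, inner_neg_right, real_inner_smul_left, real_inner_smul_right,
    inner_stdVec_stdVec' hX h1 h2, inner_stdVec_stdVec' hX le_rfl hl1, if_true]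
  split_ifs
  · subst_vars; field_simp; ring
  · ring

theorem coord_zero_fork (hl : X.Admissible l) (h : ZeroFork X) (v : V X l) {m : ℕ}
    (h1 : 1 ≤ m) (h2 : m ≤ l) : coord (genPerm X l 0 v) m =
      if m = 1 then scale X - coord v 2 else if m = 2 then scale X - coord v 1 else coord v m := by
  have hl1 := three_le_rank hl h
  have hX : X ≠ .A1 := by rintro rfl; simp [ZeroFork] at h
  rw [coord_genPerm, wallFun_zero_fork hl h, wallVec_zero, theta_fork hl h]
  simp only [inner_neg_left, inner_neg_right, inner_add_left, inner_add_right,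
    inner_stdVec_stdVec' hX h1 h2, inner_stdVec_stdVec' hX le_rfl (show 1 ≤ l by omega),
    inner_stdVec_stdVec' hX (show 1 ≤ 2 by omega) (show 2 ≤ l by omega), if_true]
  split_ifs <;> subst_vars <;> first | omega | (norm_num; done) | (norm_num; ring)

/-- The index of a generator is `0`, `l` or strictly between. -/
theorem index_cases (i : Fin (l + 1)) : i = 0 ∨ (0 < (i : ℕ) ∧ (i : ℕ) < l) ∨ i = Fin.last l := by
  simp only [Fin.ext_iff, Fin.val_zero, Fin.val_last]; omega

/-- The generators act on the coordinates by signed permutations and translations. -/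
theorem coord_genPerm_cases (hl : X.Admissible l) (hX : X ≠ .A1) (i : Fin (l + 1)) {m : ℕ}
    (h1 : 1 ≤ m) (h2 : m ≤ l) : ∃ m', 1 ≤ m' ∧ m' ≤ l ∧
      ((∀ v, coord (genPerm X l i v) m = coord v m') ∨
        ∃ d : ℤ, ∀ v, coord (genPerm X l i v) m = scale X * d - coord v m') := by
  have hl1 := one_le_rank hl
  rcases index_cases i with rfl | ⟨h0, hi⟩ | rfl
  · by_cases hf : ZeroFork X
    · have hl3 := three_le_rank hl hf
      have key := fun v => coord_zero_fork hl hf v h1 h2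
      by_cases e1 : m = 1
      · exact ⟨2, by omega, by omega, .inr ⟨1, fun v => by rw [key, if_pos e1]; simp⟩⟩
      · by_cases e2 : m = 2
        · exact ⟨1, by omega, by omega, .inr ⟨1, fun v => by rw [key, if_neg e1, if_pos e2]; simp⟩⟩
        · exact ⟨m, h1, h2, .inl fun v => by rw [key, if_neg e1, if_neg e2]⟩
    · have key := fun v => coord_zero hl hX hf v h1 h2
      by_cases e1 : m = 1
      · exact ⟨1, by omega, by omega, .inr ⟨1, fun v => by rw [key, if_pos e1]; simp⟩⟩
      · exact ⟨m, h1, h2, .inl fun v => by rw [key, if_neg e1]⟩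
  · refine ⟨_, ?_, ?_, .inl fun v => coord_mid hX h0 hi v h1 h2⟩ <;> split_ifs <;> omega
  · by_cases hD : X = .D1
    · have hl4 := four_le_rank hl hD
      have key := fun v => coord_last_fork hl hD v h1 h2
      by_cases e1 : m = l
      · exact ⟨l - 1, by omega, by omega, .inr ⟨0, fun v => by rw [key, if_pos e1]; simp⟩⟩
      · by_cases e2 : m = l - 1
        · exact ⟨l, by omega, by omega, .inr ⟨0, fun v => by rw [key, if_neg e1, if_pos e2]; simp⟩⟩
        · exact ⟨m, h1, h2, .inl fun v => by rw [key, if_neg e1, if_neg e2]⟩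
    · have key := fun v => coord_last hl hX hD v h1 h2
      by_cases e1 : m = l
      · exact ⟨l, by omega, by omega, .inr ⟨0, fun v => by rw [key, if_pos e1]; simp⟩⟩
      · exact ⟨m, h1, h2, .inl fun v => by rw [key, if_neg e1]⟩

/-- The vector `e_l` is a multiple of the last root, or in type `D1` half a difference of the last
two; adding simple roots then descends to the other `e_i`. -/
theorem stdVec_mem (hl : X.Admissible l) (hX : X ≠ .A1) {i : ℕ} (h1 : 1 ≤ i) (h2 : i ≤ l) :
    stdVec _ i ∈ V X l := by
  have hroot : ∀ {i}, 1 ≤ i → i ≤ l → simpleRootVec X l i ∈ V X l := by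
    intro i h1 h2
    exact Submodule.subset_span ⟨⟨i - 1, by omega⟩, by simp [show i - 1 + 1 = i by omega]⟩
  have hlast : stdVec _ l ∈ V X l := by
    have h3 := hroot (one_le_rank hl) le_rfl
    by_cases hD : X = .D1
    · have hl4 := four_le_rank hl hD
      have h4 := hroot (i := l - 1) (by omega) (by omega)
      rw [simpleRootVec_last_fork hD] at h3
      rw [simpleRootVec_of_lt (by omega), show l - 1 + 1 = l by omega] at h4
      have h5 := (V X l).smul_mem (2⁻¹ : ℝ) ((V X l).sub_mem h3 h4)
      convert h5 using 1
      module
    · obtain ⟨r, hr, h⟩ := simpleRootVec_last (l := l) hX hD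
      rw [h] at h3
      have h5 := (V X l).smul_mem r⁻¹ h3
      rwa [smul_smul, inv_mul_cancel₀ hr.ne', one_smul] at h5
  induction h2 using Nat.decreasingInduction with
  | self => exact hlast
  | of_succ i hi ih =>
    have h3 := (V X l).add_mem (hroot h1 hi.le) (ih (by omega))
    rw [simpleRootVec_of_lt hi] at h3
    simpa using h3

theorem exists_coord (hl : X.Admissible l) (hX : X ≠ .A1) (f : ℕ → ℝ) :
    ∃ v : V X l, ∀ m, 1 ≤ m → m ≤ l → coord v m = f m := by
  refine ⟨⟨∑ i ∈ Finset.Icc 1 l, f i • stdVec _ i, Submodule.sum_mem _ fun i hi => ?_⟩,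
    fun m h1 h2 => ?_⟩
  · obtain ⟨h1, h2⟩ := Finset.mem_Icc.1 hi
    exact (V X l).smul_mem _ (stdVec_mem hl hX h1 h2)
  · rw [coord, sum_inner]
    simp only [real_inner_smul_left, inner_stdVec_stdVec' hX h1 h2, mul_ite, mul_one, mul_zero]
    simp [h1, h2]

theorem isInterior_iff (hl : X.Admissible l) (hX : X ≠ .A1) (v : V X l) : IsInterior v ↔
    (∀ i, 1 ≤ i → i < l → coord v (i + 1) < coord v i) ∧
    (X = .D1 → 0 < coord v (l - 1) + coord v l) ∧ (X ≠ .D1 → 0 < coord v l) ∧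
    (ZeroFork X → coord v 1 + coord v 2 < scale X) ∧
    (¬ ZeroFork X → 2 * coord v 1 < scale X) := by
  have hs := scale_pos X
  have h0 : ¬ ZeroFork X → (0 < wallFun X l 0 v ↔ 2 * coord v 1 < scale X) := by
    intro h
    rw [wallFun_zero_plain hl hX h, sub_pos, div_mul_eq_mul_div, div_lt_one hs]
  have hlast : X ≠ .D1 → (0 < wallFun X l (Fin.last l) v ↔ 0 < coord v l) := by
    intro h
    obtain ⟨r, hr, h⟩ := wallFun_last hl hX h
    rw [h, mul_pos_iff_of_pos_left hr]
  constructor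
  · intro hv
    refine ⟨fun i h1 h2 => ?_, fun h => ?_, fun h => (hlast h).1 (hv _), fun h => ?_,
      fun h => (h0 h).1 (hv _)⟩
    · have := hv ⟨i, by omega⟩
      rw [wallFun_mid (i := ⟨i, _⟩) h1 h2] at this
      exact sub_pos.1 this
    · rw [← wallFun_last_fork hl h]; exact hv _
    · have := hv 0
      rw [wallFun_zero_fork hl h] at this
      linarith
  · rintro ⟨h1, h2, h3, h4, h5⟩ i
    rcases index_cases i with rfl | ⟨hi0, hi⟩ | rfl
    · by_cases hf : ZeroFork X
      · rw [wallFun_zero_fork hl hf]; linarith [h4 hf]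
      · exact (h0 hf).2 (h5 hf)
    · rw [wallFun_mid hi0 hi]; linarith [h1 i hi0 hi]
    · by_cases hD : X = .D1
      · rw [wallFun_last_fork hl hD]; exact h2 hD
      · exact (hlast hD).2 (h3 hD)

theorem coord_lt_of_lt {v : V X l} (hv : ∀ i, 1 ≤ i → i < l → coord v (i + 1) < coord v i)
    {i i' : ℕ} (h1 : 1 ≤ i) (h2 : i < i') (h3 : i' ≤ l) : coord v i' < coord v i := by
  induction i', h2 using Nat.le_induction with
  | base => exact hv i h1 h3
  | succ n hn ih => exact (hv n (by omega) h3).trans (ih (by omega))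

/-- The inequalities between the coordinates in the interior of the fundamental alcove. -/
theorem coord_bounds (hl : X.Admissible l) (hX : X ≠ .A1) {v : V X l} (hv : IsInterior v) :
    (∀ i i', 1 ≤ i → i < i' → i' ≤ l → coord v i' < coord v i) ∧
    (∀ i i', 1 ≤ i → i ≤ l → 1 ≤ i' → i' ≤ l → i ≠ i' → 0 < coord v i + coord v i') ∧
    (∀ i i', 1 ≤ i → i ≤ l → 1 ≤ i' → i' ≤ l → i ≠ i' → coord v i + coord v i' < scale X) ∧
    (∀ i i', 1 ≤ i → i ≤ l → 1 ≤ i' → i' ≤ l → i ≠ i' → coord v i - coord v i' < scale X) ∧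
    (X ≠ .D1 → ∀ i, 1 ≤ i → i ≤ l → 0 < coord v i) ∧
    (¬ ZeroFork X → ∀ i, 1 ≤ i → i ≤ l → 2 * coord v i < scale X) ∧
    (∀ i, 1 ≤ i → i ≤ l → -scale X < 2 * coord v i ∧ 2 * coord v i < 2 * scale X) := by
  have hs := scale_pos X
  have hl1 := one_le_rank hl
  obtain ⟨h1, h2, h3, h4, h5⟩ := (isInterior_iff hl hX v).1 hv
  have hlt : ∀ i i', 1 ≤ i → i < i' → i' ≤ l → coord v i' < coord v i :=
    fun i i' a b c => coord_lt_of_lt h1 a b c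
  have hle : ∀ i i', 1 ≤ i → i ≤ i' → i' ≤ l → coord v i' ≤ coord v i := by
    intro i i' a b c
    rcases b.lt_or_eq with h | rfl
    · exact (hlt _ _ a h c).le
    · exact le_rfl
  have hp : X ≠ .D1 → ∀ i, 1 ≤ i → i ≤ l → 0 < coord v i :=
    fun hD i a b => (h3 hD).trans_le (hle i l a b le_rfl)
  have hq : ¬ ZeroFork X → ∀ i, 1 ≤ i → i ≤ l → 2 * coord v i < scale X := by
    intro hf i a b
    have := hle 1 i le_rfl a b
    linarith [h5 hf]
  have hpos' : ∀ i i', 1 ≤ i → i < i' → i' ≤ l → 0 < coord v i + coord v i' := by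
    intro i i' a b c
    by_cases hD : X = .D1
    · have := hle i (l - 1) a (by omega) (by omega)
      have := hle i' l (by omega) c le_rfl
      linarith [h2 hD]
    · linarith [hp hD i a (by omega), hp hD i' (by omega) c]
  have hsum' : ∀ i i', 1 ≤ i → i < i' → i' ≤ l → coord v i + coord v i' < scale X := by
    intro i i' a b c
    by_cases hf : ZeroFork X
    · have := hle 1 i le_rfl a (by omega)
      have := hle 2 i' (by omega) (by omega) c
      linarith [h4 hf]
    · linarith [hq hf i a (by omega), hq hf i' (by omega) c]
  have hpos : ∀ i i', 1 ≤ i → i ≤ l → 1 ≤ i' → i' ≤ l → i ≠ i' → 0 < coord v i + coord v i' := by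
    intro i i' a b c d e
    rcases lt_or_gt_of_ne e with h | h
    · exact hpos' i i' a h d
    · rw [add_comm]; exact hpos' i' i c h b
  have hsum : ∀ i i', 1 ≤ i → i ≤ l → 1 ≤ i' → i' ≤ l → i ≠ i' →
      coord v i + coord v i' < scale X := by
    intro i i' a b c d e
    rcases lt_or_gt_of_ne e with h | h
    · exact hsum' i i' a h d
    · rw [add_comm]; exact hsum' i' i c h b
  have hdiff : ∀ i i', 1 ≤ i → i ≤ l → 1 ≤ i' → i' ≤ l → i ≠ i' →
      coord v i - coord v i' < scale X := by
    intro i i' a b c d e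
    -- In type `D1` the coordinate `i'` may be negative. With a third index `i''`, the difference is
    -- the sum for `i, i''` minus the sum for `i'', i'`.
    by_cases hD : X = .D1
    · have hl4 := four_le_rank hl hD
      obtain ⟨i'', e1, e2, e3, e4⟩ : ∃ i'', 1 ≤ i'' ∧ i'' ≤ l ∧ i'' ≠ i ∧ i'' ≠ i' := by
        by_cases h1 : i = 1 ∨ i' = 1
        · by_cases h2 : i = 2 ∨ i' = 2
          · exact ⟨3, by omega, by omega, by omega, by omega⟩
          · exact ⟨2, by omega, by omega, by omega, by omega⟩
        · exact ⟨1, by omega, by omega, by omega, by omega⟩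
      linarith [hpos i'' i' e1 e2 c d e4, hsum i i'' a b e1 e2 e3.symm]
    · linarith [hp hD i' c d, hsum i i' a b c d e]
  refine ⟨hlt, hpos, hsum, hdiff, hp, hq, fun i a b => ?_⟩
  by_cases hl2 : 2 ≤ l
  -- Twice a coordinate is the sum of, or a difference between, its sum and its difference with any
  -- other coordinate.
  · obtain ⟨i', e1, e2, e3⟩ : ∃ i', 1 ≤ i' ∧ i' ≤ l ∧ i ≠ i' := by
      by_cases h : i = 1
      · exact ⟨2, by omega, by omega, by omega⟩
      · exact ⟨1, by omega, by omega, by omega⟩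
    have := hpos i i' a b e1 e2 e3
    have := hsum i i' a b e1 e2 e3
    have := hdiff i i' a b e1 e2 e3
    have := hdiff i' i e1 e2 a b e3.symm
    constructor <;> linarith
  · have hD : X ≠ .D1 := fun h => by have := four_le_rank hl h; omega
    have hf : ¬ ZeroFork X := fun h => by have := three_le_rank hl h; omega
    constructor <;> linarith [hp hD i a b, hq hf i a b]

/-! #### The vertices of the fundamental alcove -/

/-- The coordinates of the vertices. -/
noncomputable def vertexCoord (X : AffineType) (l j m : ℕ) : ℝ := by
  classical
  exact if ZeroFork X ∧ j = 1 then (if m = 1 then scale X else 0)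
    else if X = .D1 ∧ j + 1 = l then (if m = l then -(scale X / 2) else scale X / 2)
    else if m ≤ j then scale X / 2 else 0

/-- The vertices are generally `s/2` on the first `j` coordinates and zero elsewhere, with `s` the
scale. The inner end node of a fork breaks this pattern, giving `(s, 0, …, 0)` at the node `0` end
and `(s/2, …, s/2, -s/2)` at the node `l` end. -/
theorem exists_vertex (hl : X.Admissible l) (hX : X ≠ .A1) (j : Fin (l + 1)) : ∃ v : V X l,
    (∀ m, 1 ≤ m → m ≤ l → coord v m = vertexCoord X l j m) ∧
    (∀ i, i ≠ j → wallFun X l i v = 0) ∧ 0 < wallFun X l j v := by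
  classical
  obtain ⟨v, hv⟩ := exists_coord hl hX (vertexCoord X l j)
  have hl1 := one_le_rank hl
  have hs := scale_pos X
  have h0 : ((0 : Fin (l + 1)) : ℕ) = 0 := rfl
  have hz : wallFun X l 0 v = if (j : ℕ) = 0 then (if ZeroFork X then scale X else 1) else 0 := by
    by_cases hf : ZeroFork X
    · have hl3 := three_le_rank hl hf
      rw [wallFun_zero_fork hl hf, hv 1 le_rfl hl1, hv 2 (by omega) (by omega)]
      simp only [vertexCoord, hf, true_and, if_true]
      split_ifs <;> first | omega | norm_num
    · have hD : X ≠ .D1 := fun h => hf (.inr (.inr h))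
      rw [wallFun_zero_plain hl hX hf, hv 1 le_rfl hl1]
      simp only [vertexCoord, hf, hD, false_and, if_false]
      split_ifs <;> first | omega | (field_simp; norm_num)
  have hm : ∀ i : Fin (l + 1), 0 < (i : ℕ) → (i : ℕ) < l → i ≠ j → wallFun X l i v = 0 := by
    intro i hi0 hi hij
    have hij' : (i : ℕ) ≠ j := fun h => hij (Fin.ext h)
    rw [wallFun_mid hi0 hi, hv i hi0 hi.le, hv (i + 1) (by omega) hi]
    simp only [vertexCoord]
    split_ifs <;> first | omega | norm_num
  have hm' : 0 < (j : ℕ) → (j : ℕ) < l → 0 < wallFun X l j v := by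
    intro hj0 hj
    rw [wallFun_mid hj0 hj, hv j hj0 hj.le, hv (j + 1) (by omega) hj]
    simp only [vertexCoord]
    split_ifs <;> first | omega | linarith
  have hla : j ≠ Fin.last l → wallFun X l (Fin.last l) v = 0 := by
    intro hjl
    have hj : (j : ℕ) ≠ l := fun h => hjl (Fin.ext h)
    by_cases hD : X = .D1
    · have hl4 := four_le_rank hl hD
      rw [wallFun_last_fork hl hD, hv l hl1 le_rfl, hv (l - 1) (by omega) (by omega)]
      simp only [vertexCoord, hD, true_and]
      split_ifs <;> first | omega | norm_num
    · obtain ⟨r, hr, h⟩ := wallFun_last hl hX hD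
      rw [h, hv l hl1 le_rfl]
      simp only [vertexCoord, hD, false_and, if_false]
      split_ifs with h1 h2 h3
      · have := three_le_rank hl h1.1; omega
      · simp
      · omega
      · simp
  have hla' : (j : ℕ) = l → 0 < wallFun X l (Fin.last l) v := by
    intro hj
    by_cases hD : X = .D1
    · have hl4 := four_le_rank hl hD
      rw [wallFun_last_fork hl hD, hv l hl1 le_rfl, hv (l - 1) (by omega) (by omega)]
      simp only [vertexCoord]
      split_ifs <;> first | omega | linarith
    · obtain ⟨r, hr, h⟩ := wallFun_last hl hX hD
      rw [h, hv l hl1 le_rfl]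
      simp only [vertexCoord, hD, false_and, if_false]
      refine mul_pos hr ?_
      split_ifs with h1 h2 h3
      · exact hs
      · have := three_le_rank hl h1.1; omega
      · linarith
      · omega
  refine ⟨v, hv, fun i hij => ?_, ?_⟩
  · rcases index_cases i with rfl | ⟨hi0, hi⟩ | rfl
    · rw [hz, if_neg fun h => hij (Fin.ext h.symm)]
    · exact hm i hi0 hi hij
    · exact hla hij.symm
  · rcases index_cases j with rfl | ⟨hi0, hi⟩ | rfl
    · rw [hz, if_pos h0]; split_ifs
      · exact hs
      · exact one_pos
    · exact hm' hi0 hi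
    · exact hla' rfl

theorem vertexCoord_half (X : AffineType) (l j m : ℕ) :
    ∃ n : ℤ, vertexCoord X l j m = scale X * n / 2 := by
  simp only [vertexCoord]
  split_ifs
  · exact ⟨2, by push_cast; ring⟩
  · exact ⟨0, by simp⟩
  · exact ⟨-1, by push_cast; ring⟩
  · exact ⟨1, by push_cast; ring⟩
  · exact ⟨1, by push_cast; ring⟩
  · exact ⟨0, by simp⟩

/-- Together with `vertexCoord_odd`, this supplies the parities in `isRootLike_of_rootPair`: a
generator fixes at least one of the two vertices belonging to the ends of a fork. -/
theorem vertexCoord_int (hl : X.Admissible l) {j m : ℕ} (hf : ZeroFork X) (hj : j ≤ 1)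
    (hm : 1 ≤ m) : ∃ n : ℤ, vertexCoord X l j m = scale X * n := by
  have hl3 := three_le_rank hl hf
  simp only [vertexCoord, hf, true_and]
  split_ifs
  · exact ⟨1, by simp⟩
  · exact ⟨0, by simp⟩
  all_goals first | omega | exact ⟨0, by simp⟩

theorem vertexCoord_odd (hl : X.Admissible l) {j m : ℕ} (hD : X = .D1) (hj : l ≤ j + 1)
    (hm : m ≤ l) : ∃ n : ℤ, 2 * vertexCoord X l j m = scale X * (2 * n + 1) := by
  have hl4 := four_le_rank hl hD
  simp only [vertexCoord, hD, true_and]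
  split_ifs
  · omega
  · omega
  · exact ⟨-1, by push_cast; ring⟩
  · exact ⟨0, by push_cast; ring⟩
  · exact ⟨0, by push_cast; ring⟩
  · omega

end TypeBCD

end CoreAbacus

namespace CoreAbacus

variable {X : AffineType} {l : ℕ}

namespace TypeBCD

/-! #### The functionals of the positions -/

theorem topIdx_cases (X : AffineType) : topIdx X = 0 ∨ topIdx X = 1 := by cases X <;> simp [topIdx]

theorem zeroIdx_cases (X : AffineType) : zeroIdx X = 0 ∨ zeroIdx X = 1 := by
  cases X <;> simp [zeroIdx]

/-- The functional of the position `r` of the zeroth period. -/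
noncomputable def slot (X : AffineType) (l r : ℕ) (v : V X l) : ℝ :=
  if r < l then coord v (r + 1) else if r < l + (topIdx X).toNat then 0
    else if r < 2 * l + (topIdx X).toNat then -coord v (2 * l + (topIdx X).toNat - r)
    else -(scale X / 2)

/-- The functional of a position. -/
noncomputable def posFun (X : AffineType) (l : ℕ) (x : ℤ) (v : V X l) : ℝ :=
  slot X l (x % period X l).toNat v - scale X * (x / period X l : ℤ)

theorem period_pos (hl : X.Admissible l) : 0 < period X l := by
  have := one_le_rank hl
  have := zeroIdx_nonneg X
  have := topIdx_nonneg X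
  simp only [period]; omega

theorem posFun_eq (k : ℤ) {r : ℕ} (hr : (r : ℤ) < period X l) (v : V X l) :
    posFun X l (k * period X l + r) v = slot X l r v - scale X * k := by
  have h1 : (k * period X l + r) % period X l = r := by
    rw [add_comm, Int.add_mul_emod_self_right]
    exact Int.emod_eq_of_lt (by omega) hr
  have h2 : (k * period X l + r) / period X l = k := by
    rw [add_comm, Int.add_mul_ediv_right _ _ (by omega),
      Int.ediv_eq_zero_of_lt (by omega) hr, zero_add]
  rw [posFun, h1, h2, Int.toNat_natCast]

theorem posFun_plus (k : ℤ) {i : ℕ} (h1 : 1 ≤ i) (h2 : i ≤ l) (v : V X l) :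
    posFun X l (posPlus X l k i) v = coord v i - scale X * k := by
  have := zeroIdx_nonneg X
  have := topIdx_nonneg X
  have e : posPlus X l k i = k * period X l + ((i - 1 : ℕ) : ℤ) := by simp only [posPlus]; omega
  rw [e, posFun_eq k (by simp only [period]; omega), slot, if_pos (by omega),
    show i - 1 + 1 = i by omega]

theorem posFun_minus (k : ℤ) {i : ℕ} (h1 : 1 ≤ i) (h2 : i ≤ l) (v : V X l) :
    posFun X l (posMinus X l k i) v = -coord v i - scale X * k := by
  have := zeroIdx_nonneg X
  have := topIdx_nonneg X
  have e : posMinus X l k i = k * period X l + ((2 * l + (topIdx X).toNat - i : ℕ) : ℤ) := by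
    simp only [posMinus, add_mul, one_mul]
    generalize k * period X l = P
    simp only [period]; omega
  rw [e, posFun_eq k (by simp only [period]; omega), slot, if_neg (by omega), if_neg (by omega),
    if_pos (by omega)]
  congr 3
  omega

theorem posFun_top (ht : topIdx X = 1) (k : ℤ) (v : V X l) :
    posFun X l (k * period X l + l) v = -(scale X * k) := by
  have := zeroIdx_nonneg X
  rw [posFun_eq k (by simp only [period]; omega), slot, if_neg (by omega), if_pos (by omega),
    zero_sub]

theorem posFun_zero (hz : zeroIdx X = 1) (k : ℤ) (v : V X l) :
    posFun X l (k * period X l + period X l - 1) v = -(scale X / 2) - scale X * k := by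
  have := topIdx_nonneg X
  have e : k * period X l + period X l - 1 =
      k * period X l + ((2 * l + (topIdx X).toNat : ℕ) : ℤ) := by
    generalize k * period X l = P
    simp only [period]; omega
  rw [e, posFun_eq k (by simp only [period]; omega), slot, if_neg (by omega), if_neg (by omega),
    if_neg (by omega)]

theorem exists_slot (hl : X.Admissible l) (x : ℤ) :
    ∃ (k : ℤ) (r : ℕ), (r : ℤ) < period X l ∧ x = k * period X l + r := by
  have hN := period_pos hl
  have h1 := Int.emod_nonneg x (b := period X l) (by omega)
  have h2 := Int.emod_lt_of_pos x hN
  refine ⟨x / period X l, (x % period X l).toNat, by omega, ?_⟩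
  have h3 := Int.ediv_mul_add_emod x (period X l)
  rw [Int.toNat_of_nonneg h1]
  exact h3.symm

theorem pos_cases (hl : X.Admissible l) (x : ℤ) :
    (∃ (k : ℤ) (i : ℕ), 1 ≤ i ∧ i ≤ l ∧ x = posPlus X l k i) ∨
    (∃ (k : ℤ) (i : ℕ), 1 ≤ i ∧ i ≤ l ∧ x = posMinus X l k i) ∨
    (topIdx X = 1 ∧ ∃ k : ℤ, x = k * period X l + l) ∨
    (zeroIdx X = 1 ∧ ∃ k : ℤ, x = k * period X l + period X l - 1) := by
  obtain ⟨k, r, hr, rfl⟩ := exists_slot hl x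
  have h0 := topIdx_cases X
  have h1 := zeroIdx_cases X
  by_cases e1 : r < l
  · exact .inl ⟨k, r + 1, by omega, by omega, by simp only [posPlus]; push_cast; ring⟩
  by_cases e2 : (r : ℤ) < l + topIdx X
  · exact .inr (.inr (.inl ⟨by omega, k, by omega⟩))
  by_cases e3 : (r : ℤ) < 2 * l + topIdx X
  · refine .inr (.inl ⟨k, 2 * l + (topIdx X).toNat - r, by omega, by omega, ?_⟩)
    simp only [posMinus, add_mul, one_mul]
    generalize k * period X l = P
    simp only [period]; omega
  · refine .inr (.inr (.inr ⟨?_, k, ?_⟩))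
    · simp only [period] at hr; omega
    · generalize k * period X l = P
      simp only [period] at hr ⊢; omega

theorem isAffineFun_posFun (x : ℤ) : IsAffineFun (posFun X l x) := fun u v t => by
  simp only [posFun, slot]
  split_ifs
  · rw [coord_add, coord_smul, coord_sub]; ring
  · ring
  · rw [coord_add, coord_smul, coord_sub]; ring
  · ring

/-- These hypotheses are stronger than lying in the alcove. At a fork the alcove also contains
points with `coord v l ≤ 0` or `2 * coord v 1 ≥ scale X`, where some pairs that are not roots change
order. -/
theorem strictAnti_posFun (hl : X.Admissible l) {v : V X l}
    (h1 : ∀ i, 1 ≤ i → i < l → coord v (i + 1) < coord v i) (h2 : 0 < coord v l)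
    (h3 : 2 * coord v 1 < scale X) : StrictAnti (posFun X l · v) := by
  have hl1 := one_le_rank hl
  have ht := topIdx_cases X
  have hz := zeroIdx_cases X
  have hpos : 0 < coord v 1 := by
    rcases hl1.lt_or_eq with h | h
    · exact h2.trans (coord_lt_of_lt h1 le_rfl h le_rfl)
    · rwa [h]
  refine strictAnti_int_of_succ_lt fun x => ?_
  obtain ⟨k, r, hr, rfl⟩ := exists_slot hl x
  rw [posFun_eq k hr]
  by_cases hr' : (r : ℤ) + 1 < period X l
  · rw [show k * period X l + (r : ℤ) + 1 = k * period X l + ((r + 1 : ℕ) : ℤ) by push_cast; ring,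
      posFun_eq k (by push_cast; exact hr')]
    refine sub_lt_sub_right ?_ _
    simp only [period] at hr hr'
    simp only [slot]
    split_ifs <;> first | omega | skip
    · exact h1 _ (by omega) (by omega)
    · rwa [show r + 1 = l by omega]
    · rw [show 2 * l + (topIdx X).toNat - (r + 1) = l by omega, show r + 1 = l by omega]; linarith
    · rw [show 2 * l + (topIdx X).toNat - (r + 1) = l by omega]; linarith
    · have := h1 (2 * l + (topIdx X).toNat - (r + 1)) (by omega) (by omega)
      rw [show 2 * l + (topIdx X).toNat - (r + 1) + 1 = 2 * l + (topIdx X).toNat - r by omega]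
        at this
      linarith
    · rw [show 2 * l + (topIdx X).toNat - r = 1 by omega]; linarith
  · rw [show k * period X l + (r : ℤ) + 1 = (k + 1) * period X l + (0 : ℕ) by
      rw [add_mul, one_mul]; push_cast; omega, posFun_eq _ (by push_cast; exact period_pos hl)]
    push_cast
    have h4 : slot X l 0 v = coord v 1 := by rw [slot, if_pos (by omega)]
    have h5 : coord v 1 - scale X < slot X l r v := by
      simp only [period] at hr hr'
      simp only [slot]
      split_ifs <;> first | omega | skip
      · rw [show 2 * l + (topIdx X).toNat - r = 1 by omega]; linarith
      · linarith
    rw [h4]; linarith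

theorem posFun_genPerm_of_eq {i : Fin (l + 1)} {m m' : ℕ}
    (h1 : 1 ≤ m) (h2 : m ≤ l) (h1' : 1 ≤ m') (h2' : m' ≤ l)
    (h : ∀ v : V X l, coord (genPerm X l i v) m = coord v m') (k : ℤ) (v : V X l) :
    posFun X l (posPlus X l k m) (genPerm X l i v) = posFun X l (posPlus X l k m') v ∧
    posFun X l (posMinus X l k m) (genPerm X l i v) = posFun X l (posMinus X l k m') v := by
  rw [posFun_plus k h1 h2, posFun_plus k h1' h2', posFun_minus k h1 h2, posFun_minus k h1' h2', h]
  exact ⟨rfl, rfl⟩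

theorem posFun_genPerm_of_neg {i : Fin (l + 1)} {m m' : ℕ}
    (h1 : 1 ≤ m) (h2 : m ≤ l) (h1' : 1 ≤ m') (h2' : m' ≤ l) {d : ℤ}
    (h : ∀ v : V X l, coord (genPerm X l i v) m = scale X * d - coord v m') (k : ℤ) (v : V X l) :
    posFun X l (posPlus X l k m) (genPerm X l i v) = posFun X l (posMinus X l (k - d) m') v ∧
    posFun X l (posMinus X l k m) (genPerm X l i v) = posFun X l (posPlus X l (k + d) m') v := by
  rw [posFun_plus k h1 h2, posFun_plus _ h1' h2', posFun_minus k h1 h2, posFun_minus _ h1' h2', h]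
  push_cast
  exact ⟨by ring, by ring⟩

theorem exists_posPerm (hl : X.Admissible l) (hX : X ≠ .A1) (i : Fin (l + 1)) (x : ℤ) :
    ∃ y, ∀ v, posFun X l y v = posFun X l x (genPerm X l i v) := by
  rcases pos_cases hl x with ⟨k, m, h1, h2, rfl⟩ | ⟨k, m, h1, h2, rfl⟩ | ⟨ht, k, rfl⟩ | ⟨hz, k, rfl⟩
  · obtain ⟨m', h1', h2', h | ⟨d, h⟩⟩ := coord_genPerm_cases hl hX i h1 h2
    · exact ⟨_, fun v => (posFun_genPerm_of_eq h1 h2 h1' h2' h k v).1.symm⟩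
    · exact ⟨_, fun v => (posFun_genPerm_of_neg h1 h2 h1' h2' h k v).1.symm⟩
  · obtain ⟨m', h1', h2', h | ⟨d, h⟩⟩ := coord_genPerm_cases hl hX i h1 h2
    · exact ⟨_, fun v => (posFun_genPerm_of_eq h1 h2 h1' h2' h k v).2.symm⟩
    · exact ⟨_, fun v => (posFun_genPerm_of_neg h1 h2 h1' h2' h k v).2.symm⟩
  · exact ⟨_, fun v => (posFun_top ht k v).trans (posFun_top ht k _).symm⟩
  · exact ⟨_, fun v => (posFun_zero hz k v).trans (posFun_zero hz k _).symm⟩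

/-- The permutation of the positions by a generator. -/
noncomputable def posPerm (hl : X.Admissible l) (hX : X ≠ .A1) (i : Fin (l + 1)) (x : ℤ) : ℤ :=
  (exists_posPerm hl hX i x).choose

theorem posFun_posPerm (hl : X.Admissible l) (hX : X ≠ .A1) (i : Fin (l + 1)) (x : ℤ) (v : V X l) :
    posFun X l (posPerm hl hX i x) v = posFun X l x (genPerm X l i v) :=
  (exists_posPerm hl hX i x).choose_spec v

/-- A point of the fundamental alcove at which all functionals of positions are different. -/
theorem exists_base (hl : X.Admissible l) (hX : X ≠ .A1) :
    ∃ v : V X l, IsInterior v ∧ StrictAnti (posFun X l · v) := by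
  have hl1 := one_le_rank hl
  have hs := scale_pos X
  -- The coordinates are equally spaced strictly between half the scale and zero, which suits all
  -- types at once.
  obtain ⟨v, hv⟩ := exists_coord hl hX (fun m => scale X * (l + 1 - m) / (2 * l + 2))
  have h2 : (0 : ℝ) < 2 * l + 2 := by positivity
  have e1 : ∀ i, 1 ≤ i → i < l → coord v (i + 1) < coord v i := by
    intro i a b
    rw [hv i a b.le, hv (i + 1) (by omega) b]
    push_cast
    gcongr
    linarith
  have e2 : ∀ i, 1 ≤ i → i ≤ l → 0 < coord v i := by
    intro i a b
    rw [hv i a b]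
    have : (i : ℝ) ≤ l := by exact_mod_cast b
    apply div_pos _ h2
    apply mul_pos hs
    linarith
  have e3 : 2 * coord v 1 < scale X := by
    rw [hv 1 le_rfl hl1, ← mul_div_assoc, div_lt_iff₀ h2]
    push_cast
    nlinarith
  refine ⟨v, (isInterior_iff hl hX v).2 ⟨e1, fun h => ?_, fun _ => e2 l hl1 le_rfl, fun h => ?_,
    fun _ => e3⟩, strictAnti_posFun hl e1 (e2 l hl1 le_rfl) e3⟩
  · have := four_le_rank hl h
    exact add_pos (e2 _ (by omega) (by omega)) (e2 _ hl1 le_rfl)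
  · have := three_le_rank hl h
    linarith [e1 1 le_rfl (by omega)]

theorem posFun_injective (hl : X.Admissible l) (hX : X ≠ .A1) {x y : ℤ}
    (h : ∀ v, posFun X l x v = posFun X l y v) : x = y := by
  obtain ⟨v, -, hv⟩ := exists_base hl hX
  exact hv.injective (h v)

theorem posPerm_eq (hl : X.Admissible l) (hX : X ≠ .A1) {i : Fin (l + 1)} {x y : ℤ}
    (h : ∀ v, posFun X l x (genPerm X l i v) = posFun X l y v) : posPerm hl hX i x = y :=
  posFun_injective hl hX fun v => by rw [posFun_posPerm, h]

theorem posPerm_of_eq (hl : X.Admissible l) (hX : X ≠ .A1) {i : Fin (l + 1)} {m m' : ℕ}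
    (h1 : 1 ≤ m) (h2 : m ≤ l) (h1' : 1 ≤ m') (h2' : m' ≤ l)
    (h : ∀ v : V X l, coord (genPerm X l i v) m = coord v m') (k : ℤ) :
    posPerm hl hX i (posPlus X l k m) = posPlus X l k m' ∧
    posPerm hl hX i (posMinus X l k m) = posMinus X l k m' :=
  ⟨posPerm_eq hl hX fun v => (posFun_genPerm_of_eq h1 h2 h1' h2' h k v).1,
    posPerm_eq hl hX fun v => (posFun_genPerm_of_eq h1 h2 h1' h2' h k v).2⟩

theorem posPerm_of_neg (hl : X.Admissible l) (hX : X ≠ .A1) {i : Fin (l + 1)} {m m' : ℕ}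
    (h1 : 1 ≤ m) (h2 : m ≤ l) (h1' : 1 ≤ m') (h2' : m' ≤ l) {d : ℤ}
    (h : ∀ v : V X l, coord (genPerm X l i v) m = scale X * d - coord v m') (k : ℤ) :
    posPerm hl hX i (posPlus X l k m) = posMinus X l (k - d) m' ∧
    posPerm hl hX i (posMinus X l k m) = posPlus X l (k + d) m' :=
  ⟨posPerm_eq hl hX fun v => (posFun_genPerm_of_neg h1 h2 h1' h2' h k v).1,
    posPerm_eq hl hX fun v => (posFun_genPerm_of_neg h1 h2 h1' h2' h k v).2⟩

/-! #### Signs of roots -/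

/-- The value of the functional of a signed position is a signed coordinate up to a multiple of
the scale. -/
theorem posFun_eq_or (hl : X.Admissible l) (x : ℤ) :
    (∃ r : ℝ, ∀ v, posFun X l x v = r) ∨ ∃ (k : ℤ) (i : ℕ), 1 ≤ i ∧ i ≤ l ∧
      ((∀ v, posFun X l x v = coord v i - scale X * k) ∨
        ∀ v, posFun X l x v = -coord v i - scale X * k) := by
  rcases pos_cases hl x with ⟨k, m, h1, h2, rfl⟩ | ⟨k, m, h1, h2, rfl⟩ | ⟨ht, k, rfl⟩ | ⟨hz, k, rfl⟩
  · exact .inr ⟨k, m, h1, h2, .inl (posFun_plus k h1 h2)⟩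
  · exact .inr ⟨k, m, h1, h2, .inr (posFun_minus k h1 h2)⟩
  · exact .inl ⟨_, posFun_top ht k⟩
  · exact .inl ⟨_, posFun_zero hz k⟩

/-- An invariant of the pairs of positions that define roots. -/
structure IsRootLike (X : AffineType) (l : ℕ) (p q : ℤ) : Prop where
  left : ¬ ∃ r : ℝ, ∀ v, posFun X l p v = r
  right : ¬ ∃ r : ℝ, ∀ v, posFun X l q v = r
  -- A constant sum means that the positions have opposite labels `i` and `-i`. This field excludes
  -- the hyperplanes where a coordinate is an odd multiple of half the scale, and the next one those
  -- where it is an integral multiple of the scale; they are not reflection hyperplanes at the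
  -- respective fork.
  zeroFork : ZeroFork X → ¬ ∃ n : ℤ, ∀ v, posFun X l p v + posFun X l q v = scale X * (2 * n + 1)
  lastFork : X = .D1 → ¬ ∃ n : ℤ, ∀ v, posFun X l p v + posFun X l q v = scale X * (2 * n)

theorem forall_genPerm {i : Fin (l + 1)} {p : V X l → Prop} (h : ∀ v, p (genPerm X l i v)) :
    ∀ v, p v := fun v => by
  have := h (genPerm X l i v)
  rwa [genPerm_genPerm] at this

/-- The conditions are stable under `W`, so exchanged pairs suffice. At a vertex fixed by the
generator the two functionals agree, and their sum is twice one value. At a vertex belonging to an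
end of the fork at `0` this is an even multiple of the scale, at the fork at `l` an odd one, against
the excluded identities. -/
theorem isRootLike_of_rootPair (hl : X.Admissible l) (hX : X ≠ .A1) {p q : ℤ}
    (h : RootPair (posPerm hl hX) p q) : IsRootLike X l p q := by
  induction h with
  | base i x h =>
    have hx : ¬ ∃ r : ℝ, ∀ v, posFun X l x v = r := by
      rintro ⟨r, hr⟩
      exact h (posPerm_eq hl hX fun v => by rw [hr, hr])
    have hy : ∀ j, i ≠ j → ∀ z : V X l, wallFun X l i z = 0 →
        posFun X l x z + posFun X l (posPerm hl hX i x) z = 2 * posFun X l x z := by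
      intro j hj z hz
      rw [posFun_posPerm, genPerm_of_wallFun_eq_zero hz]; ring
    have hs := scale_pos X
    obtain ⟨k, m, h1, h2, hxm⟩ := (posFun_eq_or hl x).resolve_left hx
    refine ⟨hx, ?_, fun hf => ?_, fun hD => ?_⟩
    · rintro ⟨r, hr⟩
      exact hx ⟨r, forall_genPerm (i := i) fun v => by rw [← posFun_posPerm hl hX, hr]⟩
    · rintro ⟨n, hn⟩
      have hl3 := three_le_rank hl hf
      obtain ⟨j, hj1, hj⟩ : ∃ j : Fin (l + 1), (j : ℕ) ≤ 1 ∧ i ≠ j := by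
        by_cases hi : i = 0
        · exact ⟨⟨1, by omega⟩, le_rfl, by rw [hi]; simp [Fin.ext_iff]⟩
        · exact ⟨0, by simp, hi⟩
      obtain ⟨z, hz1, hz2, -⟩ := exists_vertex hl hX j
      obtain ⟨n', hn'⟩ := vertexCoord_int (l := l) hl hf hj1 h1
      have e := hn z
      rw [hy j hj z (hz2 i hj)] at e
      rcases hxm with hxm | hxm
      · rw [hxm, hz1 m h1 h2, hn'] at e
        have e2 : scale X * (2 * n' - 2 * k) = scale X * (2 * n + 1) := by linarith
        have e3 := mul_left_cancel₀ hs.ne' e2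
        have e4 : 2 * n' - 2 * k = 2 * n + 1 := by exact_mod_cast e3
        omega
      · rw [hxm, hz1 m h1 h2, hn'] at e
        have e2 : scale X * (-2 * n' - 2 * k) = scale X * (2 * n + 1) := by linarith
        have e3 := mul_left_cancel₀ hs.ne' e2
        have e4 : -2 * n' - 2 * k = 2 * n + 1 := by exact_mod_cast e3
        omega
    · rintro ⟨n, hn⟩
      have hl4 := four_le_rank hl hD
      obtain ⟨j, hj1, hj⟩ : ∃ j : Fin (l + 1), l ≤ (j : ℕ) + 1 ∧ i ≠ j := by
        by_cases hi : (i : ℕ) = l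
        · exact ⟨⟨l - 1, by omega⟩, by simp; omega, by simp [Fin.ext_iff]; omega⟩
        · exact ⟨Fin.last l, by simp, by simpa [Fin.ext_iff] using hi⟩
      obtain ⟨z, hz1, hz2, -⟩ := exists_vertex hl hX j
      obtain ⟨n', hn'⟩ := vertexCoord_odd (l := l) hl hD hj1 h2
      have e := hn z
      rw [hy j hj z (hz2 i hj)] at e
      rcases hxm with hxm | hxm
      · rw [hxm, hz1 m h1 h2, mul_sub, hn'] at e
        have e2 : scale X * (2 * n' + 1 - 2 * k) = scale X * (2 * n) := by linarith
        have e3 := mul_left_cancel₀ hs.ne' e2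
        have e4 : 2 * n' + 1 - 2 * k = 2 * n := by exact_mod_cast e3
        omega
      · rw [hxm, hz1 m h1 h2, mul_sub, mul_neg, hn'] at e
        have e2 : scale X * (-2 * n' - 1 - 2 * k) = scale X * (2 * n) := by linarith
        have e3 := mul_left_cancel₀ hs.ne' e2
        have e4 : -2 * n' - 1 - 2 * k = 2 * n := by exact_mod_cast e3
        omega
  | step i p q h ih =>
    refine ⟨?_, ?_, fun hf => ?_, fun hD => ?_⟩
    · rintro ⟨r, hr⟩
      exact ih.left ⟨r, forall_genPerm (i := i) fun v => by rw [← posFun_posPerm hl hX, hr]⟩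
    · rintro ⟨r, hr⟩
      exact ih.right ⟨r, forall_genPerm (i := i) fun v => by rw [← posFun_posPerm hl hX, hr]⟩
    · rintro ⟨r, hr⟩
      exact ih.zeroFork hf ⟨r, forall_genPerm (i := i) fun v => by
        rw [← posFun_posPerm hl hX, ← posFun_posPerm hl hX, hr]⟩
    · rintro ⟨r, hr⟩
      exact ih.lastFork hD ⟨r, forall_genPerm (i := i) fun v => by
        rw [← posFun_posPerm hl hX, ← posFun_posPerm hl hX, hr]⟩

theorem lt_or_eq_of_mul_add_lt {N k k' a b : ℤ} (hN : 0 < N) (ha : 0 ≤ a) (hb : b < N)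
    (h : k * N + a < k' * N + b) : k < k' ∨ k = k' ∧ a < b := by
  rcases lt_trichotomy k k' with h1 | rfl | h1
  · exact .inl h1
  · exact .inr ⟨rfl, by omega⟩
  · exfalso
    have : (k' + 1) * N ≤ k * N := mul_le_mul_of_nonneg_right h1 hN.le
    rw [add_mul] at this
    omega

theorem posPlus_eq (k i : ℤ) : posPlus X l k i = k * period X l + (i - 1) := by
  simp only [posPlus]; ring

theorem posMinus_eq (k i : ℤ) :
    posMinus X l k i = k * period X l + (2 * l + topIdx X - i) := by
  simp only [posMinus, period]; ring

/-- Comparing periods first and labels next reduces the claim to `coord_bounds`. Only opposite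
labels need the root condition: in the same period outside `D1` the coordinate is positive, in
adjacent periods without a fork at `0` it is below half the scale, and `IsRootLike` excludes the
other cases. -/
theorem posFun_lt (hl : X.Admissible l) (hX : X ≠ .A1) {p q : ℤ}
    (h : RootPair (posPerm hl hX) p q) (hpq : p < q) (v : V X l) (hv : IsInterior v) :
    posFun X l q v < posFun X l p v := by
  obtain ⟨b1, b2, b3, b4, b5, b6, b7⟩ := coord_bounds hl hX hv
  have hs := scale_pos X
  have ht := topIdx_cases X
  have hz := zeroIdx_cases X
  obtain ⟨g1, g2, g3, g4⟩ := isRootLike_of_rootPair hl hX h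
  have hmul : ∀ {k k' : ℤ}, k < k' → scale X * k + scale X ≤ scale X * k' := by
    intro k k' hk
    have : (k : ℝ) + 1 ≤ k' := by exact_mod_cast hk
    nlinarith
  have hmul2 : ∀ {k k' : ℤ}, k + 1 < k' → scale X * k + 2 * scale X ≤ scale X * k' := by
    intro k k' hk
    have : (k : ℝ) + 2 ≤ k' := by exact_mod_cast (show k + 2 ≤ k' by omega)
    nlinarith
  rcases pos_cases hl p with ⟨k, i, h1, h2, rfl⟩ | ⟨k, i, h1, h2, rfl⟩ | ⟨e, k, rfl⟩ | ⟨e, k, rfl⟩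
  · rcases pos_cases hl q with
      ⟨k', i', h1', h2', rfl⟩ | ⟨k', i', h1', h2', rfl⟩ | ⟨e, k', rfl⟩ | ⟨e, k', rfl⟩
    · rw [posPlus_eq, posPlus_eq] at hpq
      have hlt := lt_or_eq_of_mul_add_lt (period_pos hl) (by omega)
        (by simp only [period]; omega) hpq
      rw [posFun_plus _ h1 h2, posFun_plus _ h1' h2']
      rcases hlt with hk | ⟨rfl, hi⟩
      · have := hmul hk
        by_cases e : i = i'
        · subst e; linarith
        · linarith [b4 i' i h1' h2' h1 h2 (Ne.symm e)]
      · linarith [b1 i i' h1 (by omega) h2']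
    · rw [posPlus_eq, posMinus_eq] at hpq
      have hlt := lt_or_eq_of_mul_add_lt (period_pos hl) (by omega)
        (by simp only [period]; omega) hpq
      rw [posFun_plus _ h1 h2, posFun_minus _ h1' h2']
      by_cases e : i = i'
      · subst e
        rcases hlt with hk | ⟨rfl, -⟩
        · linarith [hmul hk, (b7 i h1 h2).1]
        · have hD : X ≠ .D1 := fun hD => g4 hD ⟨-k, fun v => by
            rw [posFun_plus _ h1 h2, posFun_minus _ h1 h2]; push_cast; ring⟩
          linarith [b5 hD i h1 h2]
      · have := b2 i i' h1 h2 h1' h2' e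
        rcases hlt with hk | ⟨rfl, -⟩
        · linarith [hmul hk]
        · linarith
    · exact absurd ⟨_, posFun_top e k'⟩ g2
    · exact absurd ⟨_, posFun_zero e k'⟩ g2
  · rcases pos_cases hl q with
      ⟨k', i', h1', h2', rfl⟩ | ⟨k', i', h1', h2', rfl⟩ | ⟨e, k', rfl⟩ | ⟨e, k', rfl⟩
    · rw [posMinus_eq, posPlus_eq] at hpq
      have hlt := lt_or_eq_of_mul_add_lt (period_pos hl) (by omega)
        (by simp only [period]; omega) hpq
      rw [posFun_minus _ h1 h2, posFun_plus _ h1' h2']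
      have hk : k < k' := by
        rcases hlt with hk | ⟨-, hk⟩
        · exact hk
        · omega
      by_cases e : i = i'
      · subst e
        by_cases hk1 : k' = k + 1
        · subst hk1
          have hf : ¬ ZeroFork X := fun hf => g3 hf ⟨-k - 1, fun v => by
            rw [posFun_minus _ h1 h2, posFun_plus _ h1 h2]; push_cast; ring⟩
          linarith [b6 hf i h1 h2, hmul hk]
        · linarith [hmul2 (show k + 1 < k' by omega), (b7 i h1 h2).2]
      · linarith [hmul hk, b3 i i' h1 h2 h1' h2' e]
    · rw [posMinus_eq, posMinus_eq] at hpq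
      have hlt := lt_or_eq_of_mul_add_lt (period_pos hl) (by omega)
        (by simp only [period]; omega) hpq
      rw [posFun_minus _ h1 h2, posFun_minus _ h1' h2']
      rcases hlt with hk | ⟨rfl, hi⟩
      · have := hmul hk
        by_cases e : i = i'
        · subst e; linarith
        · linarith [b4 i i' h1 h2 h1' h2' e]
      · linarith [b1 i' i h1' (by omega) h2]
    · exact absurd ⟨_, posFun_top e k'⟩ g2
    · exact absurd ⟨_, posFun_zero e k'⟩ g2
  · exact absurd ⟨_, posFun_top e k⟩ g1
  · exact absurd ⟨_, posFun_zero e k⟩ g1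

/-- A generator fixing all positions would fix every point, since the coordinates are functionals of
positions; but it moves the points off its wall. -/
theorem exists_posPerm_ne (hl : X.Admissible l) (hX : X ≠ .A1) (i : Fin (l + 1)) :
    ∃ x, posPerm hl hX i x ≠ x := by
  by_contra! h
  have hl1 := one_le_rank hl
  obtain ⟨v, hv, -⟩ := exists_base hl hX
  have h1 : genPerm X l i v = v := by
    refine coord_ext fun m h1 h2 => ?_
    rw [ambientDim_eq hX] at h2
    have := posFun_posPerm hl hX i (posPlus X l 0 m) v
    rw [h, posFun_plus _ h1 h2, posFun_plus _ h1 h2] at this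
    linarith
  have hs := scale_pos X
  have hvi := hv i
  obtain ⟨b1, b2, b3, b4, b5, b6, b7⟩ := coord_bounds hl hX hv
  rcases index_cases i with rfl | ⟨h0, hi⟩ | rfl
  · by_cases hf : ZeroFork X
    · have hl3 := three_le_rank hl hf
      have := coord_zero_fork hl hf v le_rfl hl1
      rw [h1, if_pos rfl] at this
      linarith [b3 1 2 le_rfl hl1 (by omega) (by omega) (by omega)]
    · have := coord_zero hl hX hf v le_rfl hl1
      rw [h1, if_pos rfl] at this
      linarith [b6 hf 1 le_rfl hl1]
  · have := coord_mid hX h0 hi v h0 hi.le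
    rw [h1, if_pos rfl] at this
    linarith [b1 i (i + 1) h0 (by omega) hi]
  · by_cases hD : X = .D1
    · have hl4 := four_le_rank hl hD
      have := coord_last_fork hl hD v hl1 le_rfl
      rw [h1, if_pos rfl] at this
      linarith [b2 (l - 1) l (by omega) (by omega) hl1 le_rfl (by omega)]
    · have := coord_last hl hX hD v hl1 le_rfl
      rw [h1, if_pos rfl] at this
      linarith [b5 hD l hl1 le_rfl]

/-- The position model of the types other than `A_l^{(1)}`. -/
noncomputable def positionModel (hl : X.Admissible l) (hX : X ≠ .A1) : PositionModel X l where
  fn := posFun X l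
  isAffine := isAffineFun_posFun
  perm := posPerm hl hX
  fn_perm := posFun_posPerm hl hX
  base := (exists_base hl hX).choose
  base_mem := (exists_base hl hX).choose_spec.1
  anti := (exists_base hl hX).choose_spec.2
  vertex j := (exists_vertex hl hX j).choose
  wallFun_vertex {i j} h := (exists_vertex hl hX j).choose_spec.2.1 i h
  vertex_pos j := (exists_vertex hl hX j).choose_spec.2.2
  exists_perm_ne := exists_posPerm_ne hl hX
  sign := posFun_lt hl hX

theorem positionModel_vertex (hl : X.Admissible l) (hX : X ≠ .A1) (j : Fin (l + 1)) {m : ℕ}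
    (h1 : 1 ≤ m) (h2 : m ≤ l) :
    coord ((positionModel hl hX).vertex j) m = vertexCoord X l j m :=
  (exists_vertex hl hX j).choose_spec.1 m h1 h2

theorem exists_half_coord (hl : X.Admissible l) (hX : X ≠ .A1) (j : Fin (l + 1)) (w : W X l)
    {m : ℕ} (h1 : 1 ≤ m) (h2 : m ≤ l) : ∃ n : ℤ,
      coord ((w : Equiv.Perm (V X l)) ((positionModel hl hX).vertex j)) m = scale X * n / 2 := by
  induction w using W_induction generalizing m with
  | one =>
    have := positionModel_vertex hl hX j h1 h2
    obtain ⟨n, hn⟩ := vertexCoord_half X l j m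
    exact ⟨n, by simpa [this] using hn⟩
  | mul i w ih =>
    change ∃ n : ℤ, coord (genPerm X l i
      ((w : Equiv.Perm (V X l)) ((positionModel hl hX).vertex j))) m = scale X * n / 2
    obtain ⟨m', h1', h2', h | ⟨d, h⟩⟩ := coord_genPerm_cases hl hX i h1 h2
    · rw [h]; exact ih h1' h2'
    · obtain ⟨n, hn⟩ := ih h1' h2'
      exact ⟨2 * d - n, by rw [h, hn]; push_cast; ring⟩

end TypeBCD

end CoreAbacus

namespace CoreAbacus

variable {X : AffineType} {l : ℕ}

namespace TypeBCD

/-! #### The moves -/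

theorem posPerm_mid (hl : X.Admissible l) (hX : X ≠ .A1) {i : Fin (l + 1)} (h0 : 0 < (i : ℕ))
    (hi : (i : ℕ) < l) {m : ℕ} (h1 : 1 ≤ m) (h2 : m ≤ l) (k : ℤ) :
    posPerm hl hX i (posPlus X l k m) =
      posPlus X l k ((if m = i then i + 1 else if m = i + 1 then i else m : ℕ) : ℤ) ∧
    posPerm hl hX i (posMinus X l k m) =
      posMinus X l k ((if m = i then i + 1 else if m = i + 1 then i else m : ℕ) : ℤ) :=
  posPerm_of_eq hl hX h1 h2 (by split_ifs <;> omega) (by split_ifs <;> omega)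
    (fun v => coord_mid hX h0 hi v h1 h2) k

theorem posPerm_zero (hl : X.Admissible l) (hX : X ≠ .A1) (h : ¬ ZeroFork X) (k : ℤ) :
    posPerm hl hX 0 (posPlus X l k (1 : ℕ)) = posMinus X l (k - 1) (1 : ℕ) ∧
    posPerm hl hX 0 (posMinus X l k (1 : ℕ)) = posPlus X l (k + 1) (1 : ℕ) :=
  have h1 := one_le_rank hl
  posPerm_of_neg hl hX le_rfl h1 le_rfl h1 (fun v => by
    rw [coord_zero hl hX h v le_rfl h1, if_pos rfl]; simp) k

theorem posPerm_zero_ne (hl : X.Admissible l) (hX : X ≠ .A1) (h : ¬ ZeroFork X) {m : ℕ}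
    (h1 : 1 ≤ m) (h2 : m ≤ l) (hm : m ≠ 1) (k : ℤ) :
    posPerm hl hX 0 (posPlus X l k m) = posPlus X l k m ∧
    posPerm hl hX 0 (posMinus X l k m) = posMinus X l k m :=
  posPerm_of_eq hl hX h1 h2 h1 h2 (fun v => by rw [coord_zero hl hX h v h1 h2, if_neg hm]) k

theorem posPerm_zero_fork (hl : X.Admissible l) (hX : X ≠ .A1) (h : ZeroFork X) {m : ℕ}
    (h1 : 1 ≤ m) (h2 : m ≤ 2) (k : ℤ) :
    posPerm hl hX 0 (posPlus X l k m) = posMinus X l (k - 1) (3 - m : ℕ) ∧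
    posPerm hl hX 0 (posMinus X l k m) = posPlus X l (k + 1) (3 - m : ℕ) := by
  have h3 := three_le_rank hl h
  refine posPerm_of_neg hl hX h1 (by omega) (by omega) (by omega) (fun v => ?_) k
  rw [coord_zero_fork hl h v h1 (by omega)]
  by_cases e : m = 1
  · subst e; simp
  · obtain rfl : m = 2 := by omega
    simp

theorem posPerm_zero_fork_ne (hl : X.Admissible l) (hX : X ≠ .A1) (h : ZeroFork X) {m : ℕ}
    (h1 : 3 ≤ m) (h2 : m ≤ l) (k : ℤ) :
    posPerm hl hX 0 (posPlus X l k m) = posPlus X l k m ∧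
    posPerm hl hX 0 (posMinus X l k m) = posMinus X l k m :=
  posPerm_of_eq hl hX (by omega) h2 (by omega) h2 (fun v => by
    rw [coord_zero_fork hl h v (by omega) h2, if_neg (by omega), if_neg (by omega)]) k

theorem posPerm_last (hl : X.Admissible l) (hX : X ≠ .A1) (h : X ≠ .D1) (k : ℤ) :
    posPerm hl hX (Fin.last l) (posPlus X l k l) = posMinus X l (k - 0) l ∧
    posPerm hl hX (Fin.last l) (posMinus X l k l) = posPlus X l (k + 0) l :=
  have h1 := one_le_rank hl
  posPerm_of_neg hl hX h1 le_rfl h1 le_rfl (fun v => by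
    rw [coord_last hl hX h v h1 le_rfl, if_pos rfl]; simp) k

theorem posPerm_last_ne (hl : X.Admissible l) (hX : X ≠ .A1) (h : X ≠ .D1) {m : ℕ}
    (h1 : 1 ≤ m) (h2 : m < l) (k : ℤ) :
    posPerm hl hX (Fin.last l) (posPlus X l k m) = posPlus X l k m ∧
    posPerm hl hX (Fin.last l) (posMinus X l k m) = posMinus X l k m :=
  posPerm_of_eq hl hX h1 h2.le h1 h2.le (fun v => by
    rw [coord_last hl hX h v h1 h2.le, if_neg h2.ne]) k

theorem posPerm_last_fork (hl : X.Admissible l) (hX : X ≠ .A1) (h : X = .D1) {m : ℕ}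
    (h1 : l ≤ m + 1) (h2 : m ≤ l) (k : ℤ) :
    posPerm hl hX (Fin.last l) (posPlus X l k m) = posMinus X l (k - 0) (2 * l - 1 - m : ℕ) ∧
    posPerm hl hX (Fin.last l) (posMinus X l k m) = posPlus X l (k + 0) (2 * l - 1 - m : ℕ) := by
  have h3 := four_le_rank hl h
  refine posPerm_of_neg hl hX (by omega) h2 (by omega) (by omega) (fun v => ?_) k
  rw [coord_last_fork hl h v (by omega) h2]
  by_cases e : m = l
  · subst e
    rw [if_pos rfl, show 2 * m - 1 - m = m - 1 by omega]; simp
  · rw [if_neg e, if_pos (by omega), show 2 * l - 1 - m = l by omega]; simp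

theorem posPerm_last_fork_ne (hl : X.Admissible l) (hX : X ≠ .A1) (h : X = .D1) {m : ℕ}
    (h1 : 1 ≤ m) (h2 : m + 1 < l) (k : ℤ) :
    posPerm hl hX (Fin.last l) (posPlus X l k m) = posPlus X l k m ∧
    posPerm hl hX (Fin.last l) (posMinus X l k m) = posMinus X l k m :=
  posPerm_of_eq hl hX h1 (by omega) h1 (by omega) (fun v => by
    rw [coord_last_fork hl h v h1 (by omega), if_neg (by omega), if_neg (by omega)]) k

theorem posPlus_lt_posMinus (k : ℤ) {i i' : ℕ} (h2 : i ≤ l) (h2' : i' ≤ l) :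
    posPlus X l k i < posMinus X l k i' := by
  have := topIdx_nonneg X
  rw [posPlus_eq, posMinus_eq]; omega

theorem posMinus_lt_posPlus (k : ℤ) {i i' : ℕ} (h1 : 1 ≤ i) (h1' : 1 ≤ i') :
    posMinus X l (k - 1) i < posPlus X l k i' := by
  have := zeroIdx_nonneg X
  rw [posPlus_eq, posMinus_eq, sub_mul, one_mul]
  generalize k * period X l = P
  simp only [period]; omega

/-- The pairs exchanged by a generator, in increasing order. -/
inductive MovePair (X : AffineType) (l : ℕ) : ℕ → ℤ → ℤ → Prop
  | up (i : ℕ) (k : ℤ) (h0 : 0 < i) (hl : i < l) :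
      MovePair X l i (posPlus X l k i) (posPlus X l k (i + 1))
  | down (i : ℕ) (k : ℤ) (h0 : 0 < i) (hl : i < l) :
      MovePair X l i (posMinus X l k (i + 1)) (posMinus X l k i)
  | zero (k : ℤ) (hX : ¬ ZeroFork X) : MovePair X l 0 (posMinus X l (k - 1) 1) (posPlus X l k 1)
  | zeroFork₁ (k : ℤ) (hX : ZeroFork X) :
      MovePair X l 0 (posMinus X l (k - 1) 1) (posPlus X l k 2)
  | zeroFork₂ (k : ℤ) (hX : ZeroFork X) :
      MovePair X l 0 (posMinus X l (k - 1) 2) (posPlus X l k 1)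
  | last (k : ℤ) (hX : X ≠ .D1) : MovePair X l l (posPlus X l k l) (posMinus X l k l)
  | lastFork₁ (k : ℤ) (hX : X = .D1) : MovePair X l l (posPlus X l k l) (posMinus X l k (l - 1))
  | lastFork₂ (k : ℤ) (hX : X = .D1) : MovePair X l l (posPlus X l k (l - 1)) (posMinus X l k l)

theorem MovePair.posPerm_eq (hl : X.Admissible l) (hX : X ≠ .A1) {i : Fin (l + 1)} {n : ℕ}
    (hn : (i : ℕ) = n) {x y : ℤ} (h : MovePair X l n x y) : x < y ∧ posPerm hl hX i x = y := by
  have hl1 := one_le_rank hl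
  cases h with
  | up _ k h0 hi =>
    subst hn
    have e := (posPerm_mid hl hX h0 hi h0 hi.le k).1
    rw [if_pos rfl] at e
    exact ⟨by rw [posPlus_eq, posPlus_eq]; omega, e⟩
  | down _ k h0 hi =>
    subst hn
    have e := (posPerm_mid hl hX h0 hi (m := i + 1) (by omega) hi k).2
    rw [if_neg (by omega), if_pos rfl] at e
    exact ⟨by rw [posMinus_eq, posMinus_eq]; omega, by exact_mod_cast e⟩
  | zero k hf =>
    obtain rfl : i = 0 := Fin.ext hn
    have e := (posPerm_zero hl hX hf (k - 1)).2
    rw [sub_add_cancel] at e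
    exact ⟨by exact_mod_cast posMinus_lt_posPlus (X := X) (l := l) k le_rfl le_rfl,
      by exact_mod_cast e⟩
  | zeroFork₁ k hf =>
    obtain rfl : i = 0 := Fin.ext hn
    have e := (posPerm_zero_fork hl hX hf (m := 1) (by omega) (by omega) (k - 1)).2
    rw [sub_add_cancel] at e
    exact ⟨by exact_mod_cast (posMinus_lt_posPlus (X := X) (l := l) k
      (show 1 ≤ 1 by omega) (show 1 ≤ 2 by omega)), by exact_mod_cast e⟩
  | zeroFork₂ k hf =>
    obtain rfl : i = 0 := Fin.ext hn
    have e := (posPerm_zero_fork hl hX hf (m := 2) (by omega) (by omega) (k - 1)).2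
    rw [sub_add_cancel] at e
    exact ⟨by exact_mod_cast (posMinus_lt_posPlus (X := X) (l := l) k
      (show 1 ≤ 2 by omega) (show 1 ≤ 1 by omega)), by exact_mod_cast e⟩
  | last k hD =>
    obtain rfl : i = Fin.last l := Fin.ext hn
    have e := (posPerm_last hl hX hD k).1
    rw [sub_zero] at e
    exact ⟨posPlus_lt_posMinus k le_rfl le_rfl, e⟩
  | lastFork₁ k hD =>
    obtain rfl : i = Fin.last l := Fin.ext hn
    have hl4 := four_le_rank hl hD
    have e := (posPerm_last_fork hl hX hD (m := l) (by omega) le_rfl k).1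
    have h := posPlus_lt_posMinus (X := X) (l := l) (i' := l - 1) k le_rfl (by omega)
    rw [sub_zero, show 2 * l - 1 - l = l - 1 by omega] at e
    rw [Nat.cast_sub hl1, Nat.cast_one] at e h
    exact ⟨h, e⟩
  | lastFork₂ k hD =>
    obtain rfl : i = Fin.last l := Fin.ext hn
    have hl4 := four_le_rank hl hD
    have e := (posPerm_last_fork hl hX hD (m := l - 1) (by omega) (by omega) k).1
    have h := posPlus_lt_posMinus (X := X) (l := l) (i := l - 1) k (by omega) le_rfl
    rw [sub_zero, show 2 * l - 1 - (l - 1) = l by omega] at e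
    rw [Nat.cast_sub hl1, Nat.cast_one] at e h
    exact ⟨h, e⟩

/-- Positions labelled `0` or `l+1` have constant functionals and never move, so only signed labels
have to be examined. -/
theorem movePair_of_lt (hl : X.Admissible l) (hX : X ≠ .A1) (i : Fin (l + 1)) {x : ℤ}
    (h : x < posPerm hl hX i x) : MovePair X l i x (posPerm hl hX i x) := by
  have hl1 := one_le_rank hl
  have inert : (∃ r : ℝ, ∀ v, posFun X l x v = r) → MovePair X l i x (posPerm hl hX i x) := by
    rintro ⟨r, hr⟩
    exact absurd (TypeBCD.posPerm_eq hl hX (x := x) (y := x) fun v => by rw [hr, hr]) h.ne'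
  rcases pos_cases hl x with ⟨k, m, h1, h2, rfl⟩ | ⟨k, m, h1, h2, rfl⟩ | ⟨ht, k, rfl⟩ | ⟨hz, k, rfl⟩
  · rcases index_cases i with rfl | ⟨h0, hi⟩ | rfl
    · by_cases hf : ZeroFork X
      · by_cases hm : m ≤ 2
        · rw [(posPerm_zero_fork hl hX hf h1 hm k).1] at h
          exact absurd h (posMinus_lt_posPlus k (by omega) h1).not_gt
        · exact absurd (posPerm_zero_fork_ne hl hX hf (by omega) h2 k).1 h.ne'
      · by_cases hm : m = 1
        · subst hm
          rw [(posPerm_zero hl hX hf k).1] at h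
          exact absurd h (posMinus_lt_posPlus k (by omega) h1).not_gt
        · exact absurd (posPerm_zero_ne hl hX hf h1 h2 hm k).1 h.ne'
    · have e := (posPerm_mid hl hX h0 hi h1 h2 k).1
      rw [e] at h ⊢
      split_ifs at h ⊢ with h3 h4
      · subst h3
        exact_mod_cast MovePair.up _ k h0 hi
      · rw [posPlus_eq, posPlus_eq] at h; omega
      · exact absurd h (lt_irrefl _)
    · by_cases hD : X = .D1
      · by_cases hm : l ≤ m + 1
        · rw [(posPerm_last_fork hl hX hD hm h2 k).1, sub_zero]
          by_cases e : m = l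
          · subst e
            rw [show 2 * m - 1 - m = m - 1 by omega, Nat.cast_sub hl1, Nat.cast_one]
            exact .lastFork₁ k hD
          · obtain rfl : m = l - 1 := by omega
            rw [show 2 * l - 1 - (l - 1) = l by omega, Nat.cast_sub hl1, Nat.cast_one]
            exact .lastFork₂ k hD
        · exact absurd (posPerm_last_fork_ne hl hX hD h1 (by omega) k).1 h.ne'
      · by_cases hm : m = l
        · subst hm
          rw [(posPerm_last hl hX hD k).1, sub_zero]
          exact .last k hD
        · exact absurd (posPerm_last_ne hl hX hD h1 (by omega) k).1 h.ne'
  · rcases index_cases i with rfl | ⟨h0, hi⟩ | rfl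
    · by_cases hf : ZeroFork X
      · by_cases hm : m ≤ 2
        · rw [(posPerm_zero_fork hl hX hf h1 hm k).2]
          by_cases e : m = 1
          · subst e
            have := MovePair.zeroFork₁ (l := l) (k + 1) hf
            rw [add_sub_cancel_right] at this
            exact_mod_cast this
          · obtain rfl : m = 2 := by omega
            have := MovePair.zeroFork₂ (l := l) (k + 1) hf
            rw [add_sub_cancel_right] at this
            exact_mod_cast this
        · exact absurd (posPerm_zero_fork_ne hl hX hf (by omega) h2 k).2 h.ne'
      · by_cases hm : m = 1
        · subst hm
          rw [(posPerm_zero hl hX hf k).2]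
          have := MovePair.zero (l := l) (k + 1) hf
          rw [add_sub_cancel_right] at this
          exact_mod_cast this
        · exact absurd (posPerm_zero_ne hl hX hf h1 h2 hm k).2 h.ne'
    · have e := (posPerm_mid hl hX h0 hi h1 h2 k).2
      rw [e] at h ⊢
      split_ifs at h ⊢ with h3 h4
      · rw [posMinus_eq, posMinus_eq] at h; omega
      · subst h4
        exact_mod_cast MovePair.down _ k h0 hi
      · exact absurd h (lt_irrefl _)
    · by_cases hD : X = .D1
      · by_cases hm : l ≤ m + 1
        · rw [(posPerm_last_fork hl hX hD hm h2 k).2, add_zero] at h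
          have hl4 := four_le_rank hl hD
          exact absurd h (posPlus_lt_posMinus k (by omega) h2).not_gt
        · exact absurd (posPerm_last_fork_ne hl hX hD h1 (by omega) k).2 h.ne'
      · by_cases hm : m = l
        · subst hm
          rw [(posPerm_last hl hX hD k).2, add_zero] at h
          exact absurd h (posPlus_lt_posMinus k le_rfl le_rfl).not_gt
        · exact absurd (posPerm_last_ne hl hX hD h1 (by omega) k).2 h.ne'
  · exact inert ⟨_, posFun_top ht k⟩
  · exact inert ⟨_, posFun_zero hz k⟩

/-- The moves are those along the pairs, or set beads at the start of a half abacus. -/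
theorem move_iff_movePair (hX : X ≠ .A1) {lo : WithBot ℤ} {i : ℕ} {R A : Set ℤ} :
    Move X l lo i R A ↔
      (∃ x y, MovePair X l i x y ∧ lo ≤ (x : WithBot ℤ) ∧ R = {x} ∧ A = {y}) ∨
      (R = ∅ ∧ i = 0 ∧ (X = .A2even ∨ X = .D2) ∧ lo = (posPlus X l 0 1 : WithBot ℤ) ∧
        A = {posPlus X l 0 1}) ∨
      (R = ∅ ∧ i = 0 ∧ ZeroFork X ∧ lo = (posPlus X l 0 1 : WithBot ℤ) ∧
        A = {posPlus X l 0 1, posPlus X l 0 2}) ∨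
      (R = ∅ ∧ i = l ∧ (X = .B1 ∨ X = .D2) ∧ lo = (posMinus X l 0 l : WithBot ℤ) ∧
        A = {posMinus X l 0 l}) ∨
      (R = ∅ ∧ i = l ∧ X = .D1 ∧ lo = (posMinus X l 0 l : WithBot ℤ) ∧
        A = {posMinus X l 0 l, posMinus X l 0 (l - 1)}) := by
  constructor
  · intro h
    cases h with
    | typeA _ x h => exact absurd h hX
    | up _ k _ h0 hl hlo => exact .inl ⟨_, _, .up _ k h0 hl, hlo, rfl, rfl⟩
    | down _ k _ h0 hl hlo => exact .inl ⟨_, _, .down _ k h0 hl, hlo, rfl, rfl⟩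
    | zero k h hlo =>
      refine .inl ⟨_, _, .zero k ?_, hlo, rfl, rfl⟩
      rcases h with rfl | rfl | rfl <;> simp [ZeroFork]
    | zeroFork₁ k h hlo => exact .inl ⟨_, _, .zeroFork₁ k h, hlo, rfl, rfl⟩
    | zeroFork₂ k h hlo => exact .inl ⟨_, _, .zeroFork₂ k h, hlo, rfl, rfl⟩
    | last k h hlo =>
      refine .inl ⟨_, _, .last k ?_, hlo, rfl, rfl⟩
      rintro rfl
      simp at h
    | lastFork₁ k h hlo => exact .inl ⟨_, _, .lastFork₁ k h, hlo, rfl, rfl⟩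
    | lastFork₂ k h hlo => exact .inl ⟨_, _, .lastFork₂ k h, hlo, rfl, rfl⟩
    | newZero h hlo => exact .inr (.inl ⟨rfl, rfl, h, hlo, rfl⟩)
    | newZeroFork h hlo => exact .inr (.inr (.inl ⟨rfl, rfl, h, hlo, rfl⟩))
    | newLast h hlo => exact .inr (.inr (.inr (.inl ⟨rfl, rfl, h, hlo, rfl⟩)))
    | newLastFork h hlo => exact .inr (.inr (.inr (.inr ⟨rfl, rfl, h, hlo, rfl⟩)))
  · rintro (⟨x, y, h, hlo, rfl, rfl⟩ | ⟨rfl, rfl, h, hlo, rfl⟩ | ⟨rfl, rfl, h, hlo, rfl⟩ |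
      ⟨rfl, rfl, h, hlo, rfl⟩ | ⟨rfl, rfl, h, hlo, rfl⟩)
    · cases h with
      | up _ k h0 hl => exact .up i k hX h0 hl hlo
      | down _ k h0 hl => exact .down i k hX h0 hl hlo
      | zero k h =>
        refine .zero k ?_ hlo
        cases X <;> simp_all [ZeroFork]
      | zeroFork₁ k h => exact .zeroFork₁ k h hlo
      | zeroFork₂ k h => exact .zeroFork₂ k h hlo
      | last k h =>
        refine .last k ?_ hlo
        cases X <;> simp_all
      | lastFork₁ k h => exact .lastFork₁ k h hlo
      | lastFork₂ k h => exact .lastFork₂ k h hlo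
    · exact .newZero h hlo
    · exact .newZeroFork h hlo
    · exact .newLast h hlo
    · exact .newLastFork h hlo

/-- The possible positions of the start, and the corresponding bead sets. -/
theorem start_cases (hl : X.Admissible l) (hX : X ≠ .A1) (j : Fin (l + 1)) :
    (start X l j = ⊥ ∧ ¬ (ZeroFork X ∧ (j : ℕ) = 1) ∧ ¬ (X = .D1 ∧ (j : ℕ) + 1 = l)) ∨
    (start X l j = ((0 : ℤ) : WithBot ℤ) ∧ X ≠ .C1 ∧ (j : ℕ) = 0 ∧ halfBeads X l j = ∅) ∨
    (start X l j = ((0 : ℤ) : WithBot ℤ) ∧ ZeroFork X ∧ (j : ℕ) = 1 ∧ halfBeads X l j = {0}) ∨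
    (start X l j = ((l + topIdx X : ℤ) : WithBot ℤ) ∧ (X = .B1 ∨ X = .D1 ∨ X = .D2) ∧
      (j : ℕ) = l ∧ halfBeads X l j = ∅) ∨
    (start X l j = ((l + topIdx X : ℤ) : WithBot ℤ) ∧ X = .D1 ∧ (j : ℕ) + 1 = l ∧
      halfBeads X l j = {(l : ℤ)}) := by
  have hj := j.2
  generalize (j : ℕ) = j at *
  cases X <;> simp only [AffineType.Admissible] at hl <;>
    simp only [start, halfBeads, topIdx, ZeroFork, ne_eq, reduceCtorEq, not_true_eq_false,
      not_false_eq_true, true_and, false_and, or_false, false_or, and_false, or_true, and_true,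
      add_zero] <;>
    (try split_ifs) <;> simp <;> omega

/-- The reflection that completes half abaci. -/
noncomputable def posRefl (X : AffineType) (l j : ℕ) (x : ℤ) : ℤ :=
  if start X l j = ((0 : ℤ) : WithBot ℤ) then -1 - zeroIdx X - x else 2 * l - 1 + topIdx X - x

end TypeBCD

end CoreAbacus

/-! ### Half abaci: reflections, moves at the start, and the abacus of `Λ_j` as a level set -/

namespace CoreAbacus

variable {X : AffineType} {l : ℕ}

namespace TypeBCD

/-- This bounds the nonlinear product by linear inequalities, after which `omega` can compare
positions. -/
theorem mul_period_cases (hl : X.Admissible l) (k : ℤ) :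
    (k < 0 ∧ k * period X l ≤ -period X l) ∨ (k = 0 ∧ k * period X l = 0) ∨
      (0 < k ∧ period X l ≤ k * period X l) := by
  have hN := period_pos hl
  rcases lt_trichotomy k 0 with h | rfl | h
  · exact .inl ⟨h, by nlinarith⟩
  · exact .inr (.inl ⟨rfl, zero_mul _⟩)
  · exact .inr (.inr ⟨h, by nlinarith⟩)

/-- The pairs that cross the position `0`. -/
theorem MovePair.cross_zero (hl : X.Admissible l) {n : ℕ} {x y : ℤ} (h : MovePair X l n x y)
    (hx : x < 0) (hy : 0 ≤ y) : n = 0 ∧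
      (¬ ZeroFork X ∧ x = -1 - zeroIdx X ∧ y = 0 ∨
        ZeroFork X ∧ (x = -1 ∧ y = 1 ∨ x = -2 ∧ y = 0)) := by
  have h0 := zeroIdx_cases X
  have h1 := topIdx_cases X
  have hz : ZeroFork X → zeroIdx X = 0 := by rintro (rfl | rfl | rfl) <;> rfl
  have hl1 := one_le_rank hl
  have hp : period X l = 2 * l + zeroIdx X + topIdx X := rfl
  cases h with
  | up _ k h0 hi | down _ k h0 hi | last k hD =>
    exfalso
    simp only [posPlus_eq, posMinus_eq] at hx hy
    have := mul_period_cases hl k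
    omega
  | lastFork₁ k hD | lastFork₂ k hD =>
    exfalso
    simp only [posPlus_eq, posMinus_eq] at hx hy
    have := mul_period_cases hl k
    have := four_le_rank hl hD
    omega
  | zero k hf =>
    simp only [posPlus_eq, posMinus_eq, sub_mul, one_mul] at hx hy ⊢
    have := mul_period_cases hl k
    simp only [hf, not_false_eq_true, true_and, false_and, or_false]
    omega
  | zeroFork₁ k hf | zeroFork₂ k hf =>
    simp only [posPlus_eq, posMinus_eq, sub_mul, one_mul] at hx hy ⊢
    have := mul_period_cases hl k
    have := hz hf
    simp only [hf, not_true_eq_false, true_and, false_and, false_or]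
    omega

/-- The pairs that cross the middle of the zeroth period. -/
theorem MovePair.cross_last (hl : X.Admissible l) {n : ℕ} {x y : ℤ} (h : MovePair X l n x y)
    (hx : x < l + topIdx X) (hy : l + topIdx X ≤ y) : n = l ∧
      (X ≠ .D1 ∧ x = l - 1 ∧ y = l + topIdx X ∨
        X = .D1 ∧ (x = l - 1 ∧ y = l + 1 ∨ x = l - 2 ∧ y = l)) := by
  have h0 := zeroIdx_cases X
  have h1 := topIdx_cases X
  have hz : X = .D1 → topIdx X = 0 := by rintro rfl; rfl
  have hl1 := one_le_rank hl
  have hp : period X l = 2 * l + zeroIdx X + topIdx X := rfl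
  cases h with
  | up _ k h0 hi | down _ k h0 hi | zero k hD =>
    exfalso
    simp only [posPlus_eq, posMinus_eq, sub_mul, one_mul] at hx hy
    have := mul_period_cases hl k
    omega
  | zeroFork₁ k hf | zeroFork₂ k hf =>
    exfalso
    simp only [posPlus_eq, posMinus_eq, sub_mul, one_mul] at hx hy
    have := mul_period_cases hl k
    have := three_le_rank hl hf
    omega
  | last k hf =>
    simp only [posPlus_eq, posMinus_eq] at hx hy ⊢
    have := mul_period_cases hl k
    simp only [hf, ne_eq, not_false_eq_true, true_and, false_and, or_false]
    omega
  | lastFork₁ k hf | lastFork₂ k hf =>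
    have := hz hf
    simp only [posPlus_eq, posMinus_eq] at hx hy ⊢
    have := mul_period_cases hl k
    exact ⟨trivial, .inr ⟨hf, by omega⟩⟩

theorem posRefl_of_eq_zero {j : ℕ} (h : start X l j = ((0 : ℤ) : WithBot ℤ)) (x : ℤ) :
    posRefl X l j x = -1 - zeroIdx X - x := if_pos h

theorem posRefl_of_eq_last (hl : X.Admissible l) {j : ℕ}
    (h : start X l j = ((l + topIdx X : ℤ) : WithBot ℤ)) (x : ℤ) :
    posRefl X l j x = 2 * l - 1 + topIdx X - x := by
  have := one_le_rank hl
  have := topIdx_nonneg X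
  rw [posRefl, if_neg]
  rw [h, WithBot.coe_inj]
  omega

/-- A half abacus starts at `0` or in the middle of the zeroth period. -/
theorem start_eq (hl : X.Admissible l) (hX : X ≠ .A1) (j : Fin (l + 1)) :
    start X l j = ⊥ ∨ (start X l j = ((0 : ℤ) : WithBot ℤ) ∧ X ≠ .C1) ∨
    (start X l j = ((l + topIdx X : ℤ) : WithBot ℤ) ∧ (X = .B1 ∨ X = .D1 ∨ X = .D2)) := by
  rcases start_cases hl hX j with ⟨h, -⟩ | ⟨h, h', -⟩ | ⟨h, h', -⟩ | ⟨h, h', -⟩ | ⟨h, h', -⟩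
  · exact .inl h
  · exact .inr (.inl ⟨h, h'⟩)
  · exact .inr (.inl ⟨h, by rintro rfl; simp [ZeroFork] at h'⟩)
  · exact .inr (.inr ⟨h, h'⟩)
  · exact .inr (.inr ⟨h, .inr (.inl h')⟩)

/-- The reflection exchanges the labels `i` and `-i`, preserves the labels `0` and `l+1`, and
reverses the order of the periods. -/
theorem posFun_posRefl (hl : X.Admissible l) (hX : X ≠ .A1) (j : Fin (l + 1))
    (hs : start X l j ≠ ⊥) (x : ℤ) (v : V X l) : posFun X l (posRefl X l j x) v =
      (if start X l j = ((0 : ℤ) : WithBot ℤ) then scale X else 0) - posFun X l x v := by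
  have hp : period X l = 2 * l + zeroIdx X + topIdx X := rfl
  have hc := pos_cases hl x
  rcases (start_eq hl hX j).resolve_left hs with ⟨h, -⟩ | ⟨h, -⟩
  · rw [posRefl_of_eq_zero h, if_pos h]
    rcases hc with ⟨k, m, h1, h2, rfl⟩ | ⟨k, m, h1, h2, rfl⟩ | ⟨ht, k, rfl⟩ | ⟨hz, k, rfl⟩
    · rw [show -1 - zeroIdx X - posPlus X l k m = posMinus X l (-k - 1) m by
        simp only [posPlus, posMinus]; ring, posFun_plus k h1 h2, posFun_minus _ h1 h2]
      push_cast; ring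
    · rw [show -1 - zeroIdx X - posMinus X l k m = posPlus X l (-k - 1) m by
        simp only [posPlus, posMinus]; ring, posFun_plus _ h1 h2, posFun_minus _ h1 h2]
      push_cast; ring
    · rw [show -1 - zeroIdx X - (k * period X l + l) = (-k - 1) * period X l + l by
        rw [sub_mul, neg_mul]; omega, posFun_top ht, posFun_top ht]
      push_cast; ring
    · rw [show -1 - zeroIdx X - (k * period X l + period X l - 1) =
        (-k - 2) * period X l + period X l - 1 by
          rw [sub_mul, neg_mul]; omega, posFun_zero hz, posFun_zero hz]
      push_cast; ring
  · have hl1 := one_le_rank hl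
    have ht0 := topIdx_nonneg X
    rw [posRefl_of_eq_last hl h, if_neg (by rw [h, WithBot.coe_inj]; omega)]
    rcases hc with ⟨k, m, h1, h2, rfl⟩ | ⟨k, m, h1, h2, rfl⟩ | ⟨ht, k, rfl⟩ | ⟨hz, k, rfl⟩
    · rw [show 2 * l - 1 + topIdx X - posPlus X l k m = posMinus X l (-k) m by
        rw [posPlus_eq, posMinus_eq, neg_mul]; omega, posFun_plus k h1 h2, posFun_minus _ h1 h2]
      push_cast; ring
    · rw [show 2 * l - 1 + topIdx X - posMinus X l k m = posPlus X l (-k) m by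
        rw [posPlus_eq, posMinus_eq, neg_mul]; omega, posFun_plus _ h1 h2, posFun_minus _ h1 h2]
      push_cast; ring
    · rw [show 2 * l - 1 + topIdx X - (k * period X l + l) = (-k) * period X l + l by
        rw [neg_mul]; omega, posFun_top ht, posFun_top ht]
      push_cast; ring
    · rw [show 2 * l - 1 + topIdx X - (k * period X l + period X l - 1) =
        (-k - 1) * period X l + period X l - 1 by
          rw [sub_mul, neg_mul]; omega, posFun_zero hz, posFun_zero hz]
      push_cast; ring

theorem movePair_iff (hl : X.Admissible l) (hX : X ≠ .A1) (i : Fin (l + 1)) {x y : ℤ} :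
    MovePair X l i x y ↔ x < y ∧ posPerm hl hX i x = y :=
  ⟨MovePair.posPerm_eq hl hX rfl, fun ⟨h, e⟩ => e ▸ movePair_of_lt hl hX i (e ▸ h)⟩

theorem posPlus_zero_one : posPlus X l 0 1 = 0 := by simp [posPlus]

theorem posPlus_zero_two : posPlus X l 0 2 = 1 := by simp [posPlus]

theorem posMinus_zero (i : ℤ) : posMinus X l 0 i = 2 * l + topIdx X - i := by
  simp [posMinus_eq]

/-- The moves that set beads at the start of a half abacus are those along the pairs that cross
the start. -/
theorem exists_cross_iff (hl : X.Admissible l) (hX : X ≠ .A1) (i j : Fin (l + 1)) (A : Set ℤ) :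
    (∃ x y, MovePair X l i x y ∧ ¬ start X l j ≤ (x : WithBot ℤ) ∧ start X l j ≤ (y : WithBot ℤ) ∧
      A = {y, posRefl X l j x}) ↔
      ((i : ℕ) = 0 ∧ (X = .A2even ∨ X = .D2) ∧ start X l j = (posPlus X l 0 1 : WithBot ℤ) ∧
        A = {posPlus X l 0 1}) ∨
      ((i : ℕ) = 0 ∧ ZeroFork X ∧ start X l j = (posPlus X l 0 1 : WithBot ℤ) ∧
        A = {posPlus X l 0 1, posPlus X l 0 2}) ∨
      ((i : ℕ) = l ∧ (X = .B1 ∨ X = .D2) ∧ start X l j = (posMinus X l 0 l : WithBot ℤ) ∧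
        A = {posMinus X l 0 l}) ∨
      ((i : ℕ) = l ∧ X = .D1 ∧ start X l j = (posMinus X l 0 l : WithBot ℤ) ∧
        A = {posMinus X l 0 l, posMinus X l 0 (l - 1)}) := by
  have hl1 := one_le_rank hl
  have ht0 := topIdx_nonneg X
  have hz : ZeroFork X → zeroIdx X = 0 := by rintro (rfl | rfl | rfl) <;> rfl
  have hD : X = .D1 → topIdx X = 0 := by rintro rfl; rfl
  rw [posPlus_zero_one, posPlus_zero_two, posMinus_zero, posMinus_zero,
    show (2 * l + topIdx X - l : ℤ) = l + topIdx X by ring]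
  rcases start_eq hl hX j with h | ⟨h, hC⟩ | ⟨h, hC⟩
  · have h1 (z : ℤ) : ¬ ((⊥ : WithBot ℤ) = (z : WithBot ℤ)) := WithBot.bot_ne_coe
    simp only [h, h1, bot_le, not_true_eq_false, false_and, and_false, or_false, exists_false]
  · have h1 : ¬ (((0 : ℤ) : WithBot ℤ) = ((l + topIdx X : ℤ) : WithBot ℤ)) := by
      rw [WithBot.coe_inj]; omega
    simp only [posRefl_of_eq_zero h]
    simp only [h, h1, WithBot.coe_le_coe, not_le, true_and, false_and, and_false, or_false]
    constructor
    · rintro ⟨x, y, hxy, hx, hy, rfl⟩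
      -- At a fork two pairs cross the start. They are mirror images and create the same two beads,
      -- so in the converse direction either of them serves.
      obtain ⟨hi, ⟨hf, rfl, rfl⟩ | ⟨hf, ⟨rfl, rfl⟩ | ⟨rfl, rfl⟩⟩⟩ := hxy.cross_zero hl hx hy
      · refine .inl ⟨hi, ?_, by simp⟩
        cases X <;> simp_all [ZeroFork]
      · exact .inr ⟨hi, hf, by rw [hz hf]; simp [Set.pair_comm]⟩
      · exact .inr ⟨hi, hf, by rw [hz hf]; simp⟩
    · rintro (⟨hi, hf, rfl⟩ | ⟨hi, hf, rfl⟩)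
      · have hf' : ¬ ZeroFork X := by rcases hf with rfl | rfl <;> simp [ZeroFork]
        have e := MovePair.zero (l := l) 0 hf'
        rw [posPlus_zero_one, ← hi] at e
        refine ⟨_, _, e, ?_, le_rfl, ?_⟩
        · have := zeroIdx_nonneg X
          simp [posMinus]; omega
        · rw [show (-1 - zeroIdx X - posMinus X l (0 - 1) 1) = 0 by simp [posMinus]; ring]; simp
      · have e := MovePair.zeroFork₂ (l := l) 0 hf
        rw [posPlus_zero_one, ← hi] at e
        refine ⟨_, _, e, ?_, le_rfl, ?_⟩
        · simp [posMinus, hz hf]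
        · simp [posMinus, hz hf]
  · have h1 : ¬ (((l + topIdx X : ℤ) : WithBot ℤ) = ((0 : ℤ) : WithBot ℤ)) := by
      rw [WithBot.coe_inj]; omega
    simp only [posRefl_of_eq_last hl h]
    simp only [h, h1, WithBot.coe_le_coe, not_le, true_and, false_and, and_false, false_or]
    constructor
    · rintro ⟨x, y, hxy, hx, hy, rfl⟩
      obtain ⟨hi, ⟨hf, rfl, rfl⟩ | ⟨hf, ⟨rfl, rfl⟩ | ⟨rfl, rfl⟩⟩⟩ := hxy.cross_last hl hx hy
      · refine .inl ⟨hi, ?_, ?_⟩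
        · rcases hC with h | h | h <;> tauto
        · rw [show (2 * l - 1 + topIdx X - (l - 1) : ℤ) = l + topIdx X by ring]; simp
      · refine .inr ⟨hi, hf, ?_⟩
        rw [hD hf, Set.pair_comm]
        congr 2 <;> ring
      · refine .inr ⟨hi, hf, ?_⟩
        rw [hD hf]
        congr 2; ring
    · rintro (⟨hi, hf, rfl⟩ | ⟨hi, hf, rfl⟩)
      · have e := MovePair.last (l := l) 0 (X := X) (by rcases hf with rfl | rfl <;> simp)
        rw [posMinus_zero, posPlus_eq] at e
        rw [hi]
        refine ⟨_, _, e, by omega, by omega, ?_⟩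
        rw [show (2 * l - 1 + topIdx X - (0 * period X l + (l - 1)) : ℤ) = l + topIdx X by ring,
          show (2 * l + topIdx X - l : ℤ) = l + topIdx X by ring]
        simp
      · have e := MovePair.lastFork₂ (l := l) 0 hf
        rw [posMinus_zero, posPlus_eq] at e
        rw [hi]
        refine ⟨_, _, e, by omega, by omega, ?_⟩
        rw [show (2 * l - 1 + topIdx X - (0 * period X l + (l - 1 - 1)) : ℤ) =
          2 * l + topIdx X - (l - 1) by ring,
          show (2 * l + topIdx X - l : ℤ) = l + topIdx X by ring]

/-- Twice the coordinates of the vertices, in units of the scale. -/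
def vertexNum (X : AffineType) (l j m : ℕ) [Decidable (ZeroFork X)] [Decidable (X = .D1)] : ℤ :=
  if ZeroFork X ∧ j = 1 then (if m = 1 then 2 else 0)
    else if X = .D1 ∧ j + 1 = l then (if m = l then -1 else 1)
    else if m ≤ j then 1 else 0

theorem vertexCoord_eq (X : AffineType) (l j m : ℕ) [Decidable (ZeroFork X)] [Decidable (X = .D1)] :
    vertexCoord X l j m = scale X * vertexNum X l j m / 2 := by
  simp only [vertexCoord, vertexNum]
  split_ifs <;> push_cast <;> ring

/-- The beads of the abacus of `Λ_j` are the positions whose value at the `j`-th vertex is at least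
`levelNum / 2`, in units of the scale. -/
noncomputable def levelNum (X : AffineType) (l j : ℕ) : ℤ :=
  if start X l j = ((l + topIdx X : ℤ) : WithBot ℤ) then 0 else 1

theorem levelNum_of_eq {j : ℕ} (h : start X l j = ((l + topIdx X : ℤ) : WithBot ℤ)) :
    levelNum X l j = 0 := if_pos h

theorem levelNum_of_eq_bot {j : ℕ} (h : start X l j = ⊥) : levelNum X l j = 1 :=
  if_neg (by rw [h]; exact WithBot.bot_ne_coe)

theorem levelNum_of_eq_zero (hl : X.Admissible l) {j : ℕ}
    (h : start X l j = ((0 : ℤ) : WithBot ℤ)) : levelNum X l j = 1 := by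
  have := one_le_rank hl
  have := topIdx_nonneg X
  exact if_neg (by rw [h, WithBot.coe_inj]; omega)

/-- The level lies a quarter of the scale below `e` half-units, so no multiple of a half-unit
attains it. -/
theorem level_lt_iff (e n : ℤ) : scale X * (2 * e - 1) / 4 < scale X * n / 2 ↔ e ≤ n := by
  have hs := scale_pos X
  have h : scale X * (2 * e - 1) / 4 < scale X * n / 2 ↔
      scale X * (2 * e - 1) < scale X * (2 * n) := by
    constructor <;> intro h <;> linarith
  rw [h, mul_lt_mul_iff_right₀ hs]
  have : (2 * e - 1 : ℝ) < 2 * n ↔ 2 * e - 1 < 2 * n := by exact_mod_cast Iff.rfl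
  rw [this]
  omega

theorem level_lt_posFun_plus {v : V X l} {m : ℕ} (h1 : 1 ≤ m) (h2 : m ≤ l) {n : ℤ}
    (hv : coord v m = scale X * n / 2) (e k : ℤ) :
    scale X * (2 * e - 1) / 4 < posFun X l (posPlus X l k m) v ↔ e ≤ n - 2 * k := by
  rw [← level_lt_iff (X := X), posFun_plus k h1 h2, hv]
  push_cast
  rw [show scale X * n / 2 - scale X * k = scale X * (n - 2 * k) / 2 by ring]

theorem level_lt_posFun_minus {v : V X l} {m : ℕ} (h1 : 1 ≤ m) (h2 : m ≤ l) {n : ℤ}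
    (hv : coord v m = scale X * n / 2) (e k : ℤ) :
    scale X * (2 * e - 1) / 4 < posFun X l (posMinus X l k m) v ↔ e ≤ -n - 2 * k := by
  rw [← level_lt_iff (X := X), posFun_minus k h1 h2, hv]
  push_cast
  rw [show -(scale X * n / 2) - scale X * k = scale X * (-n - 2 * k) / 2 by ring]

theorem level_lt_posFun_top (ht : topIdx X = 1) (v : V X l) (e k : ℤ) :
    scale X * (2 * e - 1) / 4 < posFun X l (k * period X l + l) v ↔ e ≤ -2 * k := by
  rw [← level_lt_iff (X := X), posFun_top ht]
  push_cast
  rw [show -(scale X * k) = scale X * (-2 * k) / 2 by ring]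

theorem level_lt_posFun_zero (hz : zeroIdx X = 1) (v : V X l) (e k : ℤ) :
    scale X * (2 * e - 1) / 4 < posFun X l (k * period X l + period X l - 1) v ↔
      e ≤ -1 - 2 * k := by
  rw [← level_lt_iff (X := X), posFun_zero hz]
  push_cast
  rw [show -(scale X / 2) - scale X * k = scale X * (-1 - 2 * k) / 2 by ring]

theorem mem_completion_fundamentalAbacus (refl : ℤ → ℤ) (j : Fin (l + 1)) (x : ℤ) :
    x ∈ completion refl (fundamentalAbacus X l j) ↔
      (start X l j = ⊥ ∧ x < j) ∨ (start X l j ≠ ⊥ ∧ (x ∈ halfBeads X l j ∨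
        ¬ start X l j ≤ (x : WithBot ℤ) ∧ refl x ∉ halfBeads X l j)) := by
  by_cases h : start X l j = ⊥ <;> simp [completion, fundamentalAbacus, h]

/-- The completed abacus of `Λ_j`. -/
theorem completion_fundamentalAbacus_cases (hl : X.Admissible l) (hX : X ≠ .A1)
    (j : Fin (l + 1)) (x : ℤ) :
    (levelNum X l j = 1 ∧ ¬ (ZeroFork X ∧ (j : ℕ) = 1) ∧ ¬ (X = .D1 ∧ (j : ℕ) + 1 = l) ∧
      (x ∈ completion (posRefl X l j) (fundamentalAbacus X l j) ↔ x < j)) ∨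
    (levelNum X l j = 1 ∧ (ZeroFork X ∧ (j : ℕ) = 1) ∧
      (x ∈ completion (posRefl X l j) (fundamentalAbacus X l j) ↔ x = 0 ∨ x < -1)) ∨
    (levelNum X l j = 0 ∧ (j : ℕ) = l ∧ ¬ (ZeroFork X ∧ (j : ℕ) = 1) ∧
      (x ∈ completion (posRefl X l j) (fundamentalAbacus X l j) ↔ x < l + topIdx X)) ∨
    (levelNum X l j = 0 ∧ ¬ (ZeroFork X ∧ (j : ℕ) = 1) ∧ (X = .D1 ∧ (j : ℕ) + 1 = l) ∧
      (x ∈ completion (posRefl X l j) (fundamentalAbacus X l j) ↔ x = l ∨ x < l - 1)) := by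
  have hz : ZeroFork X → zeroIdx X = 0 := by rintro (rfl | rfl | rfl) <;> rfl
  have hD : X = .D1 → topIdx X = 0 := by rintro rfl; rfl
  have hD4 := fun h => four_le_rank (X := X) hl h
  have hf3 := fun h => three_le_rank (X := X) hl h
  rw [mem_completion_fundamentalAbacus]
  rcases start_cases hl hX j with ⟨h, h', h''⟩ | ⟨h, h', h'', e⟩ | ⟨h, h', h'', e⟩ |
    ⟨h, h', h'', e⟩ | ⟨h, h', h'', e⟩
  · exact .inl ⟨levelNum_of_eq_bot h, h', h'', by simp [h]⟩
  · refine .inl ⟨levelNum_of_eq_zero hl h, fun h => by omega,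
      fun h => by have := hD4 h.1; omega, ?_⟩
    rw [e, h, WithBot.coe_le_coe, h'']
    simp
  · refine .inr (.inl ⟨levelNum_of_eq_zero hl h, ⟨h', h''⟩, ?_⟩)
    rw [e, h, WithBot.coe_le_coe, posRefl_of_eq_zero h, hz h']
    simp
    omega
  · refine .inr (.inr (.inl ⟨levelNum_of_eq h, h'', fun h => by have := hf3 h.1; omega, ?_⟩))
    rw [e, h, WithBot.coe_le_coe]
    simp
  · refine .inr (.inr (.inr ⟨levelNum_of_eq h, fun h => by have := hD4 h'; omega,
      ⟨h', h''⟩, ?_⟩))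
    rw [e, h, WithBot.coe_le_coe, posRefl_of_eq_last hl h, hD h']
    simp
    omega

/-- At the vertex every functional is an integral number of half-units of the scale, so each kind of
position leaves an inequality between integers. -/
theorem mem_fundamental_iff (hl : X.Admissible l) (hX : X ≠ .A1) (j : Fin (l + 1)) (x : ℤ) :
    x ∈ completion (posRefl X l j) (fundamentalAbacus X l j) ↔
      scale X * (2 * levelNum X l j - 1) / 4 < posFun X l x ((positionModel hl hX).vertex j) := by
  classical
  have hl1 := one_le_rank hl
  have hv : ∀ m, 1 ≤ m → m ≤ l → coord ((positionModel hl hX).vertex j) m =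
      scale X * vertexNum X l j m / 2 := fun m h1 h2 => by
    rw [positionModel_vertex hl hX j h1 h2, vertexCoord_eq]
  generalize (positionModel hl hX).vertex j = v at hv
  have h0 := zeroIdx_cases X
  have h1 := topIdx_cases X
  have hf : ZeroFork X → zeroIdx X = 0 ∧ 3 ≤ l := fun h =>
    ⟨by rcases h with rfl | rfl | rfl <;> rfl, three_le_rank hl h⟩
  have hD : X = .D1 → topIdx X = 0 ∧ zeroIdx X = 0 ∧ 4 ≤ l := fun h => by
    have := four_le_rank hl h
    subst h; exact ⟨rfl, rfl, this⟩
  have hj := j.2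
  have hp : period X l = 2 * l + zeroIdx X + topIdx X := rfl
  have hN (k) := mul_period_cases hl k
  rcases completion_fundamentalAbacus_cases hl hX j x with ⟨e, e1, e2, e'⟩ | ⟨e, e1, e'⟩ |
    ⟨e, e2, e1, e'⟩ | ⟨e, e1, e2, e'⟩ <;> rw [e', e] <;> clear e' e
  · replace hv : ∀ m, 1 ≤ m → m ≤ l → coord v m =
        scale X * (if m ≤ (j : ℕ) then 1 else 0 : ℤ) / 2 := fun m h1 h2 => by
      rw [hv m h1 h2, vertexNum, if_neg e1, if_neg e2]
    rcases pos_cases hl x with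
      ⟨k, m, h1, h2, rfl⟩ | ⟨k, m, h1, h2, rfl⟩ | ⟨ht, k, rfl⟩ | ⟨hz, k, rfl⟩
    · rw [level_lt_posFun_plus h1 h2 (hv m h1 h2), posPlus_eq]
      have := hN k; split_ifs <;> omega
    · rw [level_lt_posFun_minus h1 h2 (hv m h1 h2), posMinus_eq]
      have := hN k; split_ifs <;> omega
    · rw [level_lt_posFun_top ht]
      have := hN k; omega
    · rw [level_lt_posFun_zero hz]
      have := hN k; omega
  · replace hv : ∀ m, 1 ≤ m → m ≤ l → coord v m =
        scale X * (if m = 1 then 2 else 0 : ℤ) / 2 := fun m h1 h2 => by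
      rw [hv m h1 h2, vertexNum, if_pos e1]
    have := hf e1.1
    rcases pos_cases hl x with
      ⟨k, m, h1, h2, rfl⟩ | ⟨k, m, h1, h2, rfl⟩ | ⟨ht, k, rfl⟩ | ⟨hz, k, rfl⟩
    · rw [level_lt_posFun_plus h1 h2 (hv m h1 h2), posPlus_eq]
      have := hN k; split_ifs <;> omega
    · rw [level_lt_posFun_minus h1 h2 (hv m h1 h2), posMinus_eq]
      have := hN k; have := hN (k + 1); rw [add_mul, one_mul] at this; split_ifs <;> omega
    · rw [level_lt_posFun_top ht]
      have := hN k; omega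
    · omega
  · replace hv : ∀ m, 1 ≤ m → m ≤ l → coord v m = scale X * (1 : ℤ) / 2 := fun m h1 h2 => by
      rw [hv m h1 h2, vertexNum, if_neg e1, if_neg (by omega), if_pos (by omega)]
    rcases pos_cases hl x with
      ⟨k, m, h1, h2, rfl⟩ | ⟨k, m, h1, h2, rfl⟩ | ⟨ht, k, rfl⟩ | ⟨hz, k, rfl⟩
    · rw [level_lt_posFun_plus h1 h2 (hv m h1 h2), posPlus_eq]
      have := hN k; omega
    · rw [level_lt_posFun_minus h1 h2 (hv m h1 h2), posMinus_eq]
      have := hN k; omega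
    · rw [level_lt_posFun_top ht]
      have := hN k; omega
    · rw [level_lt_posFun_zero hz]
      have := hN k; omega
  · replace hv : ∀ m, 1 ≤ m → m ≤ l → coord v m =
        scale X * (if m = l then -1 else 1 : ℤ) / 2 := fun m h1 h2 => by
      rw [hv m h1 h2, vertexNum, if_neg e1, if_pos e2]
    have := hD e2.1
    rcases pos_cases hl x with
      ⟨k, m, h1, h2, rfl⟩ | ⟨k, m, h1, h2, rfl⟩ | ⟨ht, k, rfl⟩ | ⟨hz, k, rfl⟩
    · rw [level_lt_posFun_plus h1 h2 (hv m h1 h2), posPlus_eq]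
      have := hN k; split_ifs <;> omega
    · rw [level_lt_posFun_minus h1 h2 (hv m h1 h2), posMinus_eq]
      have := hN k; split_ifs <;> omega
    · omega
    · omega

theorem vertex_determined (hl : X.Admissible l) (hX : X ≠ .A1) (j : Fin (l + 1)) {e : ℤ}
    (w w' : W X l)
    (h : ∀ x, scale X * (2 * e - 1) / 4 <
        posFun X l x ((w : Equiv.Perm (V X l)) ((positionModel hl hX).vertex j)) ↔
      scale X * (2 * e - 1) / 4 <
        posFun X l x ((w' : Equiv.Perm (V X l)) ((positionModel hl hX).vertex j))) :
    (w : Equiv.Perm (V X l)) ((positionModel hl hX).vertex j) =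
      (w' : Equiv.Perm (V X l)) ((positionModel hl hX).vertex j) := by
  refine coord_ext fun m h1 h2 => ?_
  rw [ambientDim_eq hX] at h2
  obtain ⟨n, hn⟩ := exists_half_coord hl hX j w h1 h2
  obtain ⟨n', hn'⟩ := exists_half_coord hl hX j w' h1 h2
  have hplus (k : ℤ) := h (posPlus X l k m)
  have hminus (k : ℤ) := h (posMinus X l k m)
  simp only [level_lt_posFun_plus h1 h2 hn, level_lt_posFun_plus h1 h2 hn',
    level_lt_posFun_minus h1 h2 hn, level_lt_posFun_minus h1 h2 hn'] at hplus hminus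
  -- The positions labelled `m` recover the integer part of `(n - e) / 2`, leaving the parity of `n`
  -- open. Those labelled `-m` recover the integer part of `(-n - e) / 2`, and the two together
  -- determine `n`.
  have := hplus ((n - e) / 2)
  have := hplus ((n' - e) / 2)
  have := hminus ((-n - e) / 2)
  have := hminus ((-n' - e) / 2)
  obtain rfl : n = n' := by omega
  rw [hn, hn']

/-- The abacus models of the types other than `A_l^{(1)}`. -/
noncomputable def abacusModel (hl : X.Admissible l) (hX : X ≠ .A1) (j : Fin (l + 1)) :
    AbacusModel X l j where
  toPositionModel := positionModel hl hX
  refl := posRefl X l j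
  centre := if start X l j = ((0 : ℤ) : WithBot ℤ) then scale X else 0
  fn_refl := posFun_posRefl hl hX j
  not_start_le_refl hs x hx := by
    have := zeroIdx_nonneg X
    rcases (start_eq hl hX j).resolve_left hs with ⟨h, -⟩ | ⟨h, -⟩
    · rw [posRefl_of_eq_zero h, h, WithBot.coe_le_coe]
      rw [h, WithBot.coe_le_coe] at hx
      omega
    · rw [posRefl_of_eq_last hl h, h, WithBot.coe_le_coe]
      rw [h, WithBot.coe_le_coe] at hx
      have := topIdx_nonneg X
      omega
  start_le_refl x hx hne := by
    have := zeroIdx_cases X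
    have := topIdx_cases X
    rcases start_eq hl hX j with h | ⟨h, -⟩ | ⟨h, -⟩
    · rw [h]; exact bot_le
    · rw [posRefl_of_eq_zero h] at hne ⊢
      rw [h, WithBot.coe_le_coe] at hx ⊢
      omega
    · rw [posRefl_of_eq_last hl h] at hne ⊢
      rw [h, WithBot.coe_le_coe] at hx ⊢
      omega
  move_iff i R A := by
    have hperm : (positionModel hl hX).perm = posPerm hl hX := rfl
    rw [move_iff_movePair hX, hperm]
    refine or_congr ⟨?_, ?_⟩ ?_
    · rintro ⟨x, y, h, hlo, rfl, rfl⟩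
      obtain ⟨h1, rfl⟩ := (movePair_iff hl hX i).1 h
      exact ⟨x, h1, hlo, rfl, rfl⟩
    · rintro ⟨x, h1, hlo, rfl, rfl⟩
      exact ⟨x, _, movePair_of_lt hl hX i h1, hlo, rfl, rfl⟩
    · have key := exists_cross_iff hl hX i j A
      rw [← and_or_left, ← and_or_left, ← and_or_left, ← key]
      constructor
      · rintro ⟨hR, x, y, h, hx, hy, rfl⟩
        obtain ⟨-, rfl⟩ := (movePair_iff hl hX i).1 h
        exact ⟨x, hx, hy, hR, rfl⟩
      · rintro ⟨x, hx, hy, hR, rfl⟩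
        refine ⟨hR, x, _, movePair_of_lt hl hX i ?_, hx, hy, rfl⟩
        exact WithBot.coe_lt_coe.1 ((not_le.1 hx).trans_le hy)
  level := scale X * (2 * levelNum X l j - 1) / 4
  mem_fundamental := mem_fundamental_iff hl hX j
  vertex_determined := vertex_determined hl hX j

end TypeBCD

end CoreAbacus

theorem lemma3p12 (X : CoreAbacus.AffineType) (l : ℕ) (hl : X.Admissible l) (j : Fin (l + 1)) :
    -- `ρ` is the action of `W` on abaci; it is determined by the `σ_i`, which generate `W`
    ∃ ρ : CoreAbacus.W X l →* Function.End (CoreAbacus.Abacus (CoreAbacus.start X l j)),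
      (∀ i : Fin (l + 1), ρ (CoreAbacus.gen X l i) = CoreAbacus.sigma X l i) ∧
      (∀ B, CoreAbacus.IsCore X l j B →
        ∃! w, w ∈ CoreAbacus.grassmannian X l j ∧
          ρ w (CoreAbacus.fundamentalAbacus X l j) = B) ∧
      Set.BijOn (fun w => ρ w (CoreAbacus.fundamentalAbacus X l j))
        (CoreAbacus.grassmannian X l j) {B | CoreAbacus.IsCore X l j B} ∧
      ∃ Φ : CoreAbacus.Abacus (CoreAbacus.start X l j) → Set (CoreAbacus.V X l),
        Set.BijOn Φ {B | CoreAbacus.IsCore X l j B} (CoreAbacus.alcovesInCone X l j) ∧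
        ∀ w ∈ CoreAbacus.grassmannian X l j,
          Φ (ρ w (CoreAbacus.fundamentalAbacus X l j)) = CoreAbacus.alcove w⁻¹ := by
  by_cases hX : X = .A1
  · subst hX
    exact (CoreAbacus.TypeA.abacusModel hl j).main
  · exact (CoreAbacus.TypeBCD.abacusModel hl hX j).main
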